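/- Let $L$ be an even lattice of signature $(2,n)$ containing $2U=U\oplus U$, where $U$ is the even unimodular lattice with Gram matrix $\begin{pmatrix}0&1\\1&0\end{pmatrix}$. For a nondegenerate even lattice $N$ let $A_N=N^\vee/N$ be its discriminant group with its $\mathbb{Q}/2\mathbb{Z}$-valued quadratic form, and $\mathrm{O}(A_N)$ the group of automorphisms of $A_N$ preserving this form. Let $\mathrm{O}^+(L)$ be the subgroup of $\mathrm{O}(L)$ preserving a connected component of $\{\mathbb{C}\omega\in\mathbb{P}(L\otimes\mathbb{C}) : (\omega,\omega)=0,\ (\omega,\bar\omega)>0\}$, and let $\widetilde{\mathrm{O}}^+(L)$ be the subgroup of those elements of $\mathrm{O}^+(L)$ that act trivially on $A_L$. A primitive vector $l\in L$ with $(l,l)<0$ is called stably reflective if the reflection $\sigma_l(v)=v-\frac{2(v,l)}{(l,l)}l$ belongs to $\mathrm{O}^+(L)$ and acts as $\mathrm{id}$ or $-\mathrm{id}$ on $A_L$. Let $\mathrm{div}(l)$ be the natural number generating the ideal $(l,L)\subset\mathbb{Z}$. A stably reflective vector $l$ is * of type AI if $\sigma_l\equiv\mathrm{id}$ on $A_L$,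 $(l,l)=-2$ and $\mathrm{div}(l)=2$; * of type AII if $\sigma_l\equiv\mathrm{id}$ on $A_L$, $(l,l)=-2$ and $\mathrm{div}(l)=1$; * of type BI if $\sigma_l\equiv-\mathrm{id}$ but $\sigma_l\not\equiv\mathrm{id}$ on $A_L$, and $A_L\simeq\mathbb{Z}/D\oplus(\mathbb{Z}/2)^m$ as a group for some $D>2$, $m\ge0$ with $(l,l)=-D$ and $\mathrm{div}(l)=D$; * of type BII if $\sigma_l\equiv-\mathrm{id}$ but $\sigma_l\not\equiv\mathrm{id}$ on $A_L$, and $A_L\simeq\mathbb{Z}/D\oplus(\mathbb{Z}/2)^m$ as a group for some $D>2$, $m\ge0$ with $(l,l)=-D$ and $\mathrm{div}(l)=D/2$; * of type BIII if $\sigma_l\equiv-\mathrm{id}$ but $\sigma_l\not\equiv\mathrm{id}$ on $A_L$, and $A_L\simeq\mathbb{Z}/D$ as a group for some odd $D>2$ with $(l,l)=-2D$ and $\mathrm{div}(l)=D$. For each type $*\in\{\mathrm{AI},\mathrm{AII},\mathrm{BI},\mathrm{BII},\mathrm{BIII}\}$ let $\mathcal{R}(*)$ be the set of $\langle\widetilde{\mathrm{O}}^+(L),-1\rangle$-equivalence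 classes of stably reflective vectors of type $*$ in $L$. Then $\mathcal{R}(*)$ is finite and, with $K=l^\perp\cap L$ for any choice of representatives $l$ of the classes, $$\sum_{[l]\in\mathcal{R}(*)}\frac{|\mathrm{O}(A_K)/\pm1|}{|\mathrm{O}(A_L)/\pm1|}\le e_*(n),$$ where $e_{\mathrm{AI}}(n)=9$, $e_{\mathrm{AII}}(n)=2^{n-2}$, $e_{\mathrm{BI}}(n)=9$, $e_{\mathrm{BII}}(n)=2^{n+6}$ and $e_{\mathrm{BIII}}(n)=1$. -/

import Mathlib

open scoped TensorProduct

noncomputable section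

namespace OrthLattice

/-! ### Even lattices, their signature and their discriminant forms

A lattice is a finite free `ℤ`-module `L` with a symmetric `ℤ`-valued bilinear form `B`. -/

section Lattice

variable {L : Type*} [AddCommGroup L]

/-- The form is symmetric and even: `(x, x) ∈ 2ℤ` for all `x`. -/
structure IsEvenLattice (B : LinearMap.BilinForm ℤ L) : Prop where
  symm : ∀ x y, B x y = B y x
  even : ∀ x, Even (B x x)

/-- The real quadratic form `(x, x)` on `L ⊗ ℝ` is nondegenerate of signature `(p, q)`. The last
field, together with the first two, says that it is nondegenerate. -/
structure HasSignature (B : LinearMap.BilinForm ℤ L) (p q : ℕ) : Prop where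
  pos : sigPos (LinearMap.BilinMap.toQuadraticMap (LinearMap.BilinForm.baseChange ℝ B)) = p
  neg : sigNeg (LinearMap.BilinMap.toQuadraticMap (LinearMap.BilinForm.baseChange ℝ B)) = q
  rank : Module.finrank ℤ L = p + q

/-- `L` contains `2U = U ⊕ U`, where `U` is the hyperbolic plane with Gram matrix `(0 1; 1 0)`:
there are two hyperbolic pairs `e i, f i` spanning orthogonal planes. -/
def ContainsTwoU (B : LinearMap.BilinForm ℤ L) : Prop :=
  ∃ e f : Fin 2 → L, (∀ i j, B (e i) (e j) = 0) ∧ (∀ i j, B (f i) (f j) = 0) ∧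
    ∀ i j, B (e i) (f j) = if i = j then 1 else 0

/-- The `ℚ`-bilinear extension of the form to `L ⊗ ℚ`. -/
def ratForm (B : LinearMap.BilinForm ℤ L) : LinearMap.BilinForm ℚ (ℚ ⊗[ℤ] L) :=
  LinearMap.BilinForm.baseChange ℚ B

variable (L) in
/-- `L` as a subgroup of `L ⊗ ℚ`. -/
def lat : Submodule ℤ (ℚ ⊗[ℤ] L) :=
  LinearMap.range (TensorProduct.mk ℤ ℚ L 1)

/-- The dual lattice `L^∨ = {v ∈ L ⊗ ℚ : (v, L) ⊆ ℤ}`. -/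
def dual (B : LinearMap.BilinForm ℤ L) : Submodule ℤ (ℚ ⊗[ℤ] L) :=
  (ratForm B).dualSubmodule (lat L)

/-- The discriminant group `A_L = L^∨ / L`. -/
abbrev Disc (B : LinearMap.BilinForm ℤ L) : Type _ :=
  dual B ⧸ (lat L).submoduleOf (dual B)

theorem ratForm_symm {B : LinearMap.BilinForm ℤ L} (hB : IsEvenLattice B) (v w : ℚ ⊗[ℤ] L) :
    ratForm B v w = ratForm B w v := by
  induction v using TensorProduct.induction_on with
  | zero => simp
  | add x y hx hy => simp [hx, hy]
  | tmul q x =>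
    induction w using TensorProduct.induction_on with
    | zero => simp
    | add x y hx hy => simp [hx, hy]
    | tmul r y => simp [ratForm, hB.symm x y, mul_comm]

theorem discForm_aux {B : LinearMap.BilinForm ℤ L} (hB : IsEvenLattice B) (v w : dual B)
    (h : -v + w ∈ ((lat L).submoduleOf (dual B)).toAddSubgroup) :
    ((ratForm B v v : ℚ) : AddCircle (2 : ℚ)) = ((ratForm B w w : ℚ) : AddCircle (2 : ℚ)) := by
  obtain ⟨x, hx⟩ : ∃ x : L, (1 : ℚ) ⊗ₜ[ℤ] x = -(v : ℚ ⊗[ℤ] L) + w := h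
  have hw : (w : ℚ ⊗[ℤ] L) = v + (1 : ℚ) ⊗ₜ[ℤ] x := by rw [hx]; abel
  obtain ⟨k, hk⟩ := hB.even x
  obtain ⟨m, hm⟩ := Submodule.mem_one.mp (v.2 ((1 : ℚ) ⊗ₜ[ℤ] x) ⟨x, rfl⟩)
  have hxx : ratForm B ((1 : ℚ) ⊗ₜ[ℤ] x) ((1 : ℚ) ⊗ₜ[ℤ] x) = 2 * (k : ℚ) := by
    simp [ratForm, hk]; ring
  refine QuotientAddGroup.eq.mpr (AddSubgroup.mem_zmultiples_iff.mpr ⟨m + k, ?_⟩)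
  rw [hw]
  simp only [map_add, LinearMap.add_apply, hxx,
    ratForm_symm hB ((1 : ℚ) ⊗ₜ[ℤ] x) (v : ℚ ⊗[ℤ] L), ← hm]
  simp
  ring

/-- The discriminant form `A_L → ℚ/2ℤ`, `[v] ↦ (v, v) mod 2ℤ`. -/
def discForm {B : LinearMap.BilinForm ℤ L} (hB : IsEvenLattice B) : Disc B → AddCircle (2 : ℚ) :=
  Quotient.lift (fun v : dual B => ((ratForm B v v : ℚ) : AddCircle (2 : ℚ)))
    fun v w h => discForm_aux hB v w (QuotientAddGroup.leftRel_apply.mp h)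

/-- `O(A_L)`: the group automorphisms of `A_L` preserving the discriminant form. -/
def discO {B : LinearMap.BilinForm ℤ L} (hB : IsEvenLattice B) :
    Subgroup (Disc B ≃ₗ[ℤ] Disc B) where
  carrier := {φ | ∀ x, discForm hB (φ x) = discForm hB x}
  one_mem' _ := rfl
  mul_mem' {a b} ha hb x := (ha (b x)).trans (hb x)
  inv_mem' {a} ha x := by
    have h : a (a⁻¹ x) = x := a.apply_symm_apply x
    rw [← ha (a⁻¹ x), h]

theorem discForm_neg {B : LinearMap.BilinForm ℤ L} (hB : IsEvenLattice B) (x : Disc B) :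
    discForm hB (-x) = discForm hB x := by
  induction x using Quotient.inductionOn with
  | _ v =>
    change ((ratForm B (-v : dual B) (-v : dual B) : ℚ) : AddCircle (2 : ℚ)) = (ratForm B v v : ℚ)
    simp

/-- `-1 ∈ O(A_L)`. -/
def discNeg {B : LinearMap.BilinForm ℤ L} (hB : IsEvenLattice B) : discO hB :=
  ⟨LinearEquiv.neg ℤ, discForm_neg hB⟩

/-- The order of `O(A_L)/±1`. -/
def cardDiscO {B : LinearMap.BilinForm ℤ L} (hB : IsEvenLattice B) : ℕ :=
  Nat.card (discO hB ⧸ Subgroup.zpowers (discNeg hB))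

end Lattice

/-! ### Orthogonal groups -/

section Groups

variable {L : Type*} [AddCommGroup L]

/-- `O(L)`. -/
def orthGroup (B : LinearMap.BilinForm ℤ L) : Subgroup (L ≃ₗ[ℤ] L) where
  carrier := {g | ∀ x y, B (g x) (g y) = B x y}
  one_mem' _ _ := rfl
  mul_mem' {a b} ha hb x y := (ha (b x) (b y)).trans (hb x y)
  inv_mem' {a} ha x y := by
    have h : ∀ z, a (a⁻¹ z) = z := a.apply_symm_apply
    rw [← ha (a⁻¹ x) (a⁻¹ y), h, h]

/-- The extension of an automorphism of `L` to `L ⊗ ℚ`. -/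
def ratExt (g : L ≃ₗ[ℤ] L) : (ℚ ⊗[ℤ] L) →ₗ[ℚ] (ℚ ⊗[ℤ] L) :=
  (g : L →ₗ[ℤ] L).baseChange ℚ

/-- `φ ≡ id` on `A_L = L^∨ / L`, for a linear map `φ` of `L ⊗ ℚ`. -/
def ActsAsId (B : LinearMap.BilinForm ℤ L) (φ : (ℚ ⊗[ℤ] L) →ₗ[ℚ] (ℚ ⊗[ℤ] L)) : Prop :=
  ∀ v ∈ dual B, φ v - v ∈ lat L

/-- `φ ≡ -id` on `A_L = L^∨ / L`, for a linear map `φ` of `L ⊗ ℚ`. -/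
def ActsAsNegId (B : LinearMap.BilinForm ℤ L) (φ : (ℚ ⊗[ℤ] L) →ₗ[ℚ] (ℚ ⊗[ℤ] L)) : Prop :=
  ∀ v ∈ dual B, φ v - (-v) ∈ lat L

theorem ratExt_mul (g h : L ≃ₗ[ℤ] L) (v : ℚ ⊗[ℤ] L) : ratExt (g * h) v = ratExt g (ratExt h v) := by
  induction v using TensorProduct.induction_on with
  | zero => simp
  | tmul q x => simp [ratExt]
  | add x y hx hy => simp [hx, hy]

theorem ratExt_one (v : ℚ ⊗[ℤ] L) : ratExt (1 : L ≃ₗ[ℤ] L) v = v := by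
  induction v using TensorProduct.induction_on with
  | zero => simp
  | tmul q x => simp [ratExt]
  | add x y hx hy => simp [hx, hy]

theorem ratExt_mem_lat (g : L ≃ₗ[ℤ] L) {v : ℚ ⊗[ℤ] L} (hv : v ∈ lat L) : ratExt g v ∈ lat L := by
  obtain ⟨x, rfl⟩ := hv
  exact ⟨g x, (LinearMap.baseChange_tmul _ _ _).symm⟩

/-- The stable orthogonal group `Õ(L)`, the kernel of `O(L) → O(A_L)`. -/
def stableGroup (B : LinearMap.BilinForm ℤ L) : Subgroup (L ≃ₗ[ℤ] L) where
  carrier := {g | g ∈ orthGroup B ∧ ActsAsId B (ratExt g)}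
  one_mem' := ⟨one_mem _, fun v _ => by rw [ratExt_one, sub_self]; exact zero_mem _⟩
  mul_mem' {a b} ha hb := ⟨mul_mem ha.1 hb.1, fun v hv => by
    have h1 := add_mem (ratExt_mem_lat a (hb.2 v hv)) (ha.2 v hv)
    rwa [map_sub, sub_add_sub_cancel, ← ratExt_mul] at h1⟩
  inv_mem' {a} ha := ⟨inv_mem ha.1, fun v hv => by
    have h1 := neg_mem (ratExt_mem_lat a⁻¹ (ha.2 v hv))
    rwa [map_sub, ← ratExt_mul, inv_mul_cancel, ratExt_one, neg_sub] at h1⟩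

/-- The euclidean topology of the finite-dimensional complex vector space `L ⊗ ℂ`. -/
abbrev complexTopology (L : Type*) [AddCommGroup L] : TopologicalSpace (ℂ ⊗[ℤ] L) :=
  moduleTopology ℂ (ℂ ⊗[ℤ] L)

/-- The quotient topology of the projective space `ℙ(L ⊗ ℂ)`. -/
abbrev projTopology (L : Type*) [AddCommGroup L] :
    TopologicalSpace (Projectivization ℂ (ℂ ⊗[ℤ] L)) :=
  letI := complexTopology L
  TopologicalSpace.coinduced (Projectivization.mk' ℂ : {v : ℂ ⊗[ℤ] L // v ≠ 0} → _) inferInstance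

variable (L) in
/-- Complex conjugation `ω ↦ ω̄` on `L ⊗ ℂ`. -/
def conjC : (ℂ ⊗[ℤ] L) →ₗ[ℤ] (ℂ ⊗[ℤ] L) :=
  LinearMap.rTensor L (Complex.conjAe.toLinearMap.restrictScalars ℤ)

/-- The set `{ℂω ∈ ℙ(L ⊗ ℂ) : (ω, ω) = 0, (ω, ω̄) > 0}`; the number `(ω, ω̄)` is always real.
In signature `(2, n)` this has two connected components (interchanged by complex conjugation),
each of which is a model of the type IV domain. -/
def periodSpace (B : LinearMap.BilinForm ℤ L) : Set (Projectivization ℂ (ℂ ⊗[ℤ] L)) :=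
  {p | ∃ (ω : ℂ ⊗[ℤ] L) (hω : ω ≠ 0), p = Projectivization.mk ℂ ω hω ∧
    LinearMap.BilinForm.baseChange ℂ B ω ω = 0 ∧
    0 < (LinearMap.BilinForm.baseChange ℂ B ω (conjC L ω)).re}

/-- The extension of an automorphism of `L` to `L ⊗ ℂ`. -/
def complexExt (g : L ≃ₗ[ℤ] L) : (ℂ ⊗[ℤ] L) ≃ₗ[ℂ] (ℂ ⊗[ℤ] L) :=
  g.baseChange ℤ ℂ L L

/-- The action of an automorphism of `L` on `ℙ(L ⊗ ℂ)`. -/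
def projAct (g : L ≃ₗ[ℤ] L) (p : Projectivization ℂ (ℂ ⊗[ℤ] L)) : Projectivization ℂ (ℂ ⊗[ℤ] L) :=
  Projectivization.map (complexExt g).toLinearMap (complexExt g).injective p

theorem projAct_mul (g h : L ≃ₗ[ℤ] L) (p : Projectivization ℂ (ℂ ⊗[ℤ] L)) :
    projAct (g * h) p = projAct g (projAct h p) := by
  have key : ∀ v : ℂ ⊗[ℤ] L, complexExt (g * h) v = complexExt g (complexExt h v) := by
    intro v
    induction v using TensorProduct.induction_on with
    | zero => simp
    | tmul q x => simp [complexExt]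
    | add x y hx hy => simp [hx, hy]
  induction p using Projectivization.ind with
  | h v hv => simp [projAct, Projectivization.map_mk, key]

theorem projAct_one (p : Projectivization ℂ (ℂ ⊗[ℤ] L)) : projAct (1 : L ≃ₗ[ℤ] L) p = p := by
  have key : ∀ v : ℂ ⊗[ℤ] L, complexExt (1 : L ≃ₗ[ℤ] L) v = v := by
    intro v
    induction v using TensorProduct.induction_on with
    | zero => simp
    | tmul q x => simp [complexExt]
    | add x y hx hy => simp [hx, hy]
  induction p using Projectivization.ind with
  | h v hv => simp [projAct, Projectivization.map_mk, key]

/-- The connected component of `p` in the space `periodSpace B`. -/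
def component (B : LinearMap.BilinForm ℤ L) (p : Projectivization ℂ (ℂ ⊗[ℤ] L)) :
    Set (Projectivization ℂ (ℂ ⊗[ℤ] L)) :=
  @connectedComponentIn _ (projTopology L) (periodSpace B) p

theorem orthGroup_projAct_mem (B : LinearMap.BilinForm ℤ L) {g : L ≃ₗ[ℤ] L} (hg : g ∈ orthGroup B)
    {p : Projectivization ℂ (ℂ ⊗[ℤ] L)} (hp : p ∈ periodSpace B) : projAct g p ∈ periodSpace B := by
  obtain ⟨ω, hω, rfl, h1, h2⟩ := hp
  have key : ∀ v w : ℂ ⊗[ℤ] L, LinearMap.BilinForm.baseChange ℂ B (complexExt g v) (complexExt g w)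
      = LinearMap.BilinForm.baseChange ℂ B v w := by
    intro v w
    induction v using TensorProduct.induction_on with
    | zero => simp
    | add x y hx hy => simp [hx, hy]
    | tmul q x =>
      induction w using TensorProduct.induction_on with
      | zero => simp
      | add x y hx hy => simp [hx, hy]
      | tmul r y => simp [complexExt, hg x y]
  have kc : ∀ v : ℂ ⊗[ℤ] L, conjC L (complexExt g v) = complexExt g (conjC L v) := by
    intro v
    induction v using TensorProduct.induction_on with
    | zero => simp
    | add x y hx hy => simp [hx, hy]
    | tmul q x => rfl
  refine ⟨complexExt g ω, by simpa using hω, ?_, ?_, ?_⟩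
  · simp [projAct, Projectivization.map_mk]
  · rw [key, h1]
  · rw [kc, key]; exact h2

/-- `O⁺(L)`: the isometries of `L` that map each connected component of `periodSpace B` to itself.
When there are two components, preserving one of them is the same as preserving both. -/
def orthGroupPlus (B : LinearMap.BilinForm ℤ L) : Subgroup (L ≃ₗ[ℤ] L) where
  carrier := {g | g ∈ orthGroup B ∧ ∀ p ∈ periodSpace B, projAct g p ∈ component B p}
  one_mem' := ⟨one_mem _, fun p hp => by
    rw [projAct_one]
    exact @mem_connectedComponentIn _ (projTopology L) _ _ hp⟩
  mul_mem' {a b} ha hb := ⟨mul_mem ha.1 hb.1, fun p hp => by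
    have h1 := hb.2 p hp
    have h2 := ha.2 _ (orthGroup_projAct_mem B hb.1 hp)
    rw [projAct_mul]
    unfold component at *
    rwa [@connectedComponentIn_eq _ (projTopology L) _ _ _ h1]⟩
  inv_mem' {a} ha := ⟨inv_mem ha.1, fun p hp => by
    have h0 := orthGroup_projAct_mem B (inv_mem ha.1) hp
    have h1 := ha.2 _ h0
    rw [← projAct_mul, mul_inv_cancel, projAct_one] at h1
    unfold component at *
    rw [← @connectedComponentIn_eq _ (projTopology L) _ _ _ h1]
    exact @mem_connectedComponentIn _ (projTopology L) _ _ h0⟩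

/-- `Õ⁺(L)`. -/
def stableGroupPlus (B : LinearMap.BilinForm ℤ L) : Subgroup (L ≃ₗ[ℤ] L) :=
  stableGroup B ⊓ orthGroupPlus B

/-- The group `⟨Õ⁺(L), -1⟩`. -/
def stableGroupPlusNeg (B : LinearMap.BilinForm ℤ L) : Subgroup (L ≃ₗ[ℤ] L) :=
  stableGroupPlus B ⊔ Subgroup.zpowers (LinearEquiv.neg ℤ)

end Groups

/-! ### Stably reflective vectors -/

section Reflective

variable {L : Type*} [AddCommGroup L]

/-- `l` is primitive: it is divisible in `L` by no integer other than `±1` (so `l ≠ 0`). -/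
def IsPrimitiveVec (l : L) : Prop :=
  ∀ (k : ℤ) (x : L), l = k • x → IsUnit k

/-- `div(l)`: the natural number that generates the ideal `(l, L)` of `ℤ`. -/
def divisor (B : LinearMap.BilinForm ℤ L) (l : L) : ℕ :=
  (Submodule.IsPrincipal.generator (LinearMap.range (B l))).natAbs

/-- The reflection `σ_l(v) = v - (2 (v, l) / (l, l)) l` of `L ⊗ ℚ`. -/
def reflection (B : LinearMap.BilinForm ℤ L) (l : L) : (ℚ ⊗[ℤ] L) →ₗ[ℚ] (ℚ ⊗[ℤ] L) :=
  LinearMap.id -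
    (((2 : ℚ) / (B l l : ℚ)) • (ratForm B).flip ((1 : ℚ) ⊗ₜ[ℤ] l)).smulRight ((1 : ℚ) ⊗ₜ[ℤ] l)

theorem reflection_apply (B : LinearMap.BilinForm ℤ L) (l : L) (v : ℚ ⊗[ℤ] L) :
    reflection B l v =
      v - (2 * ratForm B v ((1 : ℚ) ⊗ₜ[ℤ] l) / (B l l : ℚ)) • ((1 : ℚ) ⊗ₜ[ℤ] l) := by
  simp [reflection, div_mul_eq_mul_div]

/-- Stably reflective vectors: primitive vectors of negative norm with `σ_l ∈ O⁺(L)` and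
`σ_l ≡ ± id` on `A_L`. -/
structure IsStablyReflective (B : LinearMap.BilinForm ℤ L) (l : L) : Prop where
  primitive : IsPrimitiveVec l
  norm_neg : B l l < 0
  mem : ∃ g ∈ orthGroupPlus B, ratExt g = reflection B l
  acts : ActsAsId B (reflection B l) ∨ ActsAsNegId B (reflection B l)

/-- The five types of stably reflective vectors. -/
inductive ReflType : Type
  | AI
  | AII
  | BI
  | BII
  | BIII

/-- The numerical conditions that distinguish the types. In the types BI, BII, BIII the number
`D > 2` is tied to the discriminant group: `A_L ≃ ℤ/D ⊕ (ℤ/2)^m`, with `m = 0` in type BIII. -/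
def TypeCondition (B : LinearMap.BilinForm ℤ L) (l : L) : ReflType → Prop
  | .AI => ActsAsId B (reflection B l) ∧ B l l = -2 ∧ divisor B l = 2
  | .AII => ActsAsId B (reflection B l) ∧ B l l = -2 ∧ divisor B l = 1
  | .BI => (ActsAsNegId B (reflection B l) ∧ ¬ ActsAsId B (reflection B l)) ∧
      ∃ D m : ℕ, 2 < D ∧ Nonempty (Disc B ≃+ ZMod D × (Fin m → ZMod 2)) ∧
        B l l = -(D : ℤ) ∧ divisor B l = D
  | .BII => (ActsAsNegId B (reflection B l) ∧ ¬ ActsAsId B (reflection B l)) ∧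
      ∃ D m : ℕ, 2 < D ∧ Nonempty (Disc B ≃+ ZMod D × (Fin m → ZMod 2)) ∧
        B l l = -(D : ℤ) ∧ 2 * divisor B l = D
  | .BIII => (ActsAsNegId B (reflection B l) ∧ ¬ ActsAsId B (reflection B l)) ∧
      ∃ D : ℕ, 2 < D ∧ Nonempty (Disc B ≃+ ZMod D) ∧ Odd D ∧
        B l l = -2 * (D : ℤ) ∧ divisor B l = D

/-- The stably reflective vectors of `L` of type `t`. -/
def ReflVec (B : LinearMap.BilinForm ℤ L) (t : ReflType) : Type _ :=
  {l : L // IsStablyReflective B l ∧ TypeCondition B l t}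

/-- Equivalence of stably reflective vectors of type `t` under `⟨Õ⁺(L), -1⟩`. -/
instance reflSetoid (B : LinearMap.BilinForm ℤ L) (t : ReflType) : Setoid (ReflVec B t) :=
  (MulAction.orbitRel (stableGroupPlusNeg B) L).comap Subtype.val

/-- `ℛ(t)`: the set of `⟨Õ⁺(L), -1⟩`-equivalence classes of stably reflective vectors of
type `t`. -/
abbrev ReflClass (B : LinearMap.BilinForm ℤ L) (t : ReflType) : Type _ :=
  Quotient (reflSetoid B t)

/-- The orthogonal complement `K = l^⊥ ∩ L`. -/
abbrev complement (B : LinearMap.BilinForm ℤ L) (l : L) : Submodule ℤ L :=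
  LinearMap.ker (B l)

/-- The orthogonal complement `K = l^⊥ ∩ L` with the restricted form is again an even lattice. -/
theorem IsEvenLattice.complement {B : LinearMap.BilinForm ℤ L} (hB : IsEvenLattice B) (l : L) :
    IsEvenLattice (LinearMap.BilinForm.restrict B (complement B l)) where
  symm x y := hB.symm x y
  even x := hB.even x

/-- The ratio `|O(A_K)/±1| / |O(A_L)/±1|` with `K = l^⊥ ∩ L`. -/
def discRatio {B : LinearMap.BilinForm ℤ L} (hB : IsEvenLattice B) (l : L) : ℚ :=
  (cardDiscO (hB.complement l) : ℚ) / (cardDiscO hB : ℚ)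

/-- The bounds `e_t(n)`. -/
def bound (n : ℕ) : ReflType → ℚ
  | .AI => 9
  | .AII => (2 : ℚ) ^ ((n : ℤ) - 2)
  | .BI => 9
  | .BII => (2 : ℚ) ^ ((n : ℤ) + 6)
  | .BIII => 1

end Reflective

end OrthLattice

end

/-! Write d = div(l) and (l,l) = -de. For vectors of a fixed type, d is determined by A_L, and e is
1 (AI, BI) or 2 (AII, BII, BIII). By Eichler's criterion, which uses 2U, the class of l under the
group generated by the stable group and -1 depends only on ±x, where x = [l/d] in A_L
(`reflClass_eq`). Hence the set of classes injects into the finite group A_L.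

The form on A_L is a subquotient of the forms on (ℤl)^∨ and A_K, glued along an element y of A_K
with ey = 0 and norm d/e (`exists_isGluing`). An isometry of pairs (A_K, y) → (A_K', y') therefore
induces an isometry of A_L carrying x to x'. Two consequences follow. The stabilizer of y in O(A_K)
embeds into the stabilizer of x in O(A_L), so |O(A_K)| ≤ |orbit of y| · |Stab(x)|. The number of
O(A_L)-orbits met by the elements x is at most the number of isometry classes of pairs (A_K, y).

Over one O(A_L)-orbit the quotients |Stab(x)|/|O(A_L)| add up to at most 1, because distinct classes
have distinct x (`sum_card_stab_le`). The sum is thus at most (a bound for the orbit of y) · (number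
of orbits of x), up to a factor 2 coming from the quotients by ±1. When x ≠ -x this factor is
recovered, because both x and -x count in the orbit (`two_mul_sum_card_stab_le`).

It remains to bound the two factors. AI: y = 0, and x is 2-torsion of norm -1/2. There are at most 4
orbits of such elements (`exists_classify_minusHalf`). AII: x = 0, so there is one orbit. The orbit
of y embeds into A_L[2], which has at most 2^(n-2) elements because 2U splits off. BI: y = 0 and A_K
is 2-elementary of known order, which leaves at most 8 isometry classes
(`exists_classify_two_elementary`). BII: y ≠ 0 and A_K is 2-elementary, which leaves at most 32
classes of pairs (`exists_classify_pointed`). The orbit of y is bounded by |A_K|. BIII: A_K has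
order 2 and y generates it, so everything is unique. -/

open scoped TensorProduct

noncomputable section

namespace OrthLattice

/-! ### Finite quadratic modules -/

section QuadMod

open QuadraticMap

/-- Quadratic forms on an abelian group with values in `ℚ/2ℤ`. -/
abbrev QuadMod (A : Type*) [AddCommGroup A] := QuadraticMap ℤ A (AddCircle (2 : ℚ))

theorem coe_eq_iff {a b : ℚ} :
    (a : AddCircle (2 : ℚ)) = b ↔ ∃ m : ℤ, b = a + 2 * m := by
  rw [QuotientAddGroup.eq, AddSubgroup.mem_zmultiples_iff]
  constructor
  · rintro ⟨m, hm⟩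
    exact ⟨m, by rw [zsmul_eq_mul] at hm; linarith⟩
  · rintro ⟨m, hm⟩
    exact ⟨m, by rw [zsmul_eq_mul, hm]; ring⟩

theorem coe_eq_zero_iff {a : ℚ} : (a : AddCircle (2 : ℚ)) = 0 ↔ ∃ m : ℤ, a = 2 * m := by
  rw [eq_comm, ← AddCircle.coe_zero, coe_eq_iff]
  simp

theorem exists_coe_eq (a : AddCircle (2 : ℚ)) : ∃ r : ℚ, a = r :=
  ⟨_, (QuotientAddGroup.mk_surjective a).choose_spec.symm⟩

theorem exists_of_nsmul_eq_zero {n : ℕ} (hn : n ≠ 0) {a : AddCircle (2 : ℚ)}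
    (h : (n : ℤ) • a = 0) : ∃ k : ℤ, a = ((2 * k / n : ℚ) : AddCircle (2 : ℚ)) := by
  obtain ⟨r, rfl⟩ := exists_coe_eq a
  rw [← AddCircle.coe_zsmul, coe_eq_zero_iff] at h
  obtain ⟨m, hm⟩ := h
  refine ⟨m, ?_⟩
  congr 1
  rw [eq_div_iff (by exact_mod_cast hn), ← hm]
  simp [mul_comm]

variable {A : Type*} [AddCommGroup A] (Q : QuadMod A)

/-- The form is nondegenerate. -/
def Nondeg : Prop := ∀ x, (∀ y, polar Q x y = 0) → x = 0

/-- The group of isometries of a quadratic module. -/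
def isoGroup : Subgroup (A ≃ₗ[ℤ] A) where
  carrier := {φ | ∀ x, Q (φ x) = Q x}
  one_mem' _ := rfl
  mul_mem' {a b} ha hb x := (ha (b x)).trans (hb x)
  inv_mem' {a} ha x := by
    have h : a (a⁻¹ x) = x := a.apply_symm_apply x
    rw [← ha (a⁻¹ x), h]

variable {Q}

theorem isoGroup_polar {g : A ≃ₗ[ℤ] A} (hg : g ∈ isoGroup Q) (x y : A) :
    polar Q (g x) (g y) = polar Q x y := by
  simp only [polar, ← map_add, hg _]

variable (Q) in
/-- Two elements are equivalent under the group of isometries. -/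
def IsoEquiv (x y : A) : Prop := ∃ g ∈ isoGroup Q, g x = y

theorem IsoEquiv.refl (x : A) : IsoEquiv Q x x := ⟨1, one_mem _, rfl⟩

theorem IsoEquiv.symm {x y : A} (h : IsoEquiv Q x y) : IsoEquiv Q y x := by
  obtain ⟨g, hg, rfl⟩ := h
  exact ⟨g⁻¹, inv_mem hg, g.symm_apply_apply x⟩

theorem IsoEquiv.trans {x y z : A} (h : IsoEquiv Q x y) (h' : IsoEquiv Q y z) :
    IsoEquiv Q x z := by
  obtain ⟨g, hg, rfl⟩ := h
  obtain ⟨g', hg', rfl⟩ := h'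
  exact ⟨g' * g, mul_mem hg' hg, rfl⟩

/-- An additive self-map of a finite nondegenerate module preserving the form is an isometry. -/
theorem isoEquiv_of_hom [Finite A] (hQ : Nondeg Q) (f : A →+ A) (hf : ∀ x, Q (f x) = Q x) (x : A) :
    IsoEquiv Q x (f x) := by
  have hinj : Function.Injective f := by
    rw [injective_iff_map_eq_zero]
    intro a ha
    refine hQ a fun y => ?_
    have h : polar Q (f a) (f y) = polar Q a y := by simp only [polar, ← map_add, hf]
    rw [← h, ha, polar_zero_left]
  have hbij := (Finite.injective_iff_bijective).mp hinj
  exact ⟨LinearEquiv.ofBijective f.toIntLinearMap hbij, fun x => hf x, rfl⟩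

/-- Here `polar Q` is twice the bilinear form, with values modulo 2. The pairing (v,u) = k/n mod 1
therefore reads 2k/n, and for n = 2 a pairing of 1/2 reads as the polar value 1. -/
theorem exists_polar_of_smul {n : ℕ} (hn : n ≠ 0) {u : A} (hu : (n : ℤ) • u = 0) (v : A) :
    ∃ k : ℤ, polar Q v u = ((2 * k / n : ℚ) : AddCircle (2 : ℚ)) :=
  exists_of_nsmul_eq_zero hn (by rw [← polar_smul_right, hu, polar_zero_right])

/-- The homomorphism `v ↦ k(v) w`, where `p(v, u) = 2 k(v) / n`. -/
theorem exists_rankOne {M : Type*} [AddCommGroup M] {n : ℕ} (hn : n ≠ 0) {u : A} {w : M}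
    (hu : (n : ℤ) • u = 0)
    (hw : (n : ℤ) • w = 0) : ∃ R : A →+ M, ∀ v (k : ℤ),
      polar Q v u = ((2 * k / n : ℚ) : AddCircle (2 : ℚ)) → R v = k • w := by
  have hn' : (n : ℚ) ≠ 0 := by exact_mod_cast hn
  -- The integer `k` is determined by the pairing only modulo `n`. Since `n` kills `w`, the multiple
  -- `k • w` is well defined.
  have key : ∀ k k' : ℤ, ((2 * k / n : ℚ) : AddCircle (2 : ℚ)) = ((2 * k' / n : ℚ) : AddCircle (2 : ℚ)) →
      k • w = k' • w := by
    intro k k' h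
    rw [coe_eq_iff] at h
    obtain ⟨m, hm⟩ := h
    have : k' = k + n * m := by
      field_simp at hm
      exact_mod_cast hm
    rw [this, add_smul, mul_comm, mul_smul, hw, smul_zero, add_zero]
  choose k hk using fun v => exists_polar_of_smul (Q := Q) hn hu v
  refine ⟨AddMonoidHom.mk' (fun v => k v • w) fun a b => ?_, fun v k' h => key _ _ ?_⟩
  · rw [← add_smul]
    apply key
    rw [← hk, polar_add_left, hk, hk, ← AddCircle.coe_add]
    congr 1
    push_cast
    ring
  · rw [← hk, h]

theorem map_add' (x y : A) : Q (x + y) = Q x + Q y + polar Q x y := by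
  simp [polar]

/-- The transvection-like reflection in a `2`-torsion element of norm `1`. -/
theorem isoEquiv_of_polar_eq_zero [Finite A] (hQ : Nondeg Q) {x x' : A} {c : ℚ}
    (hx : (2 : ℤ) • x = 0) (hx' : (2 : ℤ) • x' = 0) (hc : c = 1 / 2 ∨ c = -1 / 2)
    (hq : Q x = c) (hq' : Q x' = c) (h : polar Q x x' = 0) : IsoEquiv Q x x' := by
  -- As c = ±1/2 and x ⊥ x', the norm of w is 2c = 1 mod 2. The reflection in w is v ↦ v + kw with k
  -- = polar(v,w), the sign being irrelevant because 2w = 0. It sends x to x + w = x', and it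
  -- changes norms by k² + k·k = 2k².
  set w := x + x' with hw
  have hw2 : ((2 : ℕ) : ℤ) • w = 0 := by rw [hw]; push_cast; rw [smul_add, hx, hx', add_zero]
  have hqw : Q w = ((1 : ℚ) : AddCircle (2 : ℚ)) := by
    rw [hw, map_add', hq, hq', h, add_zero, ← AddCircle.coe_add, coe_eq_iff]
    rcases hc with rfl | rfl
    · exact ⟨0, by norm_num⟩
    · exact ⟨1, by norm_num⟩
  obtain ⟨R, hR⟩ := exists_rankOne (Q := Q) two_ne_zero hw2 hw2
  have h1 : (AddMonoidHom.id A + R) x = x' := by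
    have : polar Q x w = ((2 * (1 : ℤ) / (2 : ℕ) : ℚ) : AddCircle (2 : ℚ)) := by
      rw [hw, polar_add_right, h, add_zero, polar_self, hq, ← AddCircle.coe_nsmul, coe_eq_iff]
      rcases hc with rfl | rfl
      · exact ⟨0, by norm_num⟩
      · exact ⟨1, by norm_num⟩
    simp only [AddMonoidHom.add_apply, AddMonoidHom.id_apply, hR x 1 this, hw]
    rw [one_smul, ← add_assoc, ← two_smul ℤ x, hx, zero_add]
  rw [← h1]
  refine isoEquiv_of_hom hQ _ (fun v => ?_) x
  obtain ⟨k, hk⟩ := exists_polar_of_smul (Q := Q) two_ne_zero hw2 v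
  simp only [AddMonoidHom.add_apply, AddMonoidHom.id_apply, hR v k hk]
  rw [map_add', QuadraticMap.map_smul, polar_smul_right, hqw, hk, ← AddCircle.coe_zsmul, ← AddCircle.coe_zsmul,
    add_assoc, ← AddCircle.coe_add, add_eq_left, coe_eq_zero_iff]
  exact ⟨k * k, by push_cast; simp; ring⟩

/-! ### Orbits of 2-torsion elements of norm -1/2 -/

/-- The set of `2`-torsion elements of norm `-1/2`. -/
def IsMinusHalf (Q : QuadMod A) (x : A) : Prop :=
  (2 : ℤ) • x = 0 ∧ Q x = ((-1 / 2 : ℚ) : AddCircle (2 : ℚ))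

theorem polar_of_two_torsion {u : A} (hu : (2 : ℤ) • u = 0) (v : A) :
    polar Q v u = 0 ∨ polar Q v u = ((1 : ℚ) : AddCircle (2 : ℚ)) := by
  obtain ⟨k, hk⟩ := exists_polar_of_smul (Q := Q) two_ne_zero (u := u) (by exact_mod_cast hu) v
  rcases Int.even_or_odd' k with ⟨j, rfl | rfl⟩
  · left
    rw [hk, coe_eq_zero_iff]
    exact ⟨j, by push_cast; ring⟩
  · right
    rw [hk, coe_eq_iff]
    exact ⟨-j, by push_cast; ring⟩

theorem IsMinusHalf.polar_self {x : A} (hx : IsMinusHalf Q x) :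
    polar Q x x = ((1 : ℚ) : AddCircle (2 : ℚ)) := by
  rw [QuadraticMap.polar_self, hx.2, ← AddCircle.coe_nsmul, coe_eq_iff]
  exact ⟨1, by norm_num⟩

theorem IsMinusHalf.polar_eq_one [Finite A] (hQ : Nondeg Q) {x x' : A} (hx : IsMinusHalf Q x)
    (hx' : IsMinusHalf Q x') (h : ¬ IsoEquiv Q x x') :
    polar Q x x' = ((1 : ℚ) : AddCircle (2 : ℚ)) := by
  rcases polar_of_two_torsion (Q := Q) hx'.1 x with h0 | h1
  · exact absurd (isoEquiv_of_polar_eq_zero hQ hx.1 hx'.1 (Or.inr rfl) hx.2 hx'.2 h0) h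
  · exact h1

theorem one_add_one_eq : ((1 : ℚ) : AddCircle (2 : ℚ)) + ((1 : ℚ) : AddCircle (2 : ℚ)) = 0 := by
  rw [← AddCircle.coe_add, coe_eq_zero_iff]
  exact ⟨1, by norm_num⟩

theorem one_ne : ((1 : ℚ) : AddCircle (2 : ℚ)) ≠ 0 := by
  rw [Ne, coe_eq_zero_iff]
  rintro ⟨m, hm⟩
  have : (1 : ℤ) = 2 * m := by exact_mod_cast hm
  omega

/-- Translation of `x` by `2 s`. -/
theorem isoEquiv_add_two_smul [Finite A] (hQ : Nondeg Q) {x s : A} (hx : IsMinusHalf Q x)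
    (hs : (4 : ℤ) • s = 0) (hxs : polar Q s x = 0)
    (hq : ∃ k : ℤ, Q s = ((k : ℚ) : AddCircle (2 : ℚ))) : IsoEquiv Q x (x + (2 : ℤ) • s) := by
  obtain ⟨k0, hk0⟩ := hq
  -- normal form of the norm of `s` and the sign
  obtain ⟨k, t, hk, hkt⟩ : ∃ k t : ℤ, Q s = ((k : ℚ) : AddCircle (2 : ℚ)) ∧
      ((k = 0 ∧ t = 1) ∨ (k = 1 ∧ t = -1)) := by
    rcases Int.even_or_odd' k0 with ⟨j, rfl | rfl⟩
    · exact ⟨0, 1, by rw [hk0, coe_eq_iff]; exact ⟨-j, by push_cast; ring⟩, Or.inl ⟨rfl, rfl⟩⟩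
    · exact ⟨1, -1, by rw [hk0, coe_eq_iff]; exact ⟨-j, by push_cast; ring⟩, Or.inr ⟨rfl, rfl⟩⟩
  have h4 : ((4 : ℕ) : ℤ) • (x + t • s) = 0 := by
    push_cast
    rw [smul_add, smul_comm, hs, smul_zero, add_zero, show (4 : ℤ) = 2 * 2 by norm_num, mul_smul,
      hx.1, smul_zero]
  have h22 : ((2 : ℕ) : ℤ) • ((2 : ℤ) • s) = 0 := by
    rw [smul_smul]; exact_mod_cast hs
  -- The isometry is v ↦ v + l(x + ts) + 2es, where polar(v,s) = l/2 and polar(v,x) = e. The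
  -- l²-terms of the change of norm are l²(-1/2 + k + t/2). They cancel for exactly the two pairs
  -- (k,t) chosen above, and all other terms are even.
  obtain ⟨R, hR⟩ := exists_rankOne (Q := Q) (n := 4) (by norm_num) (u := s) (w := x + t • s)
    (by exact_mod_cast hs) h4
  obtain ⟨E, hE⟩ := exists_rankOne (Q := Q) (n := 2) (by norm_num) (u := x) (w := (2 : ℤ) • s)
    (by exact_mod_cast hx.1) h22
  have h1 : (AddMonoidHom.id A + R + E) x = x + (2 : ℤ) • s := by
    have e1 : polar Q x s = ((2 * (0 : ℤ) / (4 : ℕ) : ℚ) : AddCircle (2 : ℚ)) := by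
      rw [polar_comm, hxs]; simp
    have e2 : polar Q x x = ((2 * (1 : ℤ) / (2 : ℕ) : ℚ) : AddCircle (2 : ℚ)) := by
      rw [hx.polar_self]; norm_num
    simp only [AddMonoidHom.add_apply, AddMonoidHom.id_apply, hR x 0 e1, hE x 1 e2]
    simp
  rw [← h1]
  refine isoEquiv_of_hom hQ _ (fun v => ?_) x
  obtain ⟨l, hl⟩ := exists_polar_of_smul (Q := Q) (n := 4) (by norm_num) (u := s)
    (by exact_mod_cast hs) v
  obtain ⟨e, he⟩ := exists_polar_of_smul (Q := Q) (n := 2) (by norm_num) (u := x)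
    (by exact_mod_cast hx.1) v
  simp only [AddMonoidHom.add_apply, AddMonoidHom.id_apply, hR v l hl, hE v e he]
  have hss : polar Q s s = ((2 * k : ℚ) : AddCircle (2 : ℚ)) := by
    rw [QuadraticMap.polar_self, hk, ← AddCircle.coe_nsmul]; simp
  have hxs' : polar Q x s = 0 := by rw [polar_comm, hxs]
  rw [map_add', map_add' v, QuadraticMap.map_smul, QuadraticMap.map_smul, map_add' x, QuadraticMap.map_smul,
    QuadraticMap.map_smul]
  simp only [polar_smul_right, polar_smul_left, polar_add_left, polar_add_right, hss, hxs',
    hl, he, hk, hx.2, smul_zero, add_zero, zero_add]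
  simp only [← AddCircle.coe_zsmul, ← AddCircle.coe_add]
  rw [add_assoc, add_assoc, add_assoc, ← AddCircle.coe_add, ← AddCircle.coe_add, ← AddCircle.coe_add,
    add_eq_left, coe_eq_zero_iff]
  rcases hkt with ⟨rfl, rfl⟩ | ⟨rfl, rfl⟩
  · exact ⟨e * l, by push_cast; simp; ring⟩
  · exact ⟨2 * e ^ 2 - e * l, by push_cast; simp; ring⟩

/-- The form identifies the `2`-torsion of `A` with the dual of `A / 2A`. -/
theorem exists_two_torsion_polar_eq_one [Finite A] (hQ : Nondeg Q) {r : A}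
    (hr : ¬ ∃ t, r = (2 : ℤ) • t) :
    ∃ z, (2 : ℤ) • z = 0 ∧ polar Q z r = ((1 : ℚ) : AddCircle (2 : ℚ)) := by
  classical
  let m : A →+ A := zsmulAddGroupHom 2
  have hm : ∀ a, m a = (2 : ℤ) • a := fun a => rfl
  let C := A ⧸ m.range
  let _ : Module (ZMod 2) C := AddCommGroup.zmodModule (n := 2) fun c => by
    induction c using QuotientAddGroup.induction_on with
    | H a =>
      rw [← QuotientAddGroup.mk_nsmul, QuotientAddGroup.eq_zero_iff]
      exact ⟨a, by rw [hm]; exact_mod_cast rfl⟩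
  have : Finite C := inferInstance
  -- The groups A[2], A/2A and the dual of A/2A have the same order. Pairing gives a map from A[2]
  -- to this dual, injective by nondegeneracy and hence onto. So a functional that does not vanish
  -- at `r` comes from some `z`.
  have hcard : Nat.card m.ker = Nat.card C := by
    have h1 := m.ker.card_mul_index
    have h2 := m.range.card_mul_index
    rw [AddSubgroup.index_ker] at h1
    have h3 : 0 < Nat.card m.range := Nat.card_pos
    have : Nat.card m.range * Nat.card m.ker = Nat.card m.range * m.range.index := by
      rw [h2, mul_comm, h1]
    exact Nat.eq_of_mul_eq_mul_left h3 this
  have hdual : Nat.card (Module.Dual (ZMod 2) C) = Nat.card C := by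
    rw [Module.natCard_eq_pow_finrank (K := ZMod 2), Module.natCard_eq_pow_finrank (K := ZMod 2) (V := C),
      Subspace.dual_finrank_eq]
  have hR : ∀ z : m.ker, ∃ f : Module.Dual (ZMod 2) C, ∀ v (k : ℤ),
      polar Q v z.1 = ((k : ℚ) : AddCircle (2 : ℚ)) → f (v : C) = k := by
    rintro ⟨z, hz⟩
    have hz2 : ((2 : ℕ) : ℤ) • z = 0 := hz
    obtain ⟨R, hR⟩ := exists_rankOne (Q := Q) two_ne_zero hz2
      (w := (1 : ZMod 2)) (by decide)
    refine ⟨AddMonoidHom.toZModLinearMap 2 (QuotientAddGroup.lift m.range R ?_), ?_⟩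
    · rintro _ ⟨a, rfl⟩
      rw [hm, AddMonoidHom.mem_ker, map_zsmul]
      generalize R a = b
      revert b; decide
    · intro v k h
      change R v = k
      rw [hR v k (by rw [h]; congr 1; push_cast; ring)]
      simp
  choose f hf using hR
  have hinj : Function.Injective f := by
    intro z z' h
    have key : ∀ v, polar Q v z.1 = polar Q v z'.1 := by
      intro v
      have hz : (2 : ℤ) • z.1 = 0 := z.2
      have hz' : (2 : ℤ) • z'.1 = 0 := z'.2
      have e := congrArg (fun g => g (v : C)) h
      have e0 : ∀ w : m.ker, polar Q v w.1 = 0 → f w (v : C) = 0 := fun w hw => by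
        rw [hf w v 0 (by rw [hw]; simp)]; simp
      have e1 : ∀ w : m.ker, polar Q v w.1 = ((1 : ℚ) : AddCircle (2 : ℚ)) → f w (v : C) = 1 :=
        fun w hw => by rw [hf w v 1 (by rw [hw]; simp)]; simp
      rcases polar_of_two_torsion (Q := Q) hz v with h0 | h0 <;>
      rcases polar_of_two_torsion (Q := Q) hz' v with h1 | h1
      · rw [h0, h1]
      · simp [e0 z h0, e1 z' h1] at e
      · simp [e1 z h0, e0 z' h1] at e
      · rw [h0, h1]
    apply Subtype.ext
    rw [← sub_eq_zero]
    refine hQ _ fun y => ?_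
    rw [polar_comm, polar_sub_right, key, sub_self]
  have : Finite (Module.Dual (ZMod 2) C) := Nat.finite_of_card_ne_zero (by
    rw [hdual]; exact Nat.card_pos.ne')
  have hsurj : Function.Surjective f :=
    ((Nat.bijective_iff_injective_and_card f).mpr ⟨hinj, hcard.trans hdual.symm⟩).2
  have hrC : (r : C) ≠ 0 := by
    rw [Ne, QuotientAddGroup.eq_zero_iff]
    rintro ⟨t, ht⟩
    exact hr ⟨t, ht.symm⟩
  obtain ⟨g, hg⟩ : ∃ g : Module.Dual (ZMod 2) C, g (r : C) ≠ 0 := by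
    by_contra! h
    exact hrC ((Module.forall_dual_apply_eq_zero_iff (ZMod 2) _).mp h)
  obtain ⟨z, rfl⟩ := hsurj g
  have hz : (2 : ℤ) • z.1 = 0 := z.2
  refine ⟨z.1, hz, ?_⟩
  rw [polar_comm]
  rcases polar_of_two_torsion (Q := Q) hz r with h0 | h0
  · exact absurd (by rw [hf z r 0 (by rw [h0]; simp)]; simp) hg
  · exact h0

/-- The norm is an integer. -/
def IsIntNorm (Q : QuadMod A) (x : A) : Prop := ∃ k : ℤ, Q x = ((k : ℚ) : AddCircle (2 : ℚ))

/-- The norm is a half-integer. -/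
def IsHalfNorm (Q : QuadMod A) (x : A) : Prop :=
  ∃ k : ℤ, Q x = ((k + 1 / 2 : ℚ) : AddCircle (2 : ℚ))

theorem int_or_half_of_four_smul {x : A} (h : (4 : ℤ) • Q x = 0) :
    IsIntNorm Q x ∨ IsHalfNorm Q x := by
  obtain ⟨k, hk⟩ := exists_of_nsmul_eq_zero (n := 4) (by norm_num) (a := Q x) (by exact_mod_cast h)
  rcases Int.even_or_odd' k with ⟨j, rfl | rfl⟩
  · exact Or.inl ⟨j, by rw [hk]; congr 1; push_cast; ring⟩
  · exact Or.inr ⟨j, by rw [hk]; congr 1; push_cast; ring⟩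

theorem int_or_half_of_two_torsion {x : A} (hx : (2 : ℤ) • x = 0) :
    IsIntNorm Q x ∨ IsHalfNorm Q x := by
  apply int_or_half_of_four_smul
  have : (4 : ℤ) • Q x = Q ((2 : ℤ) • x) := by rw [QuadraticMap.map_smul]; rfl
  rw [this, hx, map_zero]

theorem IsMinusHalf.four_smul_eq_zero {x s : A} (hx : IsMinusHalf Q x)
    (hxs : IsMinusHalf Q (x + (2 : ℤ) • s)) : (4 : ℤ) • s = 0 := by
  have := hxs.1
  rw [smul_add, hx.1, zero_add, smul_smul] at this
  exact this

/-- Inequivalent elements of norm `-1/2` congruent modulo `2A` differ by twice an orthogonal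
element of half-integral norm. -/
theorem exists_of_not_isoEquiv [Finite A] (hQ : Nondeg Q) {x x' : A} (hx : IsMinusHalf Q x)
    (hx' : IsMinusHalf Q x') (h : ¬ IsoEquiv Q x x') (hc : ∃ t, x' - x = (2 : ℤ) • t) :
    ∃ s, x' = x + (2 : ℤ) • s ∧ (4 : ℤ) • s = 0 ∧ polar Q s x = 0 ∧ IsHalfNorm Q s := by
  obtain ⟨t, ht⟩ := hc
  have ht' : x' = x + (2 : ℤ) • t := by rw [← ht]; abel
  have hp := hx.polar_eq_one hQ hx' h
  obtain ⟨s, hs, hsx⟩ : ∃ s, x' = x + (2 : ℤ) • s ∧ polar Q s x = 0 := by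
    rcases polar_of_two_torsion (Q := Q) hx.1 t with h0 | h0
    · exact ⟨t, ht', h0⟩
    -- Adding `x` leaves 2t unchanged, as 2x = 0, and shifts the pairing with `x` by polar(x,x) = 1.
    · refine ⟨t + x, by rw [smul_add, hx.1, add_zero, ht'], ?_⟩
      rw [polar_add_left, h0, hx.polar_self, one_add_one_eq]
  have hs4 : (4 : ℤ) • s = 0 := hx.four_smul_eq_zero (hs ▸ hx')
  refine ⟨s, hs, hs4, hsx, ?_⟩
  have h4 : (4 : ℤ) • Q s = 0 := by
    have e : (4 : ℤ) • Q s = Q ((2 : ℤ) • s) := by rw [QuadraticMap.map_smul]; rfl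
    have e2 : Q x' = Q x + Q ((2 : ℤ) • s) := by
      rw [hs, map_add', polar_smul_right, polar_comm, hsx, smul_zero, add_zero]
    rw [hx'.2, hx.2, eq_comm, add_eq_left] at e2
    rw [e, e2]
  -- An element `s` of integral norm would make x and x + 2s equivalent by translation.
  rcases int_or_half_of_four_smul h4 with h0 | h0
  · exact absurd (hs ▸ isoEquiv_add_two_smul hQ hx hs4 hsx h0) h
  · exact h0

/-- In a coset of `2A` there are at most two classes of elements of norm `-1/2`. -/
theorem isoEquiv_of_same_coset [Finite A] (hQ : Nondeg Q) {x₀ x₁ x₂ : A} (h₀ : IsMinusHalf Q x₀)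
    (h₁ : IsMinusHalf Q x₁) (h₂ : IsMinusHalf Q x₂) (h01 : ¬ IsoEquiv Q x₀ x₁)
    (h02 : ¬ IsoEquiv Q x₀ x₂) (c1 : ∃ t, x₁ - x₀ = (2 : ℤ) • t)
    (c2 : ∃ t, x₂ - x₀ = (2 : ℤ) • t) : IsoEquiv Q x₁ x₂ := by
  obtain ⟨s₁, hs1, hs1', hp1, k1, hk1⟩ := exists_of_not_isoEquiv hQ h₀ h₁ h01 c1
  obtain ⟨s₂, hs2, hs2', hp2, k2, hk2⟩ := exists_of_not_isoEquiv hQ h₀ h₂ h02 c2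
  have hx2 : x₂ = x₁ + (2 : ℤ) • (s₂ - s₁) := by rw [hs1, hs2, smul_sub]; abel
  obtain ⟨k, hk⟩ := exists_polar_of_smul (Q := Q) (n := 4) (by norm_num) (u := s₁)
    (by exact_mod_cast hs1') s₂
  have hs4 : (4 : ℤ) • (s₂ - s₁) = 0 := by rw [smul_sub, hs1', hs2', sub_zero]
  have hp : polar Q (s₂ - s₁) x₁ = ((k : ℚ) : AddCircle (2 : ℚ)) := by
    rw [hs1, polar_add_right, polar_sub_left, hp1, hp2, polar_smul_right, polar_sub_left, hk,
      polar_self, hk1, ← AddCircle.coe_nsmul, ← AddCircle.coe_sub, ← AddCircle.coe_zsmul, sub_zero,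
      zero_add, coe_eq_iff]
    exact ⟨2 * k1 + 1, by simp; ring⟩
  have hq : Q (s₂ - s₁) = ((k1 + k2 + 1 - k / 2 : ℚ) : AddCircle (2 : ℚ)) := by
    rw [sub_eq_add_neg, map_add', QuadraticMap.map_neg, polar_neg_right, hk, hk1, hk2,
      ← AddCircle.coe_neg, ← AddCircle.coe_add, ← AddCircle.coe_add, coe_eq_iff]
    exact ⟨0, by push_cast; ring⟩
  -- The element s₂ - s₁ has norm -k/2 mod 1 and polar pairing k with x₁. For even k the translation
  -- by 2(s₂ - s₁) applies. For odd k, s₂ - s₁ + x₁ has the same double, and adding x₁ corrects both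
  -- the norm and the pairing.
  rcases Int.even_or_odd' k with ⟨j, rfl | rfl⟩
  · rw [hx2]
    refine isoEquiv_add_two_smul hQ h₁ hs4 ?_ ⟨k1 + k2 + 1 - j, ?_⟩
    · rw [hp, coe_eq_zero_iff]; exact ⟨j, by push_cast; ring⟩
    · rw [hq]; congr 1; push_cast; ring
  · have hx2' : x₂ = x₁ + (2 : ℤ) • (s₂ - s₁ + x₁) := by rw [smul_add, h₁.1, add_zero, ← hx2]
    rw [hx2']
    refine isoEquiv_add_two_smul hQ h₁ ?_ ?_ ⟨k1 + k2 + 1 + j, ?_⟩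
    · rw [smul_add, hs4, zero_add, show (4 : ℤ) = 2 * 2 by norm_num, mul_smul, h₁.1, smul_zero]
    · rw [polar_add_left, hp, h₁.polar_self, ← AddCircle.coe_add, coe_eq_zero_iff]
      exact ⟨j + 1, by push_cast; ring⟩
    · rw [map_add', hq, h₁.2, hp, ← AddCircle.coe_add, ← AddCircle.coe_add]
      congr 1; push_cast; ring

/-- Elements of norm `-1/2` in three different cosets of `2A` are not pairwise inequivalent. -/
theorem isoEquiv_of_distinct_cosets [Finite A] (hQ : Nondeg Q) {x₀ x₁ x₂ : A}
    (h₀ : IsMinusHalf Q x₀) (h₁ : IsMinusHalf Q x₁) (h₂ : IsMinusHalf Q x₂)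
    (h01 : ¬ IsoEquiv Q x₀ x₁) (h02 : ¬ IsoEquiv Q x₀ x₂) (c1 : ¬ ∃ t, x₁ - x₀ = (2 : ℤ) • t)
    (c2 : ¬ ∃ t, x₂ - x₀ = (2 : ℤ) • t) (c12 : ¬ ∃ t, x₁ - x₂ = (2 : ℤ) • t) :
    IsoEquiv Q x₁ x₂ := by
  -- If the three elements are pairwise inequivalent, all their polar pairings are 1. Then r₁ and r₂
  -- are isotropic, orthogonal to x₀ and to each other, and independent modulo 2A. By duality
  -- between A[2] and A/2A, pairings with r₁ and r₂ can be prescribed on A[2]. This is used to build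
  -- an element of norm -1/2 orthogonal to two of the three, which makes those two equivalent.
  by_contra h12
  have p01 := h₀.polar_eq_one hQ h₁ h01
  have p02 := h₀.polar_eq_one hQ h₂ h02
  have p12 := h₁.polar_eq_one hQ h₂ h12
  set r₁ := x₁ - x₀ with hr1
  set r₂ := x₂ - x₀ with hr2
  have q1 : polar Q x₀ r₁ = 0 := by rw [hr1, polar_sub_right, p01, h₀.polar_self, sub_self]
  have q2 : polar Q x₀ r₂ = 0 := by rw [hr2, polar_sub_right, p02, h₀.polar_self, sub_self]
  have r12 : polar Q r₁ r₂ = 0 := by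
    rw [hr1, polar_sub_left, q2, sub_zero, hr2, polar_sub_right, p12, polar_comm, p01, sub_self]
  have e1 : x₁ = x₀ + r₁ := by rw [hr1]; abel
  have e2 : x₂ = x₀ + r₂ := by rw [hr2]; abel
  have t1 : (2 : ℤ) • r₁ = 0 := by rw [hr1, smul_sub, h₁.1, h₀.1, sub_zero]
  have t2 : (2 : ℤ) • r₂ = 0 := by rw [hr2, smul_sub, h₂.1, h₀.1, sub_zero]
  have n1 : Q r₁ = 0 := by
    have := h₁.2
    rwa [e1, map_add', q1, h₀.2, add_zero, add_eq_left] at this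
  have n2 : Q r₂ = 0 := by
    have := h₂.2
    rwa [e2, map_add', q2, h₀.2, add_zero, add_eq_left] at this
  -- adjust a `2`-torsion element so that it is orthogonal to `x₀`
  have adj : ∀ z, (2 : ℤ) • z = 0 → ∃ z', (2 : ℤ) • z' = 0 ∧ polar Q z' x₀ = 0 ∧
      polar Q z' r₁ = polar Q z r₁ ∧ polar Q z' r₂ = polar Q z r₂ := by
    intro z hz
    rcases polar_of_two_torsion (Q := Q) h₀.1 z with h | h
    · exact ⟨z, hz, h, rfl, rfl⟩
    · exact ⟨z + x₀, by rw [smul_add, hz, h₀.1, add_zero], by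
        rw [polar_add_left, h, h₀.polar_self, one_add_one_eq], by rw [polar_add_left, q1, add_zero],
        by rw [polar_add_left, q2, add_zero]⟩
  have cases1 : ∀ z, polar Q z r₁ = 0 ∨ polar Q z r₁ = ((1 : ℚ) : AddCircle (2 : ℚ)) :=
    polar_of_two_torsion t1
  have cases2 : ∀ z, polar Q z r₂ = 0 ∨ polar Q z r₂ = ((1 : ℚ) : AddCircle (2 : ℚ)) :=
    polar_of_two_torsion t2
  obtain ⟨za, ha, ha1⟩ := exists_two_torsion_polar_eq_one hQ c1
  obtain ⟨zb, hb, hb2⟩ := exists_two_torsion_polar_eq_one hQ c2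
  obtain ⟨zc, hc, hc12⟩ := exists_two_torsion_polar_eq_one hQ c12
  have hc12' : polar Q zc r₁ - polar Q zc r₂ = ((1 : ℚ) : AddCircle (2 : ℚ)) := by
    rw [← polar_sub_right, ← hc12]; congr 1; rw [hr1, hr2]; abel
  have neg1 : -((1 : ℚ) : AddCircle (2 : ℚ)) = ((1 : ℚ) : AddCircle (2 : ℚ)) :=
    neg_eq_of_add_eq_zero_left one_add_one_eq
  -- vectors with prescribed pairings
  obtain ⟨⟨z', hz', a1, a2⟩, ⟨z'', hz'', b1, b2⟩⟩ :
      (∃ z, (2 : ℤ) • z = 0 ∧ polar Q z r₁ = ((1 : ℚ) : AddCircle (2 : ℚ)) ∧ polar Q z r₂ = 0) ∧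
      (∃ z, (2 : ℤ) • z = 0 ∧ polar Q z r₁ = 0 ∧ polar Q z r₂ = ((1 : ℚ) : AddCircle (2 : ℚ))) := by
    have hadd : ∀ {z w : A}, (2 : ℤ) • z = 0 → (2 : ℤ) • w = 0 → (2 : ℤ) • (z + w) = 0 :=
      fun hz hw => by rw [smul_add, hz, hw, add_zero]
    rcases cases1 zc with h1 | h1 <;> rcases cases2 zc with h2 | h2
    · rw [h1, h2, sub_zero] at hc12'; exact absurd hc12'.symm one_ne
    · refine ⟨?_, zc, hc, h1, h2⟩
      rcases cases2 za with h | h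
      · exact ⟨za, ha, ha1, h⟩
      · exact ⟨za + zc, hadd ha hc, by rw [polar_add_left, ha1, h1, add_zero], by
          rw [polar_add_left, h, h2, one_add_one_eq]⟩
    · refine ⟨⟨zc, hc, h1, h2⟩, ?_⟩
      rcases cases1 zb with h | h
      · exact ⟨zb, hb, h, hb2⟩
      · exact ⟨zb + zc, hadd hb hc, by rw [polar_add_left, h, h1, one_add_one_eq], by
          rw [polar_add_left, hb2, h2, add_zero]⟩
    · rw [h1, h2, sub_self] at hc12'; exact absurd hc12'.symm one_ne
  obtain ⟨z', hz', a0, a1', a2'⟩ := adj z' hz'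
  obtain ⟨z'', hz'', b0, b1', b2'⟩ := adj z'' hz''
  rw [a1] at a1'; rw [a2] at a2'; rw [b1] at b1'; rw [b2] at b2'
  -- no element of norm `-1/2` is orthogonal to two of the three
  have noOrth : ∀ y u v, IsMinusHalf Q y → IsMinusHalf Q u → IsMinusHalf Q v → polar Q y u = 0 →
      polar Q y v = 0 → IsoEquiv Q u v := by
    intro y u v hy hu hv h h'
    exact (isoEquiv_of_polar_eq_zero hQ hy.1 hu.1 (Or.inr rfl) hy.2 hu.2 h).symm.trans
      (isoEquiv_of_polar_eq_zero hQ hy.1 hv.1 (Or.inr rfl) hy.2 hv.2 h')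
  -- a half-integral norm can be shifted to `-1/2`
  have shift : ∀ z r, (2 : ℤ) • z = 0 → (2 : ℤ) • r = 0 → Q r = 0 →
      polar Q z r = ((1 : ℚ) : AddCircle (2 : ℚ)) → IsHalfNorm Q z →
      IsMinusHalf Q z ∨ IsMinusHalf Q (z + r) := by
    rintro z r hz hr hqr hp ⟨k, hk⟩
    rcases Int.even_or_odd' k with ⟨j, rfl | rfl⟩
    · right
      refine ⟨by rw [smul_add, hz, hr, add_zero], ?_⟩
      rw [map_add', hqr, hp, hk, add_zero, ← AddCircle.coe_add, coe_eq_iff]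
      exact ⟨-j - 1, by push_cast; ring⟩
    · left
      refine ⟨hz, ?_⟩
      rw [hk, coe_eq_iff]
      exact ⟨-j - 1, by push_cast; ring⟩
  -- If z' had half-integral norm, then z' or z' + r₁ would have norm -1/2 while being orthogonal to
  -- x₀ and x₂ = x₀ + r₂.
  have i1 : IsIntNorm Q z' := by
    refine (int_or_half_of_two_torsion hz').resolve_right fun hh => h02 ?_
    rcases shift z' r₁ hz' t1 n1 a1' hh with hy | hy
    · exact noOrth z' _ _ hy h₀ h₂ a0 (by rw [e2, polar_add_right, a0, a2', add_zero])
    · refine noOrth _ _ _ hy h₀ h₂ ?_ ?_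
      · rw [polar_add_left, a0, polar_comm, q1, add_zero]
      · rw [e2, polar_add_right, polar_add_left, polar_add_left, a0, a2', r12, polar_comm _ r₁, q1]
        simp
  have i2 : IsIntNorm Q z'' := by
    refine (int_or_half_of_two_torsion hz'').resolve_right fun hh => h01 ?_
    rcases shift z'' r₂ hz'' t2 n2 b2' hh with hy | hy
    · exact noOrth z'' _ _ hy h₀ h₁ b0 (by rw [e1, polar_add_right, b0, b1', add_zero])
    · refine noOrth _ _ _ hy h₀ h₁ ?_ ?_
      · rw [polar_add_left, b0, polar_comm, q2, add_zero]
      · rw [e1, polar_add_right, polar_add_left, polar_add_left, b0, b1', polar_comm _ r₂ r₁, r12,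
          polar_comm _ r₂, q2]
        simp
  set z := z' + z'' with hz
  have hz2 : (2 : ℤ) • z = 0 := by rw [hz, smul_add, hz', hz'', add_zero]
  have z0 : polar Q z x₀ = 0 := by rw [hz, polar_add_left, a0, b0, add_zero]
  have z1 : polar Q z r₁ = ((1 : ℚ) : AddCircle (2 : ℚ)) := by
    rw [hz, polar_add_left, a1', b1', add_zero]
  have z2 : polar Q z r₂ = ((1 : ℚ) : AddCircle (2 : ℚ)) := by
    rw [hz, polar_add_left, a2', b2', zero_add]
  have iz : IsIntNorm Q z := by
    obtain ⟨k, hk⟩ := i1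
    obtain ⟨l, hl⟩ := i2
    rcases polar_of_two_torsion (Q := Q) hz'' z' with h | h
    · exact ⟨k + l, by rw [hz, map_add', hk, hl, h, add_zero, ← AddCircle.coe_add]; push_cast; rfl⟩
    · exact ⟨k + l + 1, by
        rw [hz, map_add', hk, hl, h, ← AddCircle.coe_add, ← AddCircle.coe_add]; push_cast; rfl⟩
  -- shift the norm of `z` to `0`
  obtain ⟨w, hw2, w0, w1, w2, wq⟩ : ∃ w, (2 : ℤ) • w = 0 ∧ polar Q w x₀ = 0 ∧
      polar Q w r₁ = ((1 : ℚ) : AddCircle (2 : ℚ)) ∧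
      polar Q w r₂ = ((1 : ℚ) : AddCircle (2 : ℚ)) ∧ Q w = 0 := by
    obtain ⟨k, hk⟩ := iz
    rcases Int.even_or_odd' k with ⟨j, rfl | rfl⟩
    · exact ⟨z, hz2, z0, z1, z2, by rw [hk, coe_eq_zero_iff]; exact ⟨j, by push_cast; ring⟩⟩
    · refine ⟨z + r₁, by rw [smul_add, hz2, t1, add_zero], ?_, ?_, ?_, ?_⟩
      · rw [polar_add_left, z0, polar_comm, q1, add_zero]
      · rw [polar_add_left, z1, polar_self, n1, smul_zero, add_zero]
      · rw [polar_add_left, z2, r12, add_zero]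
      · rw [map_add', hk, n1, z1, add_zero, ← AddCircle.coe_add, coe_eq_zero_iff]
        exact ⟨j + 1, by push_cast; ring⟩
  -- The element w + x₀ has norm -1/2. Its pairing with xᵢ = x₀ + rᵢ is polar(w,rᵢ) + polar(x₀,xᵢ) =
  -- 1 + 1 = 0.
  refine h12 (noOrth (w + x₀) _ _ ⟨by rw [smul_add, hw2, h₀.1, add_zero], ?_⟩ h₁ h₂ ?_ ?_)
  · rw [map_add', wq, w0, h₀.2, zero_add, add_zero]
  · rw [polar_add_left, p01, e1, polar_add_right, w0, w1, zero_add, one_add_one_eq]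
  · rw [polar_add_left, p02, e2, polar_add_right, w0, w2, zero_add, one_add_one_eq]

/-- In a finite nondegenerate quadratic module there are at most four classes of `2`-torsion
elements of norm `-1/2`. -/
theorem exists_classify_minusHalf [Finite A] (hQ : Nondeg Q) :
    ∃ τ : A → Fin 4, ∀ x x', IsMinusHalf Q x → IsMinusHalf Q x' → τ x = τ x' →
      IsoEquiv Q x x' := by
  classical
  by_cases hne : ∃ a, IsMinusHalf Q a
  swap
  · exact ⟨fun _ => 0, fun x _ hx => absurd ⟨x, hx⟩ hne⟩
  obtain ⟨a, ha⟩ := hne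
  let D : A → A → Prop := fun x y => ∃ t, x - y = (2 : ℤ) • t
  have Dsymm : ∀ {x y}, D x y → D y x := fun {x y} ⟨t, ht⟩ => ⟨-t, by rw [smul_neg, ← ht]; abel⟩
  have Dtrans : ∀ {x y z}, D x y → D y z → D x z := fun {x y z} ⟨t, ht⟩ ⟨u, hu⟩ =>
    ⟨t + u, by rw [smul_add, ← ht, ← hu]; abel⟩
  -- If possible, `b` is taken outside both the coset of `a` modulo 2A and the orbit of `a`.
  -- Otherwise `b = a` is a harmless default, since the last class is then empty.
  obtain ⟨b, hb, hab⟩ : ∃ b, IsMinusHalf Q b ∧ ((∃ c, IsMinusHalf Q c ∧ ¬ D c a ∧ ¬ IsoEquiv Q c a) →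
      ¬ D b a ∧ ¬ IsoEquiv Q b a) := by
    by_cases h : ∃ c, IsMinusHalf Q c ∧ ¬ D c a ∧ ¬ IsoEquiv Q c a
    · obtain ⟨c, hc, hc'⟩ := h
      exact ⟨c, hc, fun _ => hc'⟩
    · exact ⟨a, ha, fun h' => absurd h' h⟩
  -- The four classes are the orbit of `a`, the orbit of `b`, the rest of the coset of `a`, and
  -- everything else. Elements of the last class lie in the coset of `b`, since otherwise three
  -- cosets would carry pairwise inequivalent elements. Each coset contributes at most one orbit
  -- besides that of its base point.
  let τ : A → Fin 4 := fun x =>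
    if IsoEquiv Q x a then 0 else if IsoEquiv Q x b then 1 else if D x a then 2 else 3
  refine ⟨τ, fun x x' hx hx' h => ?_⟩
  simp only [τ] at h
  by_cases e1 : IsoEquiv Q x a <;> by_cases e1' : IsoEquiv Q x' a
  · exact e1.trans e1'.symm
  · rw [if_pos e1, if_neg e1'] at h
    split_ifs at h <;> simp at h
  · rw [if_neg e1, if_pos e1'] at h
    split_ifs at h <;> simp at h
  rw [if_neg e1, if_neg e1'] at h
  by_cases e2 : IsoEquiv Q x b <;> by_cases e2' : IsoEquiv Q x' b
  · exact e2.trans e2'.symm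
  · rw [if_pos e2, if_neg e2'] at h
    split_ifs at h <;> simp at h
  · rw [if_neg e2, if_pos e2'] at h
    split_ifs at h <;> simp at h
  rw [if_neg e2, if_neg e2'] at h
  by_cases e3 : D x a <;> by_cases e3' : D x' a
  · exact isoEquiv_of_same_coset hQ ha hx hx' (fun h => e1 h.symm) (fun h => e1' h.symm) e3 e3'
  · simp [e3, e3'] at h
  · simp [e3, e3'] at h
  obtain ⟨c1, c2⟩ := hab ⟨x, hx, e3, e1⟩
  have key : ∀ y, IsMinusHalf Q y → ¬ IsoEquiv Q y a → ¬ IsoEquiv Q y b → ¬ D y a → D y b := by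
    intro y hy y1 y2 y3
    by_contra y4
    exact y2 (isoEquiv_of_distinct_cosets hQ ha hy hb (fun h => y1 h.symm) (fun h => c2 h.symm)
      y3 c1 y4)
  exact isoEquiv_of_same_coset hQ hb hx hx' (fun h => e2 h.symm) (fun h => e2' h.symm)
    (key x hx e1 e2 e3) (key x' hx' e1' e2' e3')

/-- In a `2`-elementary nondegenerate quadratic module there are at most two classes of
elements of norm `-1/2`. -/
theorem exists_classify_minusHalf_of_two_torsion [Finite A] (hQ : Nondeg Q)
    (h2 : ∀ x : A, (2 : ℤ) • x = 0) :
    ∃ τ : A → Fin 2, ∀ x x', IsMinusHalf Q x → IsMinusHalf Q x' → τ x = τ x' →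
      IsoEquiv Q x x' := by
  classical
  by_cases hne : ∃ a, IsMinusHalf Q a
  swap
  · exact ⟨fun _ => 0, fun x _ hx => absurd ⟨x, hx⟩ hne⟩
  obtain ⟨a, ha⟩ := hne
  refine ⟨fun x => if IsoEquiv Q x a then 0 else 1, fun x x' hx hx' h => ?_⟩
  by_cases e1 : IsoEquiv Q x a <;> by_cases e1' : IsoEquiv Q x' a
  · exact e1.trans e1'.symm
  · simp [e1, e1'] at h
  · simp [e1, e1'] at h
  -- Here 2A = 0, so cosets are single elements and only the three-coset statement is needed.
  have coset : ∀ {y z : A}, ¬ IsoEquiv Q y z → ¬ ∃ t, y - z = (2 : ℤ) • t := by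
    rintro y z hyz ⟨t, ht⟩
    rw [h2, sub_eq_zero] at ht
    exact hyz (ht ▸ IsoEquiv.refl _)
  by_contra hn
  exact hn (isoEquiv_of_distinct_cosets hQ ha hx hx' (fun h => e1 h.symm) (fun h => e1' h.symm)
    (coset e1) (coset e1') (coset hn))

end QuadMod

end OrthLattice

end

open scoped TensorProduct
noncomputable section
namespace OrthLattice
-- Extension of isometries and classification of 2-elementary modules
section QuadMod
open QuadraticMap
variable {A : Type*} [AddCommGroup A] {Q : QuadMod A} {A' : Type*} [AddCommGroup A'] {Q' : QuadMod A'}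

/-- Two nondegenerate quadratic modules that are quotients of the same quadratic module are
isometric. -/
theorem exists_isometry_of_surjective (hQ : Nondeg Q) (hQ' : Nondeg Q') {P : Type*}
    [AddCommGroup P] (F : P →+ A) (F' : P →+ A') (hF : Function.Surjective F)
    (hF' : Function.Surjective F') (h : ∀ p, Q' (F' p) = Q (F p)) :
    ∃ Ψ : A ≃ₗ[ℤ] A', (∀ x, Q' (Ψ x) = Q x) ∧ ∀ p, Ψ (F p) = F' p := by
  have hpol : ∀ p r, polar Q' (F' p) (F' r) = polar Q (F p) (F r) := fun p r => by
    simp only [polar, ← map_add, h]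
  -- By nondegeneracy, `F` and `F'` have the same kernel, namely the radical of the common form on
  -- `P`.
  have hker : ∀ p, F p = 0 → F' p = 0 := fun p hp => by
    refine hQ' _ fun y => ?_
    obtain ⟨r, rfl⟩ := hF' y
    rw [hpol, hp, polar_zero_left]
  have hker' : ∀ p, F' p = 0 → F p = 0 := fun p hp => by
    refine hQ _ fun y => ?_
    obtain ⟨r, rfl⟩ := hF y
    rw [← hpol, hp, polar_zero_left]
  have hwd : ∀ p r, F p = F r → F' p = F' r := fun p r hpr => by
    rw [← sub_eq_zero, ← map_sub]
    exact hker _ (by rw [map_sub, hpr, sub_self])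
  choose s hs using hF
  let f : A →+ A' := AddMonoidHom.mk' (fun a => F' (s a)) fun a b => by
    rw [← map_add]
    exact hwd _ _ (by rw [map_add, hs, hs, hs])
  have hf : ∀ p, f (F p) = F' p := fun p => hwd _ _ (hs _)
  have hbij : Function.Bijective f := by
    constructor
    · rw [injective_iff_map_eq_zero]
      intro a ha
      rw [← hs a]
      exact hker' _ ha
    · intro a'
      obtain ⟨p, rfl⟩ := hF' a'
      exact ⟨F p, hf p⟩
  refine ⟨LinearEquiv.ofBijective f.toIntLinearMap hbij, fun x => ?_, hf⟩
  change Q' (F' (s x)) = Q x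
  rw [h, hs]

theorem polar_sum_right {ι : Type*} (s : Finset ι) (x : A) (b : ι → A) :
    polar Q x (∑ i ∈ s, b i) = ∑ i ∈ s, polar Q x (b i) :=
  map_sum (polarBilin Q x) b s

theorem polar_sum_left {ι : Type*} (s : Finset ι) (x : A) (b : ι → A) :
    polar Q (∑ i ∈ s, b i) x = ∑ i ∈ s, polar Q (b i) x := by
  simp only [polar_comm _ _ x, polar_sum_right]

theorem map_sum_eq_of_gram {ι : Type*} {b : ι → A} {b' : ι → A'}
    (hq : ∀ i, Q' (b' i) = Q (b i)) (hp : ∀ i j, polar Q' (b' i) (b' j) = polar Q (b i) (b j))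
    (s : Finset ι) (f : ι → ℤ) : Q' (∑ i ∈ s, f i • b' i) = Q (∑ i ∈ s, f i • b i) := by
  classical
  induction s using Finset.induction_on with
  | empty => simp
  | insert i s hi ih =>
    rw [Finset.sum_insert hi, Finset.sum_insert hi, map_add', map_add', ih,
      QuadraticMap.map_smul, QuadraticMap.map_smul, hq, polar_sum_right, polar_sum_right]
    simp only [polar_smul_left, polar_smul_right, hp]

/-- Isometries of the orthogonal complements of two families with the same Gram matrix extend. -/
theorem exists_extension (hQ : Nondeg Q) (hQ' : Nondeg Q') {ι : Type*} [Fintype ι] {b : ι → A}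
    {b' : ι → A'} (hq : ∀ i, Q' (b' i) = Q (b i))
    (hp : ∀ i j, polar Q' (b' i) (b' j) = polar Q (b i) (b j))
    {C : Type*} [AddCommGroup C] (j : C →+ A) (j' : C →+ A') (hj : ∀ c, Q' (j' c) = Q (j c))
    (hbj : ∀ i c, polar Q (b i) (j c) = 0) (hbj' : ∀ i c, polar Q' (b' i) (j' c) = 0)
    (hs : ∀ a, ∃ (f : ι → ℤ) (c : C), a = ∑ i, f i • b i + j c)
    (hs' : ∀ a, ∃ (f : ι → ℤ) (c : C), a = ∑ i, f i • b' i + j' c) :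
    ∃ Ψ : A ≃ₗ[ℤ] A', (∀ x, Q' (Ψ x) = Q x) ∧ (∀ i, Ψ (b i) = b' i) ∧ ∀ c, Ψ (j c) = j' c := by
  classical
  let F : (ι → ℤ) × C →+ A :=
    AddMonoidHom.coprod ((Fintype.linearCombination ℤ b).toAddMonoidHom) j
  let F' : (ι → ℤ) × C →+ A' :=
    AddMonoidHom.coprod ((Fintype.linearCombination ℤ b').toAddMonoidHom) j'
  have hF : ∀ p, F p = ∑ i, p.1 i • b i + j p.2 := fun p => rfl
  have hF' : ∀ p, F' p = ∑ i, p.1 i • b' i + j' p.2 := fun p => rfl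
  obtain ⟨Ψ, h1, h2⟩ := exists_isometry_of_surjective hQ hQ' F F'
    (fun a => by obtain ⟨f, c, h⟩ := hs a; exact ⟨(f, c), h.symm⟩)
    (fun a => by obtain ⟨f, c, h⟩ := hs' a; exact ⟨(f, c), h.symm⟩) (fun p => by
      rw [hF, hF', map_add', map_add', hj, map_sum_eq_of_gram hq hp, polar_sum_left, polar_sum_left]
      simp only [polar_smul_left, hbj, hbj'])
  refine ⟨Ψ, h1, fun i => ?_, fun c => ?_⟩
  · have := h2 (Pi.single i 1, 0)
    rw [hF, hF'] at this
    simpa [Pi.single_apply] using this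
  · have := h2 (0, c)
    rw [hF, hF'] at this
    simpa using this

/-! ### Two-elementary quadratic modules -/

/-- An orthogonal family of vectors of half-integral norm. -/
def IsOrthFamily (Q : QuadMod A) {j : ℕ} (v : Fin j → A) : Prop :=
  ∀ i k, polar Q (v i) (v k) = if i = k then ((1 : ℚ) : AddCircle (2 : ℚ)) else 0

theorem IsOrthFamily.self {j : ℕ} {v : Fin j → A} (hv : IsOrthFamily Q v) (i : Fin j) :
    polar Q (v i) (v i) = ((1 : ℚ) : AddCircle (2 : ℚ)) := by rw [hv, if_pos rfl]

theorem IsOrthFamily.ne {j : ℕ} {v : Fin j → A} (hv : IsOrthFamily Q v) {i k : Fin j}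
    (h : i ≠ k) : polar Q (v i) (v k) = 0 := by rw [hv, if_neg h]

theorem IsOrthFamily.injective {j : ℕ} {v : Fin j → A} (hv : IsOrthFamily Q v) :
    Function.Injective v := by
  intro i k h
  by_contra hik
  have h1 := hv.ne hik
  rw [← h, hv.self] at h1
  exact one_ne h1

theorem IsOrthFamily.cons {j : ℕ} {v : Fin j → A} (hv : IsOrthFamily Q v) {c : A}
    (hc : polar Q c c = ((1 : ℚ) : AddCircle (2 : ℚ))) (h : ∀ i, polar Q c (v i) = 0) :
    IsOrthFamily Q (Fin.cons c v : Fin (j + 1) → A) := by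
  intro i k
  refine Fin.cases ?_ (fun i => ?_) i <;> refine Fin.cases ?_ (fun k => ?_) k
  · simpa using hc
  · simpa [(Fin.succ_ne_zero k).symm] using h k
  · simpa [polar_comm _ _ c] using h i
  · simpa using hv i k

theorem polar_eq_zero_or_one (h2 : ∀ x : A, (2 : ℤ) • x = 0) (x y : A) :
    polar Q x y = 0 ∨ polar Q x y = ((1 : ℚ) : AddCircle (2 : ℚ)) :=
  polar_of_two_torsion (h2 y) x

/-- Orthogonal projection off an orthogonal family. -/
theorem IsOrthFamily.exists_orth (h2 : ∀ x : A, (2 : ℤ) • x = 0) {j : ℕ} {v : Fin j → A}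
    (hv : IsOrthFamily Q v) (w : A) :
    ∃ (f : Fin j → ℤ) (c : A), w = ∑ i, f i • v i + c ∧ ∀ i, polar Q c (v i) = 0 := by
  have : ∀ i, ∃ k : ℤ, polar Q w (v i) = ((k : ℚ) : AddCircle (2 : ℚ)) := fun i => by
    rcases polar_eq_zero_or_one (Q := Q) h2 w (v i) with h | h
    · exact ⟨0, by rw [h]; simp⟩
    · exact ⟨1, by rw [h]; simp⟩
  choose f hf using this
  refine ⟨f, w - ∑ i, f i • v i, by abel, fun i => ?_⟩
  rw [polar_sub_left, polar_sum_left, Finset.sum_eq_single i, polar_smul_left, hv.self, hf,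
    ← AddCircle.coe_zsmul, sub_eq_zero]
  · simp
  · intro k _ hk
    rw [polar_smul_left, hv.ne hk, smul_zero]
  · simp

/-- A maximal orthogonal family in a module containing a vector of half-integral norm spans. -/
theorem IsOrthFamily.span_of_maximal (hQ : Nondeg Q) (h2 : ∀ x : A, (2 : ℤ) • x = 0) {j : ℕ}
    (hj : j ≠ 0) {v : Fin j → A} (hv : IsOrthFamily Q v)
    (hmax : ∀ k > j, ∀ u : Fin k → A, ¬ IsOrthFamily Q u) (w : A) :
    ∃ f : Fin j → ℤ, w = ∑ i, f i • v i := by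
  obtain ⟨f, c, hw, hc⟩ := hv.exists_orth h2 w
  suffices c = 0 from ⟨f, by rw [hw, this, add_zero]⟩
  by_contra hc0
  -- A vector of half-integral norm orthogonal to the family would extend it.
  have even : ∀ c, (∀ i, polar Q c (v i) = 0) → polar Q c c = 0 := fun c hc =>
    (polar_eq_zero_or_one h2 c c).resolve_right fun h =>
      hmax (j + 1) (by omega) _ (hv.cons h hc)
  obtain ⟨z, hz⟩ : ∃ z, polar Q c z ≠ 0 := by
    by_contra! h
    exact hc0 (hQ c h)
  obtain ⟨g, y, hzy, hy⟩ := hv.exists_orth h2 z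
  have hcy : polar Q c y = ((1 : ℚ) : AddCircle (2 : ℚ)) := by
    refine (polar_eq_zero_or_one h2 c y).resolve_left fun h => hz ?_
    rw [hzy, polar_add_right, polar_sum_right, h, add_zero]
    exact Finset.sum_eq_zero fun i _ => by rw [polar_smul_right, hc, smul_zero]
  have hcc := even c hc
  have hyy := even y hy
  obtain ⟨j, rfl⟩ := Nat.exists_eq_succ_of_ne_zero hj
  have hyc : polar Q y c = ((1 : ℚ) : AddCircle (2 : ℚ)) := by rw [polar_comm, hcy]
  have hc' : ∀ i, polar Q (v i) c = 0 := fun i => by rw [polar_comm, hc]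
  have hy' : ∀ i, polar Q (v i) y = 0 := fun i => by rw [polar_comm, hy]
  -- The vectors c and y span an even plane orthogonal to the family. Together with v₀ it has the
  -- orthogonal basis v₀ + c, v₀ + y, v₀ + c + y of vectors of half-integral norm. Exchanging v₀ for
  -- these three lengthens the family by two, against maximality.
  have h1 : IsOrthFamily Q (Fin.cons (v 0 + c + y) (fun i : Fin j => v i.succ) : Fin (j + 1) → A) := by
    refine IsOrthFamily.cons (fun i k => ?_) ?_ fun i => ?_
    · rw [hv]; simp
    · simp only [polar_add_left, polar_add_right, hv.self, hc, hc', hy, hy', hcc, hyy, hcy, hyc]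
      simp [one_add_one_eq]
    · simp only [polar_add_left, hc, hy, hv.ne (Fin.succ_ne_zero i).symm]
      simp
  have h2' : IsOrthFamily Q (Fin.cons (v 0 + c) (Fin.cons (v 0 + c + y) (fun i : Fin j => v i.succ) :
      Fin (j + 1) → A) : Fin (j + 1 + 1) → A) := by
    refine h1.cons ?_ (Fin.cases ?_ fun i => ?_)
    · simp only [polar_add_left, polar_add_right, hv.self, hc, hc', hcc]
      simp
    · simp only [Fin.cons_zero, polar_add_left, polar_add_right, hv.self, hc, hc', hy', hcc, hcy]
      simp [one_add_one_eq]
    · simp only [Fin.cons_succ, polar_add_left, hc, hv.ne (Fin.succ_ne_zero i).symm]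
      simp
  refine hmax (j + 1 + 1 + 1) (by omega) (Fin.cons (v 0 + y) _) (h2'.cons ?_ (Fin.cases ?_
    (Fin.cases ?_ fun i => ?_)))
  · simp only [polar_add_left, polar_add_right, hv.self, hy, hy', hyy]
    simp
  · simp only [Fin.cons_zero, polar_add_left, polar_add_right, hv.self, hc', hy, hyc]
    simp [one_add_one_eq]
  · simp only [Fin.cons_succ, Fin.cons_zero, polar_add_left, polar_add_right, hv.self, hc', hy, hy',
      hyc, hyy]
    simp [one_add_one_eq]
  · simp only [Fin.cons_succ, polar_add_left, hy, hv.ne (Fin.succ_ne_zero i).symm]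
    simp

/-- A spanning orthogonal family determines the cardinality. -/
theorem IsOrthFamily.card (h2 : ∀ x : A, (2 : ℤ) • x = 0) {j : ℕ} {v : Fin j → A}
    (hv : IsOrthFamily Q v) (hs : ∀ w, ∃ f : Fin j → ℤ, w = ∑ i, f i • v i) :
    Nat.card A = 2 ^ j := by
  let F : (Fin j → Fin 2) → A := fun f => ∑ i, ((f i : ℕ) : ℤ) • v i
  have hF : Function.Bijective F := by
    constructor
    · intro f g h
      funext k
      have e : ∀ f : Fin j → Fin 2, polar Q (F f) (v k) = (((f k : ℕ) : ℚ) : AddCircle (2 : ℚ)) := by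
        intro f
        rw [polar_sum_left, Finset.sum_eq_single k, polar_smul_left, hv.self, ← AddCircle.coe_zsmul]
        · simp
        · intro i _ hi
          rw [polar_smul_left, hv.ne hi, smul_zero]
        · simp
      have e' := (e f).symm.trans ((congrArg (fun a => polar Q a (v k)) h).trans (e g))
      rw [coe_eq_iff] at e'
      obtain ⟨m, hm⟩ := e'
      have hm' : ((g k : ℕ) : ℤ) = (f k : ℕ) + 2 * m := by exact_mod_cast hm
      omega
    · intro w
      obtain ⟨f, rfl⟩ := hs w
      refine ⟨fun i => ⟨(f i % 2).toNat, by omega⟩, Finset.sum_congr rfl fun i _ => ?_⟩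
      have : f i = f i % 2 + 2 * (f i / 2) := by omega
      conv_rhs => rw [this, add_smul, mul_comm, mul_smul, h2, smul_zero, add_zero]
      congr 1
      simp only
      omega
  rw [← Nat.card_congr (Equiv.ofBijective F hF)]
  simp

theorem half_of_polar_self_eq_one {x : A} (h2 : (2 : ℤ) • x = 0)
    (h : polar Q x x = ((1 : ℚ) : AddCircle (2 : ℚ))) :
    Q x = ((1 / 2 : ℚ) : AddCircle (2 : ℚ)) ∨ Q x = ((-1 / 2 : ℚ) : AddCircle (2 : ℚ)) := by
  rcases int_or_half_of_two_torsion (Q := Q) h2 with ⟨k, hk⟩ | ⟨k, hk⟩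
  · rw [polar_self, hk, ← AddCircle.coe_nsmul] at h
    refine absurd (h.symm.trans ?_) one_ne
    rw [coe_eq_zero_iff]
    exact ⟨k, by simp⟩
  · rw [hk]
    rcases Int.even_or_odd' k with ⟨m, rfl | rfl⟩
    · left; rw [coe_eq_iff]; exact ⟨-m, by push_cast; ring⟩
    · right; rw [coe_eq_iff]; exact ⟨-m - 1, by push_cast; ring⟩

/-- The number of vectors of norm `1/2` in a family. -/
def plusCount (Q : QuadMod A) {j : ℕ} (v : Fin j → A) : ℕ :=
  Nat.card {i // Q (v i) = ((1 / 2 : ℚ) : AddCircle (2 : ℚ))}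

/-- Four vectors of norm `1/2` may be exchanged for four vectors of norm `-1/2`. -/
theorem IsOrthFamily.exists_plusCount_lt {j : ℕ} {v : Fin j → A}
    (hv : IsOrthFamily Q v) (h4 : 4 ≤ plusCount Q v) :
    ∃ u : Fin j → A, IsOrthFamily Q u ∧ plusCount Q u < plusCount Q v := by
  classical
  unfold plusCount at h4 ⊢
  simp only [Nat.card_eq_fintype_card, Fintype.card_subtype] at h4 ⊢
  obtain ⟨T, hT, hT4⟩ := Finset.exists_subset_card_eq h4
  have hTq : ∀ i ∈ T, Q (v i) = ((1 / 2 : ℚ) : AddCircle (2 : ℚ)) := fun i hi =>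
    (Finset.mem_filter.mp (hT hi)).2
  set S := ∑ i ∈ T, v i with hS
  have hSv : ∀ k ∈ T, polar Q S (v k) = ((1 : ℚ) : AddCircle (2 : ℚ)) := by
    intro k hk
    rw [hS, polar_sum_left, Finset.sum_eq_single_of_mem k hk fun i _ hi => hv.ne hi, hv.self]
  have hSv' : ∀ k ∉ T, polar Q S (v k) = 0 := by
    intro k hk
    rw [hS, polar_sum_left]
    exact Finset.sum_eq_zero fun i hi => hv.ne fun h => hk (h ▸ hi)
  have hSS : polar Q S S = 0 := by
    rw [hS, polar_sum_right, ← hS, Finset.sum_congr rfl hSv, Finset.sum_const, hT4,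
      ← AddCircle.coe_nsmul, coe_eq_zero_iff]
    exact ⟨2, by norm_num⟩
  have hQS : Q S = 0 := by
    have : ∀ s ⊆ T, Q (∑ i ∈ s, v i) = ∑ i ∈ s, Q (v i) := by
      intro s
      induction s using Finset.induction_on with
      | empty => simp
      | insert i s hi ih =>
        intro hs
        have h0 : ∑ k ∈ s, polar Q (v i) (v k) = 0 :=
          Finset.sum_eq_zero fun k hk => hv.ne fun h => hi (h ▸ hk)
        rw [Finset.sum_insert hi, Finset.sum_insert hi, map_add',
          ih ((Finset.subset_insert _ _).trans hs), polar_sum_right, h0, add_zero]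
    rw [hS, this T subset_rfl, Finset.sum_congr rfl hTq, Finset.sum_const, hT4,
      ← AddCircle.coe_nsmul, coe_eq_zero_iff]
    exact ⟨1, by norm_num⟩
  -- The sum S of the four chosen vectors satisfies Q(S) = 4·(1/2) = 0 and has polar pairing 1 with
  -- each of them. Hence S - vᵢ has norm 1/2 + 1 = -1/2, and the differences S - vᵢ have the same
  -- polar Gram matrix as the vᵢ.
  let u : Fin j → A := fun i => if i ∈ T then S - v i else v i
  have hu1 : ∀ i ∈ T, u i = S - v i := fun i hi => if_pos hi
  have hu2 : ∀ i ∉ T, u i = v i := fun i hi => if_neg hi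
  have neg1 : -((1 : ℚ) : AddCircle (2 : ℚ)) = ((1 : ℚ) : AddCircle (2 : ℚ)) :=
    neg_eq_of_add_eq_zero_left one_add_one_eq
  have hvS : ∀ k, polar Q (v k) S = polar Q S (v k) := fun k => polar_comm _ _ _
  refine ⟨u, fun i k => ?_, Finset.card_lt_card ⟨fun i hi => ?_, fun h => ?_⟩⟩
  · by_cases hi : i ∈ T <;> by_cases hk : k ∈ T
    · rw [hu1 i hi, hu1 k hk, polar_sub_left, polar_sub_right, polar_sub_right, hSS, hvS, hSv k hk,
        hSv i hi, zero_sub, neg1, sub_sub_cancel, hv]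
    · rw [hu1 i hi, hu2 k hk, polar_sub_left, hSv' k hk, zero_sub, hv]
      have : i ≠ k := fun h => hk (h ▸ hi)
      simp [this]
    · rw [hu2 i hi, hu1 k hk, polar_sub_right, hvS, hSv' i hi, zero_sub, hv]
      have : i ≠ k := fun h => hi (h ▸ hk)
      simp [this]
    · rw [hu2 i hi, hu2 k hk, hv]
  · simp only [Finset.mem_filter, Finset.mem_univ, true_and] at hi ⊢
    by_cases hiT : i ∈ T
    · exact hTq i hiT
    · rwa [hu2 i hiT] at hi
  · obtain ⟨i, hi⟩ : T.Nonempty := Finset.card_pos.mp (by omega)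
    have h1 := (Finset.mem_filter.mp (h (hT hi))).2
    rw [hu1 i hi, sub_eq_add_neg, map_add', QuadraticMap.map_neg, polar_neg_right, hSv i hi, neg1,
      hQS, zero_add, hTq i hi, add_eq_left] at h1
    exact one_ne h1

/-- A module of half-integral type has a spanning orthogonal family with few vectors of
norm `1/2`. -/
theorem exists_orthFamily [Finite A] (hQ : Nondeg Q) (h2 : ∀ x : A, (2 : ℤ) • x = 0)
    (hodd : ∃ x, polar Q x x = ((1 : ℚ) : AddCircle (2 : ℚ))) :
    ∃ (j : ℕ) (v : Fin j → A), IsOrthFamily Q v ∧ (∀ w, ∃ f : Fin j → ℤ, w = ∑ i, f i • v i) ∧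
      plusCount Q v < 4 := by
  classical
  let P : ℕ → Prop := fun j => ∃ v : Fin j → A, IsOrthFamily Q v
  have hbound : ∀ j, P j → j ≤ Nat.card A := fun j ⟨v, hv⟩ => by
    simpa using Nat.card_le_card_of_injective v hv.injective
  have hP1 : P 1 := by
    obtain ⟨x, hx⟩ := hodd
    refine ⟨fun _ => x, fun i k => ?_⟩
    rw [if_pos (Subsingleton.elim _ _), hx]
  have hPj := Nat.findGreatest_spec (hbound 1 hP1) hP1
  have hle : 1 ≤ Nat.findGreatest P (Nat.card A) := Nat.le_findGreatest (hbound 1 hP1) hP1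
  have hmax : ∀ k > Nat.findGreatest P (Nat.card A), ∀ u : Fin k → A, ¬ IsOrthFamily Q u :=
    fun k hk u hu => absurd (Nat.le_findGreatest (hbound k ⟨u, hu⟩) ⟨u, hu⟩) (not_le.mpr hk)
  generalize Nat.findGreatest P (Nat.card A) = j at hPj hle hmax
  -- Maximal length makes the family span. Among the families of this length, one with the fewest
  -- vectors of norm 1/2 has fewer than four of them, by the exchange.
  obtain ⟨v, hv, hmin⟩ : ∃ v : Fin j → A, IsOrthFamily Q v ∧
      ∀ u : Fin j → A, IsOrthFamily Q u → plusCount Q v ≤ plusCount Q u := by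
    obtain ⟨v, hv, hmin⟩ := WellFounded.has_min (measure (plusCount Q (j := j))).wf
      {v | IsOrthFamily Q v} hPj
    exact ⟨v, hv, fun u hu => not_lt.mp (hmin u hu)⟩
  refine ⟨j, v, hv, hv.span_of_maximal hQ h2 (by omega) hmax, ?_⟩
  by_contra hlt
  obtain ⟨u, hu, hu'⟩ := hv.exists_plusCount_lt (not_lt.mp hlt)
  exact absurd (hmin u hu) (not_le.mpr hu')

/-- In a 2-elementary module the vectors of such a family have norm 1/2 or -1/2. Once a permutation
matches those of norm 1/2, the two families have identical norms and pairings. -/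
theorem exists_isometry_of_orthFamily [Finite A] [Finite A'] (hQ : Nondeg Q) (hQ' : Nondeg Q')
    (h2 : ∀ x : A, (2 : ℤ) • x = 0) (h2' : ∀ x : A', (2 : ℤ) • x = 0) {j : ℕ} {v : Fin j → A}
    {v' : Fin j → A'} (hv : IsOrthFamily Q v) (hv' : IsOrthFamily Q' v')
    (hs : ∀ w, ∃ f : Fin j → ℤ, w = ∑ i, f i • v i)
    (hs' : ∀ w, ∃ f : Fin j → ℤ, w = ∑ i, f i • v' i) (hc : plusCount Q v = plusCount Q' v') :
    ∃ Ψ : A ≃ₗ[ℤ] A', ∀ x, Q' (Ψ x) = Q x := by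
  classical
  obtain ⟨e⟩ : Nonempty ({i // Q (v i) = ((1 / 2 : ℚ) : AddCircle (2 : ℚ))} ≃
      {i // Q' (v' i) = ((1 / 2 : ℚ) : AddCircle (2 : ℚ))}) := by
    rw [← Fintype.card_eq, ← Nat.card_eq_fintype_card, ← Nat.card_eq_fintype_card]
    exact hc
  let σ := e.extendSubtype
  have hσ : ∀ i, Q' (v' (σ i)) = Q (v i) := by
    intro i
    by_cases hi : Q (v i) = ((1 / 2 : ℚ) : AddCircle (2 : ℚ))
    · rw [hi]; exact e.extendSubtype_mem i hi
    · have := e.extendSubtype_not_mem i hi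
      rw [(half_of_polar_self_eq_one (h2 _) (hv.self i)).resolve_left hi]
      exact (half_of_polar_self_eq_one (h2' _) (hv'.self _)).resolve_left this
  obtain ⟨Ψ, h1, -, -⟩ := exists_extension (C := PUnit.{1}) hQ hQ' (b := v) (b' := v' ∘ σ) hσ
    (fun i k => by simp [hv _ _, hv' _ _]) 0 0 (fun c => by simp) (fun i c => by simp)
    (fun i c => by simp) (fun a => by
      obtain ⟨f, hf⟩ := hs a
      exact ⟨f, PUnit.unit, by simpa using hf⟩)
    (fun a => by
      obtain ⟨f, hf⟩ := hs' a
      refine ⟨f ∘ σ, PUnit.unit, ?_⟩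
      rw [hf]
      simpa using (Equiv.sum_comp σ (fun i => f i • v' i)).symm)
  exact ⟨Ψ, h1⟩

theorem zmod_two_smul : ∀ x : ZMod 2, (2 : ℤ) • x = 0 := by decide

theorem zmod_two_cases : ∀ x : ZMod 2, x = 0 ∨ x = 1 := by decide

theorem zmod_two_val_add (x y : ZMod 2) :
    ∃ k : ℤ, ((x + y).val : ℚ) = x.val + y.val - 2 * k := by
  refine ⟨(x.val + y.val) / 2, ?_⟩
  have h : ((x + y).val : ℤ) = x.val + y.val - 2 * ((x.val + y.val) / 2) := by
    rw [ZMod.val_add]; push_cast; omega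
  exact_mod_cast h

theorem zmod_two_val_smul (a : ℤ) (x : ZMod 2) :
    ∃ k : ℤ, ((a • x).val : ℚ) = a * x.val - 2 * k := by
  have h : (((a • x).val : ℤ) : ZMod 2) = ((a * x.val : ℤ) : ZMod 2) := by simp
  rw [ZMod.intCast_eq_intCast_iff_dvd_sub] at h
  obtain ⟨k, hk⟩ := h
  refine ⟨k, ?_⟩
  have h : ((a • x).val : ℤ) = a * x.val - 2 * k := by push_cast at hk; linarith
  exact_mod_cast h

/-- The polar form of `⟨-1/2⟩`. -/
def minusHalfPolar : LinearMap.BilinMap ℤ (ZMod 2) (AddCircle (2 : ℚ)) :=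
  (AddMonoidHom.mk' (fun x => (AddMonoidHom.mk'
    (fun y => ((x.val * y.val : ℚ) : AddCircle (2 : ℚ))) fun y y' => by
      obtain ⟨k, hk⟩ := zmod_two_val_add y y'
      rw [← AddCircle.coe_add, coe_eq_iff, hk]
      exact ⟨x.val * k, by push_cast; ring⟩).toIntLinearMap)
    fun x x' => by
      ext y
      obtain ⟨k, hk⟩ := zmod_two_val_add x x'
      simp only [AddMonoidHom.coe_toIntLinearMap, AddMonoidHom.mk'_apply, LinearMap.add_apply]
      rw [← AddCircle.coe_add, coe_eq_iff, hk]
      exact ⟨k * y.val, by push_cast; ring⟩).toIntLinearMap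

/-- The quadratic module `⟨-1/2⟩` on `ℤ/2`. -/
def minusHalf : QuadMod (ZMod 2) where
  toFun x := ((-(x.val : ℚ) ^ 2 / 2 : ℚ) : AddCircle (2 : ℚ))
  toFun_smul a x := by
    obtain ⟨k, hk⟩ := zmod_two_val_smul a x
    rw [← AddCircle.coe_zsmul, coe_eq_iff, hk]
    refine ⟨k ^ 2 - a * x.val * k, ?_⟩
    push_cast
    simp
    ring
  exists_companion' := by
    refine ⟨minusHalfPolar, fun x y => ?_⟩
    obtain ⟨k, hk⟩ := zmod_two_val_add x y
    change _ = _ + _ + ((x.val * y.val : ℚ) : AddCircle (2 : ℚ))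
    rw [← AddCircle.coe_add, ← AddCircle.coe_add, coe_eq_iff, hk]
    refine ⟨k ^ 2 - x.val * k - y.val * k + x.val * y.val, ?_⟩
    push_cast
    ring

theorem minusHalf_one : minusHalf 1 = ((-1 / 2 : ℚ) : AddCircle (2 : ℚ)) := by
  change ((-((1 : ZMod 2).val : ℚ) ^ 2 / 2 : ℚ) : AddCircle (2 : ℚ)) = _
  simp [ZMod.val_one]

theorem polar_prod_minusHalf (v v' : A) (x y : ZMod 2) :
    polar (Q.prod minusHalf) (v, x) (v', y) = polar Q v v' + polar minusHalf x y := by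
  simp only [polar, Prod.mk_add_mk, QuadraticMap.prod_apply]
  abel

/-- Adding the summand ⟨-1/2⟩ provides a vector of half-integral norm, so orthogonal bases become
available even for modules whose norms are all integral. The original module is recovered as the
complement of this distinguished generator. -/
theorem isMinusHalf_one : IsMinusHalf (Q.prod minusHalf) (0, 1) := by
  refine ⟨?_, ?_⟩
  · rw [Prod.smul_mk, smul_zero]
    exact Prod.ext rfl (zmod_two_smul 1)
  · simp [minusHalf_one]

theorem polar_minusHalf_one : polar minusHalf 1 1 = ((1 : ℚ) : AddCircle (2 : ℚ)) := by
  rw [polar_self, minusHalf_one, ← AddCircle.coe_nsmul, coe_eq_iff]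
  exact ⟨1, by norm_num⟩

theorem nondeg_prod_minusHalf (hQ : Nondeg Q) : Nondeg (Q.prod minusHalf) := by
  rintro ⟨v, x⟩ h
  have hv : v = 0 := hQ v fun y => by
    have := h (y, 0)
    rwa [polar_prod_minusHalf, polar_zero_right, add_zero] at this
  have hx := h (0, 1)
  rw [polar_prod_minusHalf, polar_zero_right, zero_add] at hx
  rcases zmod_two_cases x with rfl | rfl
  · rw [hv]; rfl
  · rw [polar_minusHalf_one] at hx
    exact absurd hx one_ne

/-- Cancellation of `⟨-1/2⟩` for isometries that preserve its generator. -/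
theorem exists_isometry_of_prod {Ψ : (A × ZMod 2) ≃ₗ[ℤ] (A' × ZMod 2)}
    (hΨ : ∀ x, (Q'.prod minusHalf) (Ψ x) = (Q.prod minusHalf) x) (h1 : Ψ (0, 1) = (0, 1)) :
    ∃ ψ : A ≃ₗ[ℤ] A', ∀ x, Q' (ψ x) = Q x := by
  have hpol : ∀ x y, polar (Q'.prod minusHalf) (Ψ x) (Ψ y) = polar (Q.prod minusHalf) x y :=
    fun x y => by simp only [polar, ← map_add, hΨ]
  -- The submodule A × 0 is the orthogonal complement of (0,1), so an isometry matching the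
  -- generators maps one complement onto the other.
  have key : ∀ v, (Ψ (v, 0)).2 = 0 := fun v => by
    have h := hpol (v, 0) (0, 1)
    rw [h1, polar_prod_minusHalf (Q := Q), polar_zero_right, polar_zero_left, add_zero] at h
    have h' := polar_prod_minusHalf (Q := Q') (Ψ (v, 0)).1 0 (Ψ (v, 0)).2 1
    rw [Prod.mk.eta, h, polar_zero_right, zero_add] at h'
    refine (zmod_two_cases _).resolve_right fun h2 => ?_
    rw [h2, polar_minusHalf_one] at h'
    exact one_ne h'.symm
  have key' : ∀ v, (Ψ.symm (v, 0)).2 = 0 := fun v => by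
    refine (zmod_two_cases _).resolve_right fun h2 => ?_
    have e : Ψ.symm (v, 0) = ((Ψ.symm (v, 0)).1, 0) + (0, 1) := by
      rw [Prod.mk_add_mk, add_zero, zero_add, ← h2]
    have e' := congrArg Ψ e
    rw [LinearEquiv.apply_symm_apply, map_add, h1] at e'
    have := congrArg Prod.snd e'
    rw [Prod.snd_add, key, zero_add] at this
    exact zero_ne_one this
  let ψ : A ≃ₗ[ℤ] A' :=
    { toFun := fun v => (Ψ (v, 0)).1
      invFun := fun v => (Ψ.symm (v, 0)).1
      map_add' := fun v w => by
        rw [← Prod.fst_add, ← map_add, Prod.mk_add_mk, add_zero]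
      map_smul' := fun a v => by
        have : ((a • v, 0) : A × ZMod 2) = a • (v, 0) := by simp
        rw [this, map_smul]; rfl
      left_inv := fun v => by
        have : ((Ψ (v, 0)).1, 0) = Ψ (v, 0) := Prod.ext rfl (key v).symm
        simp only [this, LinearEquiv.symm_apply_apply]
      right_inv := fun v => by
        have : ((Ψ.symm (v, 0)).1, 0) = Ψ.symm (v, 0) := Prod.ext rfl (key' v).symm
        simp only [this, LinearEquiv.apply_symm_apply] }
  refine ⟨ψ, fun v => ?_⟩
  have h := hΨ (v, 0)
  rw [QuadraticMap.prod_apply, QuadraticMap.prod_apply, key, map_zero, add_zero, add_zero] at h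
  exact h

/-- There are at most eight nondegenerate `2`-elementary quadratic modules of given cardinality,
up to isometry. -/
theorem exists_classify_two_elementary {I : Type*} (V : I → Type*) [∀ i, AddCommGroup (V i)]
    [∀ i, Finite (V i)] (q : ∀ i, QuadMod (V i)) (hq : ∀ i, Nondeg (q i))
    (h2 : ∀ i (x : V i), (2 : ℤ) • x = 0) (hc : ∀ i j, Nat.card (V i) = Nat.card (V j)) :
    ∃ τ : I → Fin 4 × Fin 2, ∀ i j, τ i = τ j →
      ∃ ψ : V i ≃ₗ[ℤ] V j, ∀ x, q j (ψ x) = q i x := by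
  classical
  have h2W : ∀ i (x : V i × ZMod 2), (2 : ℤ) • x = 0 := fun i x =>
    Prod.ext (h2 i _) (zmod_two_smul _)
  have hW := fun i => nondeg_prod_minusHalf (hq i)
  -- Each V ⊕ ⟨-1/2⟩ has an orthogonal basis with fewer than four vectors of norm 1/2. Its length is
  -- fixed by the order of V, so at most four isometry classes of sums occur.
  choose m v hv hs hp using fun i => exists_orthFamily (hW i) (h2W i)
    ⟨(0, 1), isMinusHalf_one.polar_self⟩
  have hm : ∀ i j, m i = m j := fun i j => by
    have h1 := (hv i).card (h2W i) (hs i)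
    have h2 := (hv j).card (h2W j) (hs j)
    rw [Nat.card_prod, hc i j, ← Nat.card_prod, h2] at h1
    exact (Nat.pow_right_injective le_rfl h1).symm
  let t : I → Fin 4 := fun i => ⟨_, hp i⟩
  have hiso : ∀ i j, t i = t j → ∃ Ψ : (V i × ZMod 2) ≃ₗ[ℤ] (V j × ZMod 2),
      ∀ x, ((q j).prod minusHalf) (Ψ x) = ((q i).prod minusHalf) x := by
    intro i j hij
    have hpc : plusCount ((q i).prod minusHalf) (v i) = plusCount ((q j).prod minusHalf) (v j) :=
      congrArg Fin.val hij
    have hmij := hm i j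
    obtain ⟨mi, vi, hvi, hsi, hpci⟩ : ∃ (k : ℕ) (u : Fin k → V i × ZMod 2),
        IsOrthFamily ((q i).prod minusHalf) u ∧ (∀ w, ∃ f : Fin k → ℤ, w = ∑ i, f i • u i) ∧
        plusCount ((q i).prod minusHalf) u = plusCount ((q j).prod minusHalf) (v j) ∧ k = m j :=
      ⟨_, v i, hv i, hs i, hpc, hmij⟩
    obtain ⟨hpci, rfl⟩ := hpci
    exact exists_isometry_of_orthFamily (hW i) (hW j) (h2W i) (h2W j) hvi (hv j) hsi (hs j) hpci
  -- a base point in every class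
  let base : Fin 4 → I → I := fun p i => if h : ∃ j, t j = p then h.choose else i
  have hbase : ∀ i, t (base (t i) i) = t i := fun i => by
    have h : ∃ j, t j = t i := ⟨i, rfl⟩
    simp only [base, dif_pos h]
    exact h.choose_spec
  have hbase' : ∀ i j, t i = t j → base (t i) i = base (t j) j := fun i j hij => by
    have h : ∃ k, t k = t j := ⟨j, rfl⟩
    simp only [base, hij, dif_pos h]
  choose θ hθ using fun i => hiso i (base (t i) i) (hbase i).symm
  -- Transported to the base module of its class, the generator of ⟨-1/2⟩ becomes an element of norm
  -- -1/2, of which there are at most two orbits. When the orbits agree, ⟨-1/2⟩ cancels. This gives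
  -- 4 · 2 invariants.
  choose σ hσ using fun i => exists_classify_minusHalf_of_two_torsion (hW i) (h2W i)
  refine ⟨fun i => (t i, σ _ (θ i (0, 1))), fun i j hij => ?_⟩
  obtain ⟨h1, h3⟩ := Prod.mk.inj hij
  have hb := hbase' i j h1
  obtain ⟨k, Θi, Θj, hΘi, hΘj, hk⟩ : ∃ (k : I) (Θi : (V i × ZMod 2) ≃ₗ[ℤ] (V k × ZMod 2))
      (Θj : (V j × ZMod 2) ≃ₗ[ℤ] (V k × ZMod 2)),
      (∀ x, ((q k).prod minusHalf) (Θi x) = ((q i).prod minusHalf) x) ∧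
      (∀ x, ((q k).prod minusHalf) (Θj x) = ((q j).prod minusHalf) x) ∧
      σ k (Θi (0, 1)) = σ k (Θj (0, 1)) := by
    have aux : ∀ k (Θi : (V i × ZMod 2) ≃ₗ[ℤ] (V k × ZMod 2)), k = base (t j) j →
        (∀ x, ((q k).prod minusHalf) (Θi x) = ((q i).prod minusHalf) x) →
        σ k (Θi (0, 1)) = σ (base (t j) j) (θ j (0, 1)) → ∃ (k : I)
        (Θi : (V i × ZMod 2) ≃ₗ[ℤ] (V k × ZMod 2)) (Θj : (V j × ZMod 2) ≃ₗ[ℤ] (V k × ZMod 2)),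
        (∀ x, ((q k).prod minusHalf) (Θi x) = ((q i).prod minusHalf) x) ∧
        (∀ x, ((q k).prod minusHalf) (Θj x) = ((q j).prod minusHalf) x) ∧
        σ k (Θi (0, 1)) = σ k (Θj (0, 1)) := by
      rintro k Θi rfl h h'
      exact ⟨_, Θi, θ j, h, hθ j, h'⟩
    exact aux _ (θ i) hb (hθ i) h3
  have tr : ∀ {l} {Θ : (V l × ZMod 2) ≃ₗ[ℤ] (V k × ZMod 2)},
      (∀ x, ((q k).prod minusHalf) (Θ x) = ((q l).prod minusHalf) x) →
      IsMinusHalf ((q k).prod minusHalf) (Θ (0, 1)) := fun {l Θ} h =>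
    ⟨by rw [← map_smul, (isMinusHalf_one (Q := q l)).1, map_zero], by rw [h]; exact isMinusHalf_one.2⟩
  obtain ⟨g, hg, hg1⟩ := hσ k _ _ (tr hΘi) (tr hΘj) hk
  refine exists_isometry_of_prod (Ψ := (Θi.trans g).trans Θj.symm) (fun x => ?_) ?_
  · rw [← hΘj, ← hΘi, ← hg (Θi x)]
    simp
  · simp only [LinearEquiv.trans_apply]
    rw [hg1, LinearEquiv.symm_apply_apply]

/-- The family `b` has the dual family `d`, and both have the same orthogonal complement. -/
structure IsBlock (Q : QuadMod A) {r : ℕ} (b d : Fin r → A) : Prop where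
  dual : ∀ i k, polar Q (b i) (d k) = if i = k then ((1 : ℚ) : AddCircle (2 : ℚ)) else 0
  compl : ∀ c, (∀ k, polar Q c (b k) = 0) ↔ ∀ k, polar Q c (d k) = 0

/-- The orthogonal complement of a family. -/
def orthCompl (Q : QuadMod A) {r : ℕ} (b : Fin r → A) : Submodule ℤ A where
  carrier := {c | ∀ k, polar Q c (b k) = 0}
  zero_mem' k := polar_zero_left _ _
  add_mem' hx hy k := by rw [polar_add_left, hx, hy, add_zero]
  smul_mem' a x hx k := by rw [polar_smul_left, hx, smul_zero]

/-- Subtracting the bᵢ with coefficients polar(a,dᵢ) leaves a vector orthogonal to every dₖ, and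
hence to every bₖ. -/
theorem IsBlock.exists_decomp (h2 : ∀ x : A, (2 : ℤ) • x = 0) {r : ℕ} {b d : Fin r → A}
    (h : IsBlock Q b d) (a : A) :
    ∃ (f : Fin r → Fin 2) (c : orthCompl Q b), a = ∑ i, ((f i : ℕ) : ℤ) • b i + c := by
  have : ∀ i, ∃ k : Fin 2, polar Q a (d i) = (((k : ℕ) : ℚ) : AddCircle (2 : ℚ)) := fun i => by
    rcases polar_eq_zero_or_one (Q := Q) h2 a (d i) with h | h
    · exact ⟨0, by rw [h]; simp⟩
    · exact ⟨1, by rw [h]; simp⟩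
  choose f hf using this
  refine ⟨f, ⟨a - ∑ i, ((f i : ℕ) : ℤ) • b i, ?_⟩, by simp⟩
  refine (h.compl _).mpr fun k => ?_
  rw [polar_sub_left, polar_sum_left, Finset.sum_eq_single k, polar_smul_left, h.dual, if_pos rfl, hf,
    ← AddCircle.coe_zsmul, sub_eq_zero]
  · simp
  · intro i _ hi
    rw [polar_smul_left, h.dual, if_neg hi, smul_zero]
  · simp

theorem IsBlock.card (h2 : ∀ x : A, (2 : ℤ) • x = 0) {r : ℕ} {b d : Fin r → A}
    (h : IsBlock Q b d) : Nat.card A = 2 ^ r * Nat.card (orthCompl Q b) := by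
  let F : (Fin r → Fin 2) × orthCompl Q b → A := fun p => ∑ i, ((p.1 i : ℕ) : ℤ) • b i + p.2
  have hF : Function.Bijective F := by
    constructor
    · rintro ⟨f, c⟩ ⟨g, c'⟩ hfg
      have e : ∀ p : (Fin r → Fin 2) × orthCompl Q b, ∀ k,
          polar Q (F p) (d k) = (((p.1 k : ℕ) : ℚ) : AddCircle (2 : ℚ)) := by
        intro p k
        rw [polar_add_left, (h.compl _).mp p.2.2 k, add_zero, polar_sum_left,
          Finset.sum_eq_single k, polar_smul_left, h.dual, if_pos rfl, ← AddCircle.coe_zsmul]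
        · simp
        · intro i _ hi
          rw [polar_smul_left, h.dual, if_neg hi, smul_zero]
        · simp
      have hfg' : f = g := by
        funext k
        have e' := (e (f, c) k).symm.trans
          ((congrArg (fun a => polar Q a (d k)) hfg).trans (e (g, c') k))
        rw [coe_eq_iff] at e'
        obtain ⟨m, hm⟩ := e'
        have hm' : ((g k : ℕ) : ℤ) = (f k : ℕ) + 2 * m := by exact_mod_cast hm
        omega
      subst hfg'
      exact Prod.ext rfl (Subtype.ext (add_left_cancel hfg))
    · intro w
      obtain ⟨f, c, rfl⟩ := h.exists_decomp h2 w
      exact ⟨(f, c), rfl⟩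
  rw [← Nat.card_congr (Equiv.ofBijective F hF), Nat.card_prod]
  simp

theorem IsBlock.nondeg (hQ : Nondeg Q) (h2 : ∀ x : A, (2 : ℤ) • x = 0) {r : ℕ} {b d : Fin r → A}
    (h : IsBlock Q b d) : Nondeg (Q.comp (orthCompl Q b).subtype) := by
  rintro ⟨c, hc⟩ h0
  refine Subtype.ext (hQ _ fun y => ?_)
  obtain ⟨f, c', rfl⟩ := h.exists_decomp h2 y
  have h1 : polar Q c c' = 0 := h0 c'
  rw [polar_add_right, polar_sum_right, h1, add_zero]
  exact Finset.sum_eq_zero fun i _ => by rw [polar_smul_right, hc i, smul_zero]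

/-- The isometry classes of `2`-elementary modules with a distinguished block. -/
theorem exists_classify_block {I : Type*} (V : I → Type*) [∀ i, AddCommGroup (V i)]
    [∀ i, Finite (V i)] (q : ∀ i, QuadMod (V i)) (hq : ∀ i, Nondeg (q i))
    (h2 : ∀ i (x : V i), (2 : ℤ) • x = 0) (hc : ∀ i j, Nat.card (V i) = Nat.card (V j)) {r : ℕ}
    {b d : ∀ i, Fin r → V i} (hb : ∀ i, IsBlock (q i) (b i) (d i)) {Λ : Type*} (l : I → Λ)
    (hl : ∀ i j, l i = l j → (∀ k, q j (b j k) = q i (b i k)) ∧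
      ∀ k m, polar (q j) (b j k) (b j m) = polar (q i) (b i k) (b i m)) :
    ∃ τ : I → Λ × Fin 4 × Fin 2, ∀ i j, τ i = τ j →
      ∃ ψ : V i ≃ₗ[ℤ] V j, (∀ x, q j (ψ x) = q i x) ∧ ∀ k, ψ (b i k) = b j k := by
  -- The block splits off orthogonally. The label `l` determines its Gram data, and the complement
  -- is nondegenerate, 2-elementary and of fixed order, so it has at most eight isometry types.
  obtain ⟨τ, hτ⟩ := exists_classify_two_elementary (fun i => orthCompl (q i) (b i))
    (fun i => (q i).comp (orthCompl (q i) (b i)).subtype) (fun i => (hb i).nondeg (hq i) (h2 i))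
    (fun i x => Subtype.ext (h2 i x)) (fun i j => by
      have h := hc i j
      rw [(hb i).card (h2 i), (hb j).card (h2 j)] at h
      exact Nat.eq_of_mul_eq_mul_left (by positivity) h)
  refine ⟨fun i => (l i, τ i), fun i j hij => ?_⟩
  obtain ⟨h1, h3⟩ := Prod.mk.inj hij
  obtain ⟨ψ, hψ⟩ := hτ i j h3
  obtain ⟨hg1, hg2⟩ := hl i j h1
  obtain ⟨Ψ, e1, e2, -⟩ := exists_extension (hq i) (hq j) (b := b i) (b' := b j) hg1 hg2
    (C := orthCompl (q i) (b i)) (orthCompl (q i) (b i)).subtype.toAddMonoidHom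
    ((orthCompl (q j) (b j)).subtype.toAddMonoidHom.comp ψ.toLinearMap.toAddMonoidHom)
    hψ (fun k c => by rw [polar_comm]; exact c.2 k) (fun k c => by
      rw [polar_comm]; exact (ψ c).2 k)
    (fun a => by
      obtain ⟨f, c, h⟩ := (hb i).exists_decomp (h2 i) a
      exact ⟨_, c, h⟩)
    (fun a => by
      obtain ⟨f, c, h⟩ := (hb j).exists_decomp (h2 j) a
      refine ⟨fun k => ((f k : ℕ) : ℤ), ψ.symm c, ?_⟩
      rw [h]
      simp)
  exact ⟨Ψ, e1, e2⟩

/-- The isometry classes of `2`-elementary modules with a distinguished nonzero element of given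
norm. -/
theorem exists_classify_pointed {I : Type*} (V : I → Type*) [∀ i, AddCommGroup (V i)]
    [∀ i, Finite (V i)] (q : ∀ i, QuadMod (V i)) (hq : ∀ i, Nondeg (q i))
    (h2 : ∀ i (x : V i), (2 : ℤ) • x = 0) (hc : ∀ i j, Nat.card (V i) = Nat.card (V j))
    (y : ∀ i, V i) (hy : ∀ i, y i ≠ 0) (c : AddCircle (2 : ℚ)) (hyc : ∀ i, q i (y i) = c) :
    ∃ τ : I → Fin 4 × Fin 4 × Fin 2, ∀ i j, τ i = τ j →
      ∃ ψ : V i ≃ₗ[ℤ] V j, (∀ x, q j (ψ x) = q i x) ∧ ψ (y i) = y j := by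
  have hself : ∀ i, polar (q i) (y i) (y i) = 2 • c := fun i => by rw [polar_self, hyc]
  by_cases hne : Nonempty I
  swap
  · exact ⟨fun i => absurd ⟨i⟩ hne, fun i => absurd ⟨i⟩ hne⟩
  obtain ⟨i₀⟩ := hne
  -- Whether y pairs with itself to 0 or to 1 depends only on its norm c, so the same case holds for
  -- every index.
  rcases polar_eq_zero_or_one (Q := q i₀) (h2 i₀) (y i₀) (y i₀) with h0 | h1
  · have hyy : ∀ i, polar (q i) (y i) (y i) = 0 := fun i => by rw [hself, ← hself i₀, h0]
    have hz : ∀ i, ∃ z, polar (q i) (y i) z = ((1 : ℚ) : AddCircle (2 : ℚ)) := fun i => by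
      by_contra! h
      exact hy i (hq i _ fun z => (polar_eq_zero_or_one (h2 i) _ _).resolve_right (h z))
    choose z hz using hz
    -- The only free entry in the Gram data of (y,z) is the norm of z. It lies in (1/2)ℤ/2ℤ, which
    -- accounts for the first factor `Fin 4`.
    have hk : ∀ i, ∃ k : Fin 4, q i (z i) = ((((k : ℕ) : ℚ) / 2 : ℚ) : AddCircle (2 : ℚ)) := fun i => by
      have h4 : ((4 : ℕ) : ℤ) • q i (z i) = 0 := by
        have : (4 : ℤ) • q i (z i) = q i ((2 : ℤ) • z i) := by rw [QuadraticMap.map_smul]; rfl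
        rw [h2, map_zero] at this
        exact_mod_cast this
      obtain ⟨k, hk⟩ := exists_of_nsmul_eq_zero (by norm_num) h4
      refine ⟨⟨(k % 4).toNat, by omega⟩, ?_⟩
      rw [hk, coe_eq_iff]
      have : (((k % 4).toNat : ℕ) : ℤ) = k - 4 * (k / 4) := by omega
      have : (((k % 4).toNat : ℕ) : ℚ) = k - 4 * (k / 4 : ℤ) := by exact_mod_cast this
      refine ⟨-(k / 4), ?_⟩
      simp only [this]
      push_cast
      ring
    choose l hl using hk
    have hzy : ∀ i, polar (q i) (z i) (y i) = ((1 : ℚ) : AddCircle (2 : ℚ)) := fun i => by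
      rw [polar_comm, hz]
    -- The family dual to (y,z) is (d,y). Here d must be orthogonal to z, so d is z or z + y
    -- according to polar(z,z).
    have hd : ∀ i, ∃ d : V i, polar (q i) (y i) d = ((1 : ℚ) : AddCircle (2 : ℚ)) ∧
        polar (q i) (z i) d = 0 ∧
        ∀ c, polar (q i) c (y i) = 0 → (polar (q i) c d = 0 ↔ polar (q i) c (z i) = 0) := fun i => by
      rcases polar_eq_zero_or_one (Q := q i) (h2 i) (z i) (z i) with h | h
      · exact ⟨z i, hz i, h, fun c _ => Iff.rfl⟩
      · refine ⟨z i + y i, by rw [polar_add_right, hz, hyy, add_zero], by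
          rw [polar_add_right, h, hzy, one_add_one_eq], fun c hc => by
          rw [polar_add_right, hc, add_zero]⟩
    choose d hd1 hd2 hd3 using hd
    have hgram : ∀ i j, l i = l j → (∀ k, q j (![y j, z j] k) = q i (![y i, z i] k)) ∧
        ∀ k m, polar (q j) (![y j, z j] k) (![y j, z j] m) =
          polar (q i) (![y i, z i] k) (![y i, z i] m) := fun i j hij => by
      have hzz : q j (z j) = q i (z i) := by rw [hl, hl, hij]
      refine ⟨fun k => ?_, fun k m => ?_⟩
      · fin_cases k
        · simp [hyc]
        · simpa using hzz
      · fin_cases k <;> fin_cases m <;> simp [hyy, hz, hzy, hzz]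
    obtain ⟨τ, hτ⟩ := exists_classify_block V q hq h2 hc (r := 2) (b := fun i => ![y i, z i])
      (d := fun i => ![d i, y i]) (fun i => ⟨fun k m => by
        fin_cases k <;> fin_cases m <;> simp [hd1, hd2, hyy, hzy], fun c => by
        simp only [Fin.forall_fin_two, Matrix.cons_val_zero, Matrix.cons_val_one]
        constructor
        · rintro ⟨h1, h2⟩; exact ⟨(hd3 i c h1).mpr h2, h1⟩
        · rintro ⟨h1, h2⟩; exact ⟨h2, (hd3 i c h2).mp h1⟩⟩) l hgram
    refine ⟨τ, fun i j hij => ?_⟩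
    obtain ⟨ψ, h, h'⟩ := hτ i j hij
    exact ⟨ψ, h, h' 0⟩
  · have hyy : ∀ i, polar (q i) (y i) (y i) = ((1 : ℚ) : AddCircle (2 : ℚ)) := fun i => by
      rw [hself, ← hself i₀, h1]
    -- Now y alone is a block dual to itself, and its Gram data are fixed by c. The label is
    -- therefore constant.
    obtain ⟨τ, hτ⟩ := exists_classify_block V q hq h2 hc (r := 1) (b := fun i _ => y i)
      (d := fun i _ => y i) (fun i => ⟨fun k m => by
        rw [if_pos (Subsingleton.elim _ _), hyy], fun c => Iff.rfl⟩) (fun _ => (0 : Fin 4))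
      (fun i j _ => ⟨fun _ => by rw [hyc, hyc], fun _ _ => by rw [hyy, hyy]⟩)
    refine ⟨τ, fun i j hij => ?_⟩
    obtain ⟨ψ, h, h'⟩ := hτ i j hij
    exact ⟨ψ, h, h' 0⟩

end QuadMod
end OrthLattice
end

open scoped TensorProduct

noncomputable section

namespace OrthLattice

/-! ### Discriminant forms as finite nondegenerate quadratic modules -/

section DiscriminantForm

open QuadraticMap Module

variable {L : Type*} [AddCommGroup L]

/-- The form has trivial radical. -/
def IsNondeg (B : LinearMap.BilinForm ℤ L) : Prop := ∀ x, (∀ y, B x y = 0) → x = 0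

theorem exists_smul_eq_tmul (v : ℚ ⊗[ℤ] L) : ∃ (N : ℤ) (x : L), N ≠ 0 ∧ N • v = 1 ⊗ₜ[ℤ] x := by
  induction v using TensorProduct.induction_on with
  | zero => exact ⟨1, 0, one_ne_zero, by simp⟩
  | tmul q x =>
    refine ⟨q.den, q.num • x, by exact_mod_cast q.den_ne_zero, ?_⟩
    rw [TensorProduct.smul_tmul', TensorProduct.tmul_smul, TensorProduct.smul_tmul']
    congr 1
    simp [mul_comm]
  | add v w hv hw =>
    obtain ⟨N, x, hN, hx⟩ := hv
    obtain ⟨M, y, hM, hy⟩ := hw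
    refine ⟨N * M, M • x + N • y, mul_ne_zero hN hM, ?_⟩
    rw [smul_add, mul_comm, mul_smul, hx, mul_comm, mul_smul, hy, TensorProduct.tmul_add,
      TensorProduct.tmul_smul, TensorProduct.tmul_smul]

theorem one_tmul_injective [Module.Free ℤ L] :
    Function.Injective fun x : L => (1 : ℚ) ⊗ₜ[ℤ] x := by
  have h := Module.Flat.rTensor_preserves_injective_linearMap (M := L)
    (Algebra.linearMap ℤ ℚ) (by exact fun a b h => by simpa using h)
  intro x y hxy
  have : (LinearMap.rTensor L (Algebra.linearMap ℤ ℚ)) (1 ⊗ₜ x) =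
      (LinearMap.rTensor L (Algebra.linearMap ℤ ℚ)) (1 ⊗ₜ y) := by
    simpa using hxy
  have := congrArg (TensorProduct.lid ℤ L) (h this)
  simpa using this

theorem smul_ratTensor_eq_zero {N : ℤ} (hN : N ≠ 0) {v : ℚ ⊗[ℤ] L} (h : N • v = 0) : v = 0 := by
  have h' : (N : ℚ) • v = 0 := by rw [Int.cast_smul_eq_zsmul]; exact h
  exact (smul_eq_zero.mp h').resolve_left (by exact_mod_cast hN)

@[simp]
theorem ratForm_tmul (B : LinearMap.BilinForm ℤ L) (q r : ℚ) (x y : L) :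
    ratForm B (q ⊗ₜ x) (r ⊗ₜ y) = q * r * B x y := by
  simp [ratForm, mul_comm]

theorem ratForm_one (B : LinearMap.BilinForm ℤ L) (x y : L) :
    ratForm B (1 ⊗ₜ x) (1 ⊗ₜ y) = B x y := by simp

theorem mem_lat {v : ℚ ⊗[ℤ] L} : v ∈ lat L ↔ ∃ x : L, (1 : ℚ) ⊗ₜ[ℤ] x = v := Iff.rfl

theorem tmul_mem_lat (x : L) : (1 : ℚ) ⊗ₜ[ℤ] x ∈ lat L := ⟨x, rfl⟩

theorem mem_dual {B : LinearMap.BilinForm ℤ L} {v : ℚ ⊗[ℤ] L} :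
    v ∈ dual B ↔ ∀ y : L, ∃ k : ℤ, ratForm B v (1 ⊗ₜ y) = k := by
  constructor
  · intro h y
    obtain ⟨k, hk⟩ := Submodule.mem_one.mp (h _ (tmul_mem_lat y))
    exact ⟨k, by rw [← hk]; rfl⟩
  · rintro h _ ⟨y, rfl⟩
    obtain ⟨k, hk⟩ := h y
    exact Submodule.mem_one.mpr ⟨k, hk.symm⟩

theorem lat_le_dual (B : LinearMap.BilinForm ℤ L) : lat L ≤ dual B := by
  rintro _ ⟨x, rfl⟩
  exact mem_dual.mpr fun y => ⟨B x y, ratForm_one B x y⟩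

theorem ratForm_nondeg {B : LinearMap.BilinForm ℤ L} (hN : IsNondeg B) {v : ℚ ⊗[ℤ] L}
    (h : ∀ y : L, ratForm B v (1 ⊗ₜ y) = 0) : v = 0 := by
  obtain ⟨N, x, hN0, hx⟩ := exists_smul_eq_tmul v
  refine smul_ratTensor_eq_zero hN0 ?_
  rw [hx, hN x fun y => ?_, TensorProduct.tmul_zero]
  have := ratForm_one B x y
  rw [← hx, map_zsmul, LinearMap.smul_apply, h, smul_zero] at this
  exact_mod_cast this.symm

theorem ratForm_nondegenerate {B : LinearMap.BilinForm ℤ L} (hB : IsEvenLattice B)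
    (hN : IsNondeg B) : (ratForm B).Nondegenerate := by
  refine ⟨fun v hv => ratForm_nondeg hN fun y => hv _, fun v hv => ratForm_nondeg hN fun y => ?_⟩
  rw [ratForm_symm hB]
  exact hv _

theorem lat_eq_span {ι : Type*} (b : Basis ι ℤ L) :
    lat L = Submodule.span ℤ (Set.range (Algebra.TensorProduct.basis ℚ b)) := by
  apply le_antisymm
  · rintro _ ⟨x, rfl⟩
    have hx : x ∈ Submodule.span ℤ (Set.range b) := by rw [b.span_eq]; trivial
    change (1 : ℚ) ⊗ₜ[ℤ] x ∈ _
    induction hx using Submodule.span_induction with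
    | mem x hx =>
      obtain ⟨i, rfl⟩ := hx
      exact Submodule.subset_span ⟨i, by simp⟩
    | zero => rw [TensorProduct.tmul_zero]; exact zero_mem _
    | add x y _ _ hx hy => rw [TensorProduct.tmul_add]; exact add_mem hx hy
    | smul a x _ hx =>
      have : (1 : ℚ) ⊗ₜ[ℤ] (a • x) = a • ((1 : ℚ) ⊗ₜ[ℤ] x) := TensorProduct.tmul_smul _ _ _
      rw [this]; exact Submodule.smul_mem _ _ hx
  · rw [Submodule.span_le]
    rintro _ ⟨i, rfl⟩
    exact ⟨b i, (Algebra.TensorProduct.basis_apply b i).symm⟩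

section Finite

variable [Module.Free ℤ L] [Module.Finite ℤ L]

/-- The dual of the dual lattice is the lattice. -/
theorem mem_lat_of_dual {B : LinearMap.BilinForm ℤ L} (hB : IsEvenLattice B) (hN : IsNondeg B)
    {v : ℚ ⊗[ℤ] L} (h : ∀ w ∈ dual B, ∃ k : ℤ, ratForm B v w = k) : v ∈ lat L := by
  classical
  let b := Module.Free.chooseBasis ℤ L
  have := LinearMap.BilinForm.dualSubmodule_dualSubmodule_of_basis (R := ℤ)
    (ratForm B) (ratForm_nondegenerate hB hN) ⟨fun v w => ratForm_symm hB v w⟩ (Algebra.TensorProduct.basis ℚ b)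
  rw [lat_eq_span b, ← this]
  intro w hw
  rw [← lat_eq_span b] at hw
  obtain ⟨k, hk⟩ := h w hw
  exact Submodule.mem_one.mpr ⟨k, by rw [hk]; rfl⟩

/-- The dual lattice is finitely generated by a dual basis, and every element of L ⊗ ℚ has a nonzero
multiple in L. The quotient is thus finitely generated and torsion. -/
theorem disc_finite {B : LinearMap.BilinForm ℤ L} (hB : IsEvenLattice B) (hN : IsNondeg B) :
    Finite (Disc B) := by
  classical
  let b := Module.Free.chooseBasis ℤ L
  have hfg : (dual B).FG := by
    rw [dual, lat_eq_span b, LinearMap.BilinForm.dualSubmodule_span_of_basis _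
      (ratForm_nondegenerate hB hN)]
    exact Submodule.fg_span (Set.finite_range _)
  have : Module.Finite ℤ (dual B) := Module.Finite.iff_fg.mpr hfg
  refine Module.finite_of_fg_torsion (Disc B) fun {x} => ?_
  induction x using Quotient.inductionOn with
  | _ v =>
    obtain ⟨N, x, hN0, hx⟩ := exists_smul_eq_tmul (v : ℚ ⊗[ℤ] L)
    refine ⟨⟨N, mem_nonZeroDivisors_of_ne_zero hN0⟩, ?_⟩
    change Submodule.Quotient.mk (N • v) = 0
    rw [Submodule.Quotient.mk_eq_zero]
    exact ⟨x, hx.symm⟩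

end Finite

/-- The class in the discriminant group of an element of the dual lattice. -/
abbrev discMk {B : LinearMap.BilinForm ℤ L} (v : dual B) : Disc B := Submodule.Quotient.mk v

theorem discMk_smul {B : LinearMap.BilinForm ℤ L} (a : ℤ) (v : dual B) :
    discMk (a • v) = a • discMk v := rfl

theorem discMk_add {B : LinearMap.BilinForm ℤ L} (v w : dual B) :
    discMk (v + w) = discMk v + discMk w := rfl

theorem discMk_eq_zero {B : LinearMap.BilinForm ℤ L} {v : dual B} :
    discMk v = 0 ↔ (v : ℚ ⊗[ℤ] L) ∈ lat L := by
  rw [Submodule.Quotient.mk_eq_zero]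
  rfl

theorem discMk_eq {B : LinearMap.BilinForm ℤ L} {v w : dual B} :
    discMk v = discMk w ↔ (v : ℚ ⊗[ℤ] L) - w ∈ lat L := by
  rw [Submodule.Quotient.eq]
  rfl

theorem discMk_surjective {B : LinearMap.BilinForm ℤ L} :
    Function.Surjective (discMk : dual B → Disc B) := Submodule.Quotient.mk_surjective _

theorem discForm_mk {B : LinearMap.BilinForm ℤ L} (hB : IsEvenLattice B) (v : dual B) :
    discForm hB (discMk v) = ((ratForm B v v : ℚ) : AddCircle (2 : ℚ)) := rfl

theorem polar_discForm_mk {B : LinearMap.BilinForm ℤ L} (hB : IsEvenLattice B) (v w : dual B) :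
    polar (discForm hB) (discMk v) (discMk w) =
      ((2 * ratForm B v w : ℚ) : AddCircle (2 : ℚ)) := by
  unfold polar
  rw [← Submodule.Quotient.mk_add, discForm_mk, discForm_mk, discForm_mk, ← AddCircle.coe_sub,
    ← AddCircle.coe_sub]
  congr 1
  simp only [Submodule.coe_add, map_add, LinearMap.add_apply, ratForm_symm hB (w : ℚ ⊗[ℤ] L) v]
  ring

/-- The discriminant form as a quadratic map. -/
def discQuad {B : LinearMap.BilinForm ℤ L} (hB : IsEvenLattice B) : QuadMod (Disc B) :=
  QuadraticMap.ofPolar (discForm hB)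
    (fun a x => by
      obtain ⟨v, rfl⟩ := discMk_surjective x
      rw [← Submodule.Quotient.mk_smul, discForm_mk, discForm_mk, ← AddCircle.coe_zsmul]
      congr 1
      simp
      ring)
    (fun x x' y => by
      obtain ⟨v, rfl⟩ := discMk_surjective x
      obtain ⟨v', rfl⟩ := discMk_surjective x'
      obtain ⟨w, rfl⟩ := discMk_surjective y
      rw [← Submodule.Quotient.mk_add, polar_discForm_mk, polar_discForm_mk, polar_discForm_mk,
        ← AddCircle.coe_add]
      congr 1
      simp
      ring)
    (fun a x y => by
      obtain ⟨v, rfl⟩ := discMk_surjective x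
      obtain ⟨w, rfl⟩ := discMk_surjective y
      rw [← Submodule.Quotient.mk_smul, polar_discForm_mk, polar_discForm_mk,
        ← AddCircle.coe_zsmul]
      congr 1
      simp
      ring)

theorem discQuad_mk {B : LinearMap.BilinForm ℤ L} (hB : IsEvenLattice B) (v : dual B) :
    discQuad hB (discMk v) = ((ratForm B v v : ℚ) : AddCircle (2 : ℚ)) := rfl

theorem polar_discQuad_mk {B : LinearMap.BilinForm ℤ L} (hB : IsEvenLattice B) (v w : dual B) :
    polar (discQuad hB) (discMk v) (discMk w) =
      ((2 * ratForm B v w : ℚ) : AddCircle (2 : ℚ)) := polar_discForm_mk hB v w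

/-- This is L^∨∨ = L: a class orthogonal to all of A_L is represented by a vector that pairs
integrally with L^∨. -/
theorem discQuad_nondeg [Module.Free ℤ L] [Module.Finite ℤ L] {B : LinearMap.BilinForm ℤ L}
    (hB : IsEvenLattice B) (hN : IsNondeg B) : Nondeg (discQuad hB) := by
  intro x hx
  obtain ⟨v, rfl⟩ := discMk_surjective x
  rw [discMk_eq_zero]
  refine mem_lat_of_dual hB hN fun w hw => ?_
  have := hx (discMk ⟨w, hw⟩)
  rw [polar_discQuad_mk, coe_eq_zero_iff] at this
  obtain ⟨m, hm⟩ := this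
  exact ⟨m, by linarith⟩

/-- Rank p + q leaves no room for a real radical, and by flatness an integral radical vector would
survive in it. -/
theorem isNondeg_of_hasSignature [Module.Free ℤ L] [Module.Finite ℤ L]
    {B : LinearMap.BilinForm ℤ L} (hB : IsEvenLattice B) {p q : ℕ} (h : HasSignature B p q) :
    IsNondeg B := by
  intro x hx
  set R := LinearMap.BilinMap.toQuadraticMap (LinearMap.BilinForm.baseChange ℝ B) with hR
  have h1 := QuadraticForm.sigPos_add_sigNeg_add_radical (Q := R)
  rw [h.pos, h.neg, Module.finrank_baseChange, h.rank] at h1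
  have h2 : Module.finrank ℝ R.radical = 0 := by omega
  have h3 : R.radical = ⊥ := Submodule.finrank_eq_zero.mp h2
  have hBx : ∀ w, LinearMap.BilinForm.baseChange ℝ B (1 ⊗ₜ x) w = 0 := fun w => by
    induction w using TensorProduct.induction_on with
    | zero => simp
    | tmul r y => simp [hx]
    | add y z hy hz => rw [map_add, hy, hz, add_zero]
  have hBx' : ∀ w, LinearMap.BilinForm.baseChange ℝ B w (1 ⊗ₜ x) = 0 := fun w => by
    induction w using TensorProduct.induction_on with
    | zero => simp
    | tmul r y => simp [hB.symm y x, hx]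
    | add y z hy hz => rw [map_add, LinearMap.add_apply, hy, hz, add_zero]
  have h4 : (1 : ℝ) ⊗ₜ[ℤ] x ∈ R.radical := by
    rw [QuadraticMap.mem_radical_iff']
    refine ⟨hBx _, fun w => ?_⟩
    rw [hR, LinearMap.BilinMap.toQuadraticMap_apply, LinearMap.BilinMap.toQuadraticMap_apply]
    simp [hBx, hBx']
  rw [h3, Submodule.mem_bot] at h4
  have hfl := Module.Flat.rTensor_preserves_injective_linearMap (M := L)
    (Algebra.linearMap ℤ ℝ) (by exact fun a b h => by simpa using h)
  have h5 : (LinearMap.rTensor L (Algebra.linearMap ℤ ℝ)) (1 ⊗ₜ x) =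
      (LinearMap.rTensor L (Algebra.linearMap ℤ ℝ)) 0 := by
    simpa using h4
  simpa using congrArg (TensorProduct.lid ℤ L) (hfl h5)

/-- The orthogonal complement of `2U`. -/
def twoUCompl (B : LinearMap.BilinForm ℤ L) (e f : Fin 2 → L) : L →ₗ[ℤ] (Fin 2 → ℤ) × (Fin 2 → ℤ) :=
  (LinearMap.pi fun i => B.flip (e i)).prod (LinearMap.pi fun i => B.flip (f i))

/-- The `2`-torsion of the discriminant group of a lattice containing `2U`. -/
theorem card_two_torsion_le [Module.Free ℤ L] [Module.Finite ℤ L] {B : LinearMap.BilinForm ℤ L}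
    (hB : IsEvenLattice B) (hU : ContainsTwoU B) :
    ∃ r, finrank ℤ L = r + 4 ∧ Nat.card {x : Disc B // (2 : ℤ) • x = 0} ≤ 2 ^ r := by
  obtain ⟨e, f, he, hf, hef⟩ := hU
  have hfe : ∀ i j, B (f i) (e j) = if i = j then 1 else 0 := fun i j => by
    rw [hB.symm, hef]; simp [eq_comm]
  let φ := twoUCompl B e f
  have hφ : ∀ x, φ x = (fun i => B x (e i), fun i => B x (f i)) := fun x => rfl
  have hsurj : Function.Surjective φ := by
    rintro ⟨a, b⟩
    refine ⟨∑ i, a i • f i + ∑ i, b i • e i, ?_⟩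
    rw [hφ]
    refine Prod.ext (funext fun j => ?_) (funext fun j => ?_)
    · fin_cases j <;> simp [he, hfe]
    · fin_cases j <;> simp [hf, hef]
  have hrank : finrank ℤ L = finrank ℤ (LinearMap.ker φ) + 4 := by
    have h := Submodule.finrank_quotient_add_finrank (LinearMap.ker φ)
    rw [(LinearMap.quotKerEquivOfSurjective φ hsurj).finrank_eq] at h
    rw [← h]
    simp [add_comm]
  refine ⟨_, hrank, ?_⟩
  have hrep : ∀ x : {x : Disc B // (2 : ℤ) • x = 0}, ∃ (v : dual B) (m : LinearMap.ker φ),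
      discMk v = x.1 ∧ (2 : ℤ) • (v : ℚ ⊗[ℤ] L) = 1 ⊗ₜ (m : L) := by
    rintro ⟨x, hx⟩
    obtain ⟨v, rfl⟩ := discMk_surjective x
    choose a ha using fun i => mem_dual.mp v.2 (e i)
    choose b hb using fun i => mem_dual.mp v.2 (f i)
    -- This is the orthogonal projection of `v` to 2U. It is integral because 2U is unimodular, so
    -- `v - u` represents the same class and is orthogonal to 2U.
    let u : L := ∑ i, a i • f i + ∑ i, b i • e i
    let w : dual B := v - ⟨1 ⊗ₜ u, lat_le_dual B (tmul_mem_lat u)⟩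
    have hw : discMk w = discMk v := by
      rw [discMk_eq]
      refine ⟨-u, ?_⟩
      change (1 : ℚ) ⊗ₜ[ℤ] (-u) = _
      simp [w, TensorProduct.tmul_neg]
    have hw2 : discMk ((2 : ℤ) • w) = 0 := by
      rw [discMk_smul, hw, hx]
    rw [discMk_eq_zero] at hw2
    obtain ⟨m, hm⟩ := hw2
    have hm' : (1 : ℚ) ⊗ₜ[ℤ] m = (2 : ℤ) • (w : ℚ ⊗[ℤ] L) := hm
    have hue : ∀ i, B u (e i) = a i := fun i => by fin_cases i <;> simp [u, he, hfe]
    have huf : ∀ i, B u (f i) = b i := fun i => by fin_cases i <;> simp [u, hf, hef]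
    refine ⟨w, ⟨m, ?_⟩, hw, hm'.symm⟩
    rw [LinearMap.mem_ker, hφ]
    refine Prod.ext (funext fun j => ?_) (funext fun j => ?_)
    · have := ratForm_one B m (e j)
      rw [hm', map_zsmul, LinearMap.smul_apply] at this
      simp only [w, Submodule.coe_sub, map_sub, LinearMap.sub_apply, ha, ratForm_one, hue,
        sub_self, smul_zero] at this
      exact_mod_cast this.symm
    · have := ratForm_one B m (f j)
      rw [hm', map_zsmul, LinearMap.smul_apply] at this
      simp only [w, Submodule.coe_sub, map_sub, LinearMap.sub_apply, hb, ratForm_one, huf,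
        sub_self, smul_zero] at this
      exact_mod_cast this.symm
  choose v m hv hm using hrep
  let b := finBasis ℤ (LinearMap.ker φ)
  -- If the doubles of two representatives agree modulo 2M, with M = (2U)^⊥ of rank r, then the
  -- representatives differ by an element of M, and hence of L. So the 2-torsion embeds into M/2M.
  have hinj : Function.Injective fun x => (fun i => ((b.repr (m x) i : ℤ) : ZMod 2)) := by
    intro x y hxy
    have h1 : ∀ i, ∃ k : ℤ, b.repr (m x) i - b.repr (m y) i = 2 * k := fun i => by
      have := congrFun hxy i
      rw [eq_comm, ZMod.intCast_eq_intCast_iff_dvd_sub] at this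
      exact this
    choose k hk using h1
    have h2 : m x - m y = (2 : ℤ) • ∑ i, k i • b i := by
      apply b.ext_elem
      intro i
      simp [Finsupp.single_apply, ← hk]
    apply Subtype.ext
    rw [← hv, ← hv, discMk_eq]
    refine ⟨(∑ i, k i • b i : LinearMap.ker φ), ?_⟩
    have h3 : (2 : ℤ) • ((v x : ℚ ⊗[ℤ] L) - (v y : ℚ ⊗[ℤ] L) -
        1 ⊗ₜ ((∑ i, k i • b i : LinearMap.ker φ) : L)) = 0 := by
      rw [smul_sub, smul_sub, hm, hm, ← TensorProduct.tmul_sub, ← Submodule.coe_sub, h2]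
      rw [sub_eq_zero]
      exact TensorProduct.tmul_smul _ _ _
    have h4 := smul_ratTensor_eq_zero two_ne_zero h3
    rw [sub_eq_zero] at h4
    exact h4.symm
  have := Nat.card_le_card_of_injective _ hinj
  simpa using this

end DiscriminantForm

end OrthLattice

end

open scoped TensorProduct
noncomputable section
namespace OrthLattice
-- Gluing A_L from ℤl and K
section Gluing
open QuadraticMap Module

/-- The subgroup of `ℤ × A` on which the gluing map is defined. -/
def glueGroup {A : Type*} [AddCommGroup A] (Q : QuadMod A) (y : A) (c : ℚ) :
    AddSubgroup (ℤ × A) where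
  -- For c = 1/e the pair (a,w) stands for the vector al/(de) + w. The condition is twice the
  -- statement a/e + (w,y) ∈ ℤ, which says that this vector pairs integrally with a chosen v such
  -- that (l,v) = d.
  carrier := {p | ((2 * p.1 * c : ℚ) : AddCircle (2 : ℚ)) + polar Q p.2 y = 0}
  zero_mem' := by simp
  add_mem' {p r} hp hr := by
    have : ((2 * ((p.1 + r.1 : ℤ) : ℚ) * c : ℚ) : AddCircle (2 : ℚ)) =
        ((2 * p.1 * c : ℚ) : AddCircle (2 : ℚ)) + ((2 * r.1 * c : ℚ) : AddCircle (2 : ℚ)) := by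
      rw [← AddCircle.coe_add]; congr 1; push_cast; ring
    change ((2 * ((p.1 + r.1 : ℤ) : ℚ) * c : ℚ) : AddCircle (2 : ℚ)) + polar Q (p.2 + r.2) y = 0
    rw [this, polar_add_left, add_add_add_comm, hp, hr, add_zero]
  neg_mem' {p} hp := by
    have : ((2 * ((-p.1 : ℤ) : ℚ) * c : ℚ) : AddCircle (2 : ℚ)) =
        -((2 * p.1 * c : ℚ) : AddCircle (2 : ℚ)) := by
      rw [← AddCircle.coe_neg]; congr 1; push_cast; ring
    change ((2 * ((-p.1 : ℤ) : ℚ) * c : ℚ) : AddCircle (2 : ℚ)) + polar Q (-p.2) y = 0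
    rw [this, polar_neg_left, ← neg_add, hp, neg_zero]

/-- The quadratic module `A` is glued from a cyclic module of order `d e` and `A'` along `y`;
the element `x` is the image of the cyclic part. -/
structure IsGluing {A A' : Type*} [AddCommGroup A] [AddCommGroup A'] (Q : QuadMod A)
    (Q' : QuadMod A') (d e : ℕ) (x : A) (y : A') (Φ : glueGroup Q' y (1 / e) →+ A) : Prop where
  surjective : Function.Surjective Φ
  map : ∀ p, Q (Φ p) = ((-(p.1.1 : ℚ) ^ 2 / (d * e) : ℚ) : AddCircle (2 : ℚ)) + Q' p.1.2
  -- In the lattice case y is the class of v + l/e, the projection of v to K ⊗ ℚ. The pair (-jd, jy)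
  -- then represents jv modulo K, and L = ℤv + K.
  ker : ∀ p, Φ p = 0 ↔ ∃ j : ℤ, p.1 = (-j * d, j • y)
  base : ∀ p, p.1 = ((e : ℤ), 0) → Φ p = x
  norm : Q' y = ((d / e : ℚ) : AddCircle (2 : ℚ))
  torsion : (e : ℤ) • y = 0

variable {L : Type*} [AddCommGroup L] {B : LinearMap.BilinForm ℤ L}

theorem divisor_dvd (l x : L) : ((divisor B l : ℕ) : ℤ) ∣ B l x := by
  rw [divisor, Int.natCast_natAbs, abs_dvd, ← Submodule.IsPrincipal.mem_iff_generator_dvd]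
  exact ⟨x, rfl⟩

theorem exists_eq_divisor (l : L) : ∃ v, B l v = divisor B l := by
  have h : ((divisor B l : ℕ) : ℤ) ∈ LinearMap.range (B l) := by
    rw [Submodule.IsPrincipal.mem_iff_generator_dvd, divisor, Int.natCast_natAbs, dvd_abs]
  obtain ⟨v, hv⟩ := h
  exact ⟨v, hv⟩

/-- For every z, the vector -(l,l)z + (l,z)l lies in K. A vector of K orthogonal to K is therefore
orthogonal to (l,l)L. -/
theorem complement_isNondeg (hB : IsEvenLattice B) (hN : IsNondeg B) {l : L} (hl : B l l ≠ 0) :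
    IsNondeg (LinearMap.BilinForm.restrict B (complement B l)) := by
  rintro ⟨x, hx⟩ h
  have hxl : B x l = 0 := by rw [hB.symm]; exact hx
  refine Subtype.ext (hN x fun z => ?_)
  have hz : -(B l l) • z + B l z • l ∈ complement B l := by
    rw [LinearMap.mem_ker, map_add, map_smul, map_smul]
    simp only [smul_eq_mul]
    ring
  have h1 : B x (-(B l l) • z + B l z • l) = 0 := h ⟨_, hz⟩
  rw [map_add, map_smul, map_smul, hxl, smul_zero, add_zero, smul_eq_mul] at h1
  exact (mul_eq_zero.mp h1).resolve_left (neg_ne_zero.mpr hl)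

/-- The inclusion of `K ⊗ ℚ` into `L ⊗ ℚ`. -/
def ratIncl (B : LinearMap.BilinForm ℤ L) (l : L) :
    (ℚ ⊗[ℤ] complement B l) →ₗ[ℚ] (ℚ ⊗[ℤ] L) :=
  (complement B l).subtype.baseChange ℚ

@[simp]
theorem ratIncl_tmul (l : L) (q : ℚ) (x : complement B l) :
    ratIncl B l (q ⊗ₜ x) = q ⊗ₜ[ℤ] (x : L) := rfl

theorem ratForm_ratIncl (l : L) (v w : ℚ ⊗[ℤ] complement B l) :
    ratForm B (ratIncl B l v) (ratIncl B l w) =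
      ratForm (LinearMap.BilinForm.restrict B (complement B l)) v w := by
  induction v using TensorProduct.induction_on with
  | zero => simp
  | add x y hx hy => simp only [map_add, LinearMap.add_apply, hx, hy]
  | tmul q x =>
    induction w using TensorProduct.induction_on with
    | zero => simp
    | add x y hx hy => simp only [map_add, hx, hy]
    | tmul r y => simp

theorem ratForm_self_ratIncl (l : L) (w : ℚ ⊗[ℤ] complement B l) (q : ℚ) :
    ratForm B (q ⊗ₜ l) (ratIncl B l w) = 0 := by
  induction w using TensorProduct.induction_on with
  | zero => simp
  | add x y hx hy => simp only [map_add, hx, hy, add_zero]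
  | tmul r y =>
    have : B l y = 0 := y.2
    simp [this]

theorem ratIncl_injective (hB : IsEvenLattice B) (hN : IsNondeg B) {l : L} (hl : B l l ≠ 0) :
    Function.Injective (ratIncl B l) := by
  rw [injective_iff_map_eq_zero]
  intro w hw
  refine ratForm_nondeg (complement_isNondeg hB hN hl) fun y => ?_
  rw [← ratForm_ratIncl, hw, map_zero, LinearMap.zero_apply]

theorem exists_ratIncl_eq (l : L) {z : ℚ ⊗[ℤ] L} (hz : ratForm B (1 ⊗ₜ l) z = 0) :
    ∃ w, ratIncl B l w = z := by
  obtain ⟨M, x, hM, hx⟩ := exists_smul_eq_tmul z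
  have hxK : x ∈ complement B l := by
    rw [LinearMap.mem_ker]
    have := ratForm_one B l x
    rw [← hx, map_zsmul, hz, smul_zero] at this
    exact_mod_cast this.symm
  refine ⟨(1 / M : ℚ) ⊗ₜ ⟨x, hxK⟩, ?_⟩
  rw [ratIncl_tmul, ← sub_eq_zero]
  refine smul_ratTensor_eq_zero hM ?_
  rw [smul_sub, hx, sub_eq_zero, ← Int.cast_smul_eq_zsmul ℚ, TensorProduct.smul_tmul']
  congr 1
  have : (M : ℚ) ≠ 0 := by exact_mod_cast hM
  simp [this]

/-- The vector `a l / (d e) + w` of `L ⊗ ℚ`. -/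
def glueVec (B : LinearMap.BilinForm ℤ L) (l : L) (d e : ℕ) (a : ℤ)
    (w : ℚ ⊗[ℤ] complement B l) : ℚ ⊗[ℤ] L :=
  ((a : ℚ) / (d * e)) ⊗ₜ l + ratIncl B l w

theorem glueVec_add (l : L) (d e : ℕ) (a a' : ℤ) (w w' : ℚ ⊗[ℤ] complement B l) :
    glueVec B l d e (a + a') (w + w') = glueVec B l d e a w + glueVec B l d e a' w' := by
  rw [glueVec, glueVec, glueVec, map_add, add_add_add_comm, ← TensorProduct.add_tmul]
  congr 2
  push_cast
  ring

theorem ratForm_glueVec {l : L} {d e : ℕ}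
    (hB : IsEvenLattice B) (hd0 : 0 < d) (he0 : 0 < e) (hl : B l l = -((d * e : ℕ) : ℤ))
    (a : ℤ) (w : ℚ ⊗[ℤ] complement B l) :
    ratForm B (glueVec B l d e a w) (glueVec B l d e a w) = -(a : ℚ) ^ 2 / (d * e) +
      ratForm (LinearMap.BilinForm.restrict B (complement B l)) w w := by
  have : (d : ℚ) ≠ 0 := by exact_mod_cast hd0.ne'
  have : (e : ℚ) ≠ 0 := by exact_mod_cast he0.ne'
  unfold glueVec
  simp only [map_add, LinearMap.add_apply, ratForm_self_ratIncl, ratForm_ratIncl, ratForm_tmul, hl,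
    ratForm_symm hB (ratIncl B l w) _]
  push_cast
  field_simp
  ring

theorem ratForm_glueVec_self {l : L} {d e : ℕ}
    (hB : IsEvenLattice B) (hd0 : 0 < d) (he0 : 0 < e) (hl : B l l = -((d * e : ℕ) : ℤ))
    (a : ℤ) (w : ℚ ⊗[ℤ] complement B l) :
    ratForm B (glueVec B l d e a w) (1 ⊗ₜ l) = -a := by
  have : (d : ℚ) ≠ 0 := by exact_mod_cast hd0.ne'
  have : (e : ℚ) ≠ 0 := by exact_mod_cast he0.ne'
  unfold glueVec
  simp only [map_add, LinearMap.add_apply, ratForm_self_ratIncl, ratForm_tmul, hl,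
    ratForm_symm hB (ratIncl B l w) _]
  push_cast
  field_simp
  ring

theorem exists_decomp_of_divisor {l : L} {d : ℕ} {v : L}
    (hd : ∀ x, (d : ℤ) ∣ B l x) (hv : B l v = d) (z : L) :
    ∃ (j : ℤ) (k : complement B l), B l z = j * d ∧ z = j • v + k := by
  obtain ⟨j, hj⟩ := hd z
  refine ⟨j, ⟨z - j • v, ?_⟩, by rw [hj, mul_comm], by simp⟩
  rw [LinearMap.mem_ker, map_sub, map_smul, hv, hj, smul_eq_mul]
  ring

/-- Since L = ℤv + K, integrality has to be tested only on K and on v. -/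
theorem glueVec_mem_dual {l : L} {d e : ℕ} {v : L}
    (hd0 : 0 < d) (he0 : 0 < e) (hd : ∀ x, (d : ℤ) ∣ B l x) (hv : B l v = d) {a : ℤ}
    {w : ℚ ⊗[ℤ] complement B l} :
    glueVec B l d e a w ∈ dual B ↔
      w ∈ dual (LinearMap.BilinForm.restrict B (complement B l)) ∧
      ∃ m : ℤ, (a : ℚ) / e + ratForm B (ratIncl B l w) (1 ⊗ₜ v) = m := by
  have hd0' : (d : ℚ) ≠ 0 := by exact_mod_cast hd0.ne'
  have he0' : (e : ℚ) ≠ 0 := by exact_mod_cast he0.ne'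
  have hpv : ratForm B (glueVec B l d e a w) (1 ⊗ₜ v) =
      (a : ℚ) / e + ratForm B (ratIncl B l w) (1 ⊗ₜ v) := by
    unfold glueVec
    rw [map_add, LinearMap.add_apply, ratForm_tmul, hv]
    congr 1
    push_cast
    field_simp
  have hpk : ∀ k : complement B l, ratForm B (glueVec B l d e a w) (1 ⊗ₜ (k : L)) =
      ratForm (LinearMap.BilinForm.restrict B (complement B l)) w (1 ⊗ₜ k) := fun k => by
    have hk : B l k = 0 := k.2
    unfold glueVec
    rw [map_add, LinearMap.add_apply, ratForm_tmul, hk, ← ratForm_ratIncl, ratIncl_tmul]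
    simp
  rw [mem_dual, mem_dual]
  constructor
  · intro h
    exact ⟨fun k => by rw [← hpk]; exact h k, by rw [← hpv]; exact h v⟩
  · rintro ⟨h1, m, h2⟩ z
    obtain ⟨j, k, -, rfl⟩ := exists_decomp_of_divisor hd hv z
    obtain ⟨m', hm'⟩ := h1 k
    refine ⟨j * m + m', ?_⟩
    have : (1 : ℚ) ⊗ₜ[ℤ] (j • v + (k : L)) = j • ((1 : ℚ) ⊗ₜ[ℤ] v) + 1 ⊗ₜ (k : L) := by
      rw [TensorProduct.tmul_add]
      congr 1
      exact TensorProduct.tmul_smul _ _ _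
    rw [this, map_add, map_zsmul, hpv, hpk, h2, hm']
    push_cast
    simp

theorem exists_glueVec_eq {l : L} {d e : ℕ}
    (hB : IsEvenLattice B) (hd0 : 0 < d) (he0 : 0 < e) (hl : B l l = -((d * e : ℕ) : ℤ)) {u : ℚ ⊗[ℤ] L}
    (hu : u ∈ dual B) :
    ∃ a w, glueVec B l d e a w = u := by
  have hd0' : (d : ℚ) ≠ 0 := by exact_mod_cast hd0.ne'
  have he0' : (e : ℚ) ≠ 0 := by exact_mod_cast he0.ne'
  obtain ⟨m, hm⟩ := mem_dual.mp hu l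
  obtain ⟨w, hw⟩ := exists_ratIncl_eq l (B := B) (z := u - (((-m : ℤ) : ℚ) / (d * e)) ⊗ₜ l) (by
    rw [map_sub, ratForm_symm hB, hm, ratForm_tmul, hl]
    push_cast
    field_simp
    ring)
  exact ⟨-m, w, by rw [glueVec, hw]; abel⟩

/-- The vector `l / div(l)` of the dual lattice. -/
def divVec (B : LinearMap.BilinForm ℤ L) (l : L) : dual B :=
  ⟨((1 : ℚ) / divisor B l) ⊗ₜ l, mem_dual.mpr fun y => by
    obtain ⟨k, hk⟩ := divisor_dvd (B := B) l y
    rcases Nat.eq_zero_or_pos (divisor B l) with h | h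
    · exact ⟨0, by rw [h]; simp⟩
    · refine ⟨k, ?_⟩
      have : (divisor B l : ℚ) ≠ 0 := by exact_mod_cast h.ne'
      rw [ratForm_tmul, hk]
      push_cast
      field_simp⟩

/-- The class of `l / div(l)` in the discriminant group. -/
def divClass (B : LinearMap.BilinForm ℤ L) (l : L) : Disc B := discMk (divVec B l)

/-- The discriminant form of `L` is glued from the discriminant forms of `ℤ l` and `K = l^⊥`. -/
theorem exists_isGluing (hB : IsEvenLattice B) (hN : IsNondeg B) {l : L} {e : ℕ}
    (hd0 : 0 < divisor B l) (he0 : 0 < e) (hl : B l l = -((divisor B l * e : ℕ) : ℤ)) :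
    ∃ y Φ, IsGluing (discQuad hB) (discQuad (hB.complement l)) (divisor B l) e (divClass B l) y Φ ∧
      ∀ (p : glueGroup (discQuad (hB.complement l)) y (1 / e))
        (w : dual (LinearMap.BilinForm.restrict B (complement B l))), discMk w = p.1.2 →
        ∃ h, Φ p = discMk ⟨glueVec B l (divisor B l) e p.1.1 w, h⟩ := by
  obtain ⟨v, hv⟩ := exists_eq_divisor (B := B) l
  have hd := divisor_dvd (B := B) l
  set d := divisor B l with hdd
  have hd0' : (d : ℚ) ≠ 0 := by exact_mod_cast hd0.ne'
  have he0' : (e : ℚ) ≠ 0 := by exact_mod_cast he0.ne'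
  have hl0 : B l l ≠ 0 := by
    rw [hl]
    have : 0 < d * e := Nat.mul_pos hd0 he0
    omega
  have hlq : ((B l l : ℤ) : ℚ) = -(d * e) := by rw [hl]; push_cast; rfl
  have hvq : ((B l v : ℤ) : ℚ) = d := by rw [hv]; push_cast; rfl
  have hvq' : ((B v l : ℤ) : ℚ) = d := by rw [hB.symm, hvq]
  -- Projection of v to the orthogonal complement of l, using (l,v) = d and (l,l) = -de.
  obtain ⟨yv, hyv⟩ := exists_ratIncl_eq l (B := B)
    (z := 1 ⊗ₜ v + ((1 : ℚ) / e) ⊗ₜ l) (by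
      rw [map_add, ratForm_tmul, ratForm_tmul, hlq, hvq]; field_simp; ring)
  have hyd : yv ∈ dual (LinearMap.BilinForm.restrict B (complement B l)) := by
    refine mem_dual.mpr fun k => ⟨B v k, ?_⟩
    have hk : B l k = 0 := k.2
    rw [← ratForm_ratIncl, hyv, ratIncl_tmul, map_add, LinearMap.add_apply, ratForm_tmul,
      ratForm_tmul, hk]
    simp
  have hwv : ∀ w, ratForm B (ratIncl B l w) (1 ⊗ₜ v) =
      ratForm (LinearMap.BilinForm.restrict B (complement B l)) w yv := fun w => by
    rw [← ratForm_ratIncl, hyv, map_add, ratForm_symm hB _ (((1 : ℚ) / e) ⊗ₜ l),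
      ratForm_self_ratIncl, add_zero]
  let y : Disc (LinearMap.BilinForm.restrict B (complement B l)) := discMk ⟨yv, hyd⟩
  have hmem : ∀ (a : ℤ) (w : dual (LinearMap.BilinForm.restrict B (complement B l))),
      (a, discMk w) ∈ glueGroup (discQuad (hB.complement l)) y (1 / e) ↔
      glueVec B l d e a w ∈ dual B := by
    intro a w
    rw [glueVec_mem_dual hd0 he0 hd hv, hwv]
    change ((2 * a * (1 / e) : ℚ) : AddCircle (2 : ℚ)) +
      polar (discQuad (hB.complement l)) (discMk w) (discMk ⟨yv, hyd⟩) = 0 ↔ _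
    rw [polar_discQuad_mk, ← AddCircle.coe_add, coe_eq_zero_iff]
    constructor
    · rintro ⟨m, hm⟩
      exact ⟨w.2, m, by simp only at hm; linear_combination hm / 2⟩
    · rintro ⟨-, m, hm⟩
      exact ⟨m, by simp only; linear_combination 2 * hm⟩
  have hlift : ∀ x : Disc (LinearMap.BilinForm.restrict B (complement B l)), ∃ w, discMk w = x :=
    discMk_surjective
  choose s hs using hlift
  have hindep : ∀ (a : ℤ) (w w' : dual (LinearMap.BilinForm.restrict B (complement B l)))
      (h : glueVec B l d e a w ∈ dual B) (h' : glueVec B l d e a w' ∈ dual B),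
      discMk w = discMk w' → discMk ⟨_, h⟩ = discMk ⟨_, h'⟩ := by
    intro a w w' h h' hw
    rw [discMk_eq] at hw ⊢
    obtain ⟨k, hk⟩ := hw
    refine ⟨k, ?_⟩
    have e1 : ratIncl B l (1 ⊗ₜ k) = ratIncl B l (w - w') := congrArg _ hk
    rw [ratIncl_tmul, map_sub] at e1
    change (1 : ℚ) ⊗ₜ[ℤ] (k : L) = glueVec B l d e a w - glueVec B l d e a w'
    rw [e1, glueVec, glueVec]
    abel
  have hmem' : ∀ p : glueGroup (discQuad (hB.complement l)) y (1 / e),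
      glueVec B l d e p.1.1 (s p.1.2) ∈ dual B := fun p => by
    rw [← hmem, hs]
    exact p.2
  -- The map sends (a,w) to the class of al/(de) + w. Changing w by an element of K does not change
  -- the class.
  let Φ : glueGroup (discQuad (hB.complement l)) y (1 / e) →+ Disc B :=
    AddMonoidHom.mk' (fun p => discMk ⟨_, hmem' p⟩) fun p r => by
      have h1 : glueVec B l d e (p + r).1.1 ((s p.1.2 + s r.1.2 : dual _) : ℚ ⊗[ℤ] _) ∈ dual B := by
        change glueVec B l d e (p.1.1 + r.1.1) (_ + _) ∈ dual B
        rw [glueVec_add]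
        exact add_mem (hmem' p) (hmem' r)
      rw [hindep _ (s (p + r).1.2) (s p.1.2 + s r.1.2) (hmem' _) h1 (by
        rw [discMk_add, hs, hs, hs]; rfl), ← discMk_add]
      congr 1
      exact Subtype.ext (glueVec_add _ _ _ _ _ _ _)
  have hΦ : ∀ (p : glueGroup (discQuad (hB.complement l)) y (1 / e))
      (w : dual (LinearMap.BilinForm.restrict B (complement B l))), discMk w = p.1.2 →
      ∃ h, Φ p = discMk ⟨glueVec B l d e p.1.1 w, h⟩ := by
    intro p w hw
    have h : glueVec B l d e p.1.1 w ∈ dual B := by rw [← hmem, hw]; exact p.2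
    exact ⟨h, hindep _ _ _ _ _ (by rw [hs, hw])⟩
  refine ⟨y, Φ, ⟨?_, ?_, ?_, ?_, ?_, ?_⟩, hΦ⟩
  · intro u
    obtain ⟨u, rfl⟩ := discMk_surjective u
    obtain ⟨a, w, hw⟩ := exists_glueVec_eq hB hd0 he0 hl u.2
    have h1 : glueVec B l d e a w ∈ dual B := by rw [hw]; exact u.2
    have h2 := ((glueVec_mem_dual hd0 he0 hd hv).mp h1).1
    obtain ⟨h, h3⟩ := hΦ ⟨(a, discMk ⟨w, h2⟩), (hmem a ⟨w, h2⟩).mpr h1⟩ ⟨w, h2⟩ rfl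
    refine ⟨_, h3.trans ?_⟩
    congr 1
    exact Subtype.ext hw
  · intro p
    obtain ⟨h, h3⟩ := hΦ p (s p.1.2) (hs _)
    rw [h3, discQuad_mk]
    conv_rhs => rw [← hs p.1.2, discQuad_mk, ← AddCircle.coe_add]
    congr 1
    exact ratForm_glueVec hB hd0 he0 hl _ _
  · intro p
    obtain ⟨w, hw⟩ := discMk_surjective p.1.2
    obtain ⟨h, h3⟩ := hΦ p w hw
    rw [h3, discMk_eq_zero]
    constructor
    · rintro ⟨z, hz⟩
      have hz' : (1 : ℚ) ⊗ₜ[ℤ] z = glueVec B l d e p.1.1 w := hz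
      obtain ⟨j, k, hj, rfl⟩ := exists_decomp_of_divisor hd hv z
      have ha : p.1.1 = -j * d := by
        have h4 := ratForm_glueVec_self hB hd0 he0 hl p.1.1 (w : ℚ ⊗[ℤ] complement B l)
        rw [← hz', ratForm_one, hB.symm, hj] at h4
        have : j * (d : ℤ) = -p.1.1 := by exact_mod_cast h4
        rw [← neg_eq_iff_eq_neg.mpr this]
        ring
      refine ⟨j, Prod.ext ha ?_⟩
      rw [← hw]
      change discMk w = j • discMk ⟨yv, hyd⟩
      rw [← discMk_smul, discMk_eq]
      refine ⟨k, ratIncl_injective hB hN hl0 ?_⟩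
      change ratIncl B l (1 ⊗ₜ k) = ratIncl B l (w - j • yv)
      rw [map_sub, map_zsmul, hyv, ratIncl_tmul]
      rw [glueVec, ha, TensorProduct.tmul_add] at hz'
      have h5 : (1 : ℚ) ⊗ₜ[ℤ] (j • v) = j • ((1 : ℚ) ⊗ₜ[ℤ] v) := TensorProduct.tmul_smul _ _ _
      have h6 : (((-j * d : ℤ) : ℚ) / (d * e)) ⊗ₜ[ℤ] l = -(j • (((1 : ℚ) / e) ⊗ₜ[ℤ] l)) := by
        rw [← Int.cast_smul_eq_zsmul ℚ, TensorProduct.smul_tmul', ← TensorProduct.neg_tmul]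
        congr 1
        rw [smul_eq_mul]
        push_cast
        field_simp
      rw [h5, h6] at hz'
      rw [smul_add, eq_sub_iff_add_eq]
      rw [add_comm, add_comm _ (ratIncl B l _), ← sub_eq_add_neg, eq_sub_iff_add_eq] at hz'
      rw [← hz']
      abel
    · rintro ⟨j, hj⟩
      have ha : p.1.1 = -j * d := congrArg Prod.fst hj
      have hy : discMk w = discMk (j • (⟨yv, hyd⟩ : dual _)) := hw.trans (congrArg Prod.snd hj)
      rw [discMk_eq] at hy
      obtain ⟨k, hk⟩ := hy
      refine ⟨j • v + k, ?_⟩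
      change (1 : ℚ) ⊗ₜ[ℤ] (j • v + (k : L)) = glueVec B l d e p.1.1 w
      have hk' : ratIncl B l (1 ⊗ₜ k) = ratIncl B l (w - j • yv) := congrArg _ hk
      rw [map_sub, map_zsmul, hyv, ratIncl_tmul] at hk'
      have h5 : (1 : ℚ) ⊗ₜ[ℤ] (j • v) = j • ((1 : ℚ) ⊗ₜ[ℤ] v) := TensorProduct.tmul_smul _ _ _
      have h6 : (((-j * d : ℤ) : ℚ) / (d * e)) ⊗ₜ[ℤ] l = -(j • (((1 : ℚ) / e) ⊗ₜ[ℤ] l)) := by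
        rw [← Int.cast_smul_eq_zsmul ℚ, TensorProduct.smul_tmul', ← TensorProduct.neg_tmul]
        congr 1
        rw [smul_eq_mul]
        push_cast
        field_simp
      rw [glueVec, ha, TensorProduct.tmul_add, h5, h6, hk', smul_add]
      abel
  · intro p hp
    obtain ⟨h, h3⟩ := hΦ p 0 (by rw [hp]; rfl)
    rw [h3, divClass]
    congr 1
    apply Subtype.ext
    change glueVec B l d e p.1.1 ((0 : dual (LinearMap.BilinForm.restrict B (complement B l))) :
      ℚ ⊗[ℤ] complement B l) = ((1 : ℚ) / d) ⊗ₜ l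
    rw [glueVec, hp, Submodule.coe_zero, map_zero, add_zero]
    congr 1
    push_cast
    field_simp
  · change ((ratForm _ yv yv : ℚ) : AddCircle (2 : ℚ)) = _
    rw [← ratForm_ratIncl, hyv, coe_eq_iff]
    obtain ⟨k, hk⟩ := hB.even v
    refine ⟨-k, ?_⟩
    simp only [map_add, LinearMap.add_apply, ratForm_tmul, hvq, hvq', hlq, hk]
    push_cast
    field_simp
    ring
  · change (e : ℤ) • discMk ⟨yv, hyd⟩ = 0
    rw [← discMk_smul, discMk_eq_zero]
    have hk : (e : ℤ) • v + l ∈ complement B l := by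
      rw [LinearMap.mem_ker, map_add, map_smul, hv, hl, smul_eq_mul]
      push_cast
      ring
    refine ⟨⟨_, hk⟩, ratIncl_injective hB hN hl0 ?_⟩
    change ratIncl B l (1 ⊗ₜ _) = ratIncl B l ((e : ℤ) • yv)
    rw [map_zsmul, hyv, ratIncl_tmul, smul_add]
    simp only
    rw [TensorProduct.tmul_add]
    congr 1
    · exact TensorProduct.tmul_smul _ _ _
    · rw [← Int.cast_smul_eq_zsmul ℚ, TensorProduct.smul_tmul']
      congr 1
      push_cast
      simp [he0']

end Gluing
end OrthLattice
end

open scoped TensorProduct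
noncomputable section
namespace OrthLattice
-- What the gluing says about isometries, orders and 2-torsion
section GluingConsequences
open QuadraticMap Module
variable {A A' A'' : Type*} [AddCommGroup A] [AddCommGroup A'] [AddCommGroup A'']
  {Q : QuadMod A} {Q' : QuadMod A'} {Q'' : QuadMod A''} {d e : ℕ} {x x'' : A} {y : A'} {y'' : A''}
  {Φ : glueGroup Q' y (1 / e) →+ A} {Φ'' : glueGroup Q'' y'' (1 / e) →+ A}

theorem mem_glueGroup {c : ℚ} {p : ℤ × A'} : p ∈ glueGroup Q' y c ↔
    ((2 * p.1 * c : ℚ) : AddCircle (2 : ℚ)) + polar Q' p.2 y = 0 := Iff.rfl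

theorem mk_zero_mem_glueGroup (he : 0 < e) (m : ℤ) :
    ((e : ℤ) * m, (0 : A')) ∈ glueGroup Q' y (1 / e) := by
  have he' : (e : ℚ) ≠ 0 := by exact_mod_cast he.ne'
  rw [mem_glueGroup, polar_zero_left, add_zero, coe_eq_zero_iff]
  refine ⟨m, ?_⟩
  push_cast
  field_simp

/-- Isometries of the gluing data extend. -/
theorem IsGluing.exists_isometry (h : IsGluing Q Q' d e x y Φ) (h'' : IsGluing Q Q'' d e x'' y'' Φ'')
    (hQ : Nondeg Q) (he : 0 < e) (ψ : A' ≃ₗ[ℤ] A'') (hψ : ∀ w, Q'' (ψ w) = Q' w) (hy : ψ y = y'') :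
    ∃ g ∈ isoGroup Q, g x = x'' ∧ ∀ (p : glueGroup Q' y (1 / e)) (r : glueGroup Q'' y'' (1 / e)),
      r.1 = (p.1.1, ψ p.1.2) → g (Φ p) = Φ'' r := by
  have hpol : ∀ v w, polar Q'' (ψ v) (ψ w) = polar Q' v w := fun v w => by
    simp only [polar, ← map_add, hψ]
  have hmem : ∀ p : ℤ × A', (p.1, ψ p.2) ∈ glueGroup Q'' y'' (1 / e) ↔
      p ∈ glueGroup Q' y (1 / e) := fun p => by
    rw [mem_glueGroup, mem_glueGroup, ← hy, hpol]
  -- The map id × ψ respects the gluing condition because ψ(y) = y''. Both composites onto A induce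
  -- the same form, so they differ by an isometry of A.
  let T : glueGroup Q' y (1 / e) →+ glueGroup Q'' y'' (1 / e) :=
    AddMonoidHom.mk' (fun p => ⟨(p.1.1, ψ p.1.2), (hmem _).mpr p.2⟩) fun p r =>
      Subtype.ext (Prod.ext rfl (map_add ψ _ _))
  have hT : Function.Surjective T := fun r =>
    ⟨⟨(r.1.1, ψ.symm r.1.2), by rw [← hmem]; simpa using r.2⟩,
      Subtype.ext (Prod.ext rfl (ψ.apply_symm_apply _))⟩
  obtain ⟨g, hg, hg'⟩ := exists_isometry_of_surjective hQ hQ Φ (Φ''.comp T) h.surjective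
    (h''.surjective.comp hT) fun p => by
      rw [h.map, AddMonoidHom.comp_apply, h''.map]
      change _ + Q'' (ψ p.1.2) = _
      rw [hψ]
      rfl
  have hg'' : ∀ (p : glueGroup Q' y (1 / e)) (r : glueGroup Q'' y'' (1 / e)),
      r.1 = (p.1.1, ψ p.1.2) → g (Φ p) = Φ'' r := fun p r hr => by
    rw [hg', AddMonoidHom.comp_apply]
    congr 1
    exact Subtype.ext hr.symm
  refine ⟨g, hg, ?_, hg''⟩
  have h1 := mk_zero_mem_glueGroup (Q' := Q') (y := y) he 1
  have h2 := mk_zero_mem_glueGroup (Q' := Q'') (y := y'') he 1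
  rw [mul_one] at h1 h2
  rw [← h.base ⟨_, h1⟩ rfl, ← h''.base ⟨_, h2⟩ rfl]
  exact hg'' _ _ (by simp)

/-- As e kills y, the pairing (w,y) lies in (1/e)ℤ and can be compensated by some a/e. -/
theorem IsGluing.exists_mem (h : IsGluing Q Q' d e x y Φ) (he : 0 < e) (w : A') :
    ∃ a : ℤ, (a, w) ∈ glueGroup Q' y (1 / e) := by
  obtain ⟨k, hk⟩ := exists_polar_of_smul (Q := Q') he.ne' h.torsion w
  refine ⟨-k, ?_⟩
  rw [mem_glueGroup]
  simp only
  rw [hk, ← AddCircle.coe_add, coe_eq_zero_iff]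
  exact ⟨0, by push_cast; ring⟩

/-- The isometries of `A'` fixing `y` embed into the isometries of `A` fixing `x`. -/
theorem IsGluing.card_stab_le [Finite A] (h : IsGluing Q Q' d e x y Φ) (hQ : Nondeg Q)
    (hd : 0 < d) (he : 0 < e) :
    Nat.card {g : isoGroup Q' // g.1 y = y} ≤ Nat.card {g : isoGroup Q // g.1 x = x} := by
  have hex : ∀ ψ : {g : isoGroup Q' // g.1 y = y}, ∃ g : {g : isoGroup Q // g.1 x = x},
      ∀ (p r : glueGroup Q' y (1 / e)), r.1 = (p.1.1, ψ.1.1 p.1.2) → g.1.1 (Φ p) = Φ r := fun ψ => by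
    obtain ⟨g, hg, hgx, hg'⟩ := h.exists_isometry h hQ he ψ.1.1 ψ.1.2 ψ.2
    exact ⟨⟨⟨g, hg⟩, hgx⟩, hg'⟩
  choose G hG using hex
  have : Finite (A ≃ₗ[ℤ] A) := DFunLike.finite _
  refine Nat.card_le_card_of_injective G fun ψ ψ' hψ => ?_
  refine Subtype.ext (Subtype.ext (LinearEquiv.ext fun w => ?_))
  obtain ⟨a, ha⟩ := h.exists_mem he w
  have hmem : ∀ ψ : {g : isoGroup Q' // g.1 y = y},
      (a, ψ.1.1 w) ∈ glueGroup Q' y (1 / e) := fun ψ => by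
    have := isoGroup_polar ψ.1.2 w y
    rw [ψ.2] at this
    rw [mem_glueGroup, this]
    exact ha
  have h1 := hG ψ ⟨_, ha⟩ ⟨_, hmem ψ⟩ rfl
  have h2 := hG ψ' ⟨_, ha⟩ ⟨_, hmem ψ'⟩ rfl
  rw [hψ, h2] at h1
  -- The lifts have the same first coordinate `a`. Their difference in the kernel is (-jd, jy) with
  -- jd = 0, which forces j = 0.
  have h3 := (h.ker _).mp ((map_sub Φ _ _).trans (sub_eq_zero.mpr h1))
  obtain ⟨j, hj⟩ := h3
  have h4 : a - a = -j * d := congrArg Prod.fst hj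
  have h5 : ψ'.1.1 w - ψ.1.1 w = j • y := congrArg Prod.snd hj
  have : j = 0 := by
    have : j * (d : ℤ) = 0 := by linarith
    rcases mul_eq_zero.mp this with h | h
    · exact h
    · exact absurd h (by exact_mod_cast hd.ne')
  rw [this, zero_smul, sub_eq_zero] at h5
  exact h5.symm

/-- Both A' and A are quotients of the glue group by infinite cyclic subgroups, generated by (e,0)
and (-d,y) respectively. Since ey = 0, d times the first generator is minus e times the second. The
index of this common subgroup is computed in two ways. -/
theorem IsGluing.card_mul (h : IsGluing Q Q' d e x y Φ) (hd : 0 < d) (he : 0 < e) :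
    d * Nat.card A' = e * Nat.card A := by
  have he' : (e : ℚ) ≠ 0 := by exact_mod_cast he.ne'
  let π : glueGroup Q' y (1 / e) →+ A' := (AddMonoidHom.snd ℤ A').comp (AddSubgroup.subtype _)
  have hπ : Function.Surjective π := fun w => by
    obtain ⟨a, ha⟩ := h.exists_mem he w
    exact ⟨⟨_, ha⟩, rfl⟩
  let ι : ℤ →+ glueGroup Q' y (1 / e) :=
    AddMonoidHom.mk' (fun m => ⟨((e : ℤ) * m, 0), mk_zero_mem_glueGroup he m⟩) fun m n =>
      Subtype.ext (Prod.ext (mul_add _ _ _) (add_zero _).symm)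
  have hι : Function.Injective ι := fun m n hmn => by
    have : (e : ℤ) * m = e * n := congrArg (fun p => p.1.1) hmn
    exact mul_left_cancel₀ (by exact_mod_cast he.ne') this
  have hκm : ∀ j : ℤ, (-j * d, j • y) ∈ glueGroup Q' y (1 / e) := fun j => by
    rw [mem_glueGroup]
    simp only
    rw [polar_smul_left, polar_self, h.norm, two_nsmul, ← AddCircle.coe_add, ← AddCircle.coe_zsmul,
      ← AddCircle.coe_add,
      coe_eq_zero_iff]
    refine ⟨0, ?_⟩
    rw [zsmul_eq_mul]
    push_cast
    field_simp
    ring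
  let κ : ℤ →+ glueGroup Q' y (1 / e) :=
    AddMonoidHom.mk' (fun j => ⟨(-j * d, j • y), hκm j⟩) fun m n =>
      Subtype.ext (Prod.ext (by simp; ring) (add_smul _ _ _))
  have hκ : Function.Injective κ := fun m n hmn => by
    have : -m * (d : ℤ) = -n * d := congrArg (fun p => p.1.1) hmn
    have := mul_right_cancel₀ (by exact_mod_cast hd.ne') this
    omega
  have hkπ : π.ker = AddSubgroup.map ι ⊤ := by
    ext p
    rw [AddMonoidHom.mem_ker]
    constructor
    · intro hp
      have h1 := p.2
      have hp' : p.1.2 = 0 := hp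
      rw [mem_glueGroup, hp', polar_zero_left, add_zero, coe_eq_zero_iff] at h1
      obtain ⟨m, hm⟩ := h1
      refine ⟨m, trivial, Subtype.ext (Prod.ext ?_ hp'.symm)⟩
      field_simp at hm
      have : p.1.1 = e * m := by exact_mod_cast hm
      exact this.symm
    · rintro ⟨m, -, rfl⟩
      rfl
  have hkΦ : Φ.ker = AddSubgroup.map κ ⊤ := by
    ext p
    rw [AddMonoidHom.mem_ker, h.ker]
    constructor
    · rintro ⟨j, hj⟩
      exact ⟨j, trivial, Subtype.ext hj.symm⟩
    · rintro ⟨j, -, rfl⟩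
      exact ⟨j, rfl⟩
  have hR : AddSubgroup.map ι (AddSubgroup.zmultiples (d : ℤ)) =
      AddSubgroup.map κ (AddSubgroup.zmultiples (e : ℤ)) := by
    rw [AddMonoidHom.map_zmultiples, AddMonoidHom.map_zmultiples]
    have : κ e = - ι d := by
      refine Subtype.ext (Prod.ext ?_ ?_)
      · change -(e : ℤ) * d = -(e * d)
        ring
      · change (e : ℤ) • y = -0
        rw [h.torsion, neg_zero]
    rw [this, AddSubgroup.zmultiples_neg]
  have h1 := AddSubgroup.relIndex_mul_index
    (AddSubgroup.map_mono (f := ι) (le_top (a := AddSubgroup.zmultiples (d : ℤ))))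
  have h2 := AddSubgroup.relIndex_mul_index
    (AddSubgroup.map_mono (f := κ) (le_top (a := AddSubgroup.zmultiples (e : ℤ))))
  rw [AddSubgroup.relIndex_map_map_of_injective _ _ hι, AddSubgroup.relIndex_top_right,
    Int.index_zmultiples, ← hkπ, AddSubgroup.index_ker, AddMonoidHom.range_eq_top.mpr hπ,
    hR] at h1
  rw [AddSubgroup.relIndex_map_map_of_injective _ _ hκ, AddSubgroup.relIndex_top_right,
    Int.index_zmultiples, ← hkΦ, AddSubgroup.index_ker, AddMonoidHom.range_eq_top.mpr h.surjective,
    ← h1] at h2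
  simpa using h2.symm

theorem IsGluing.eq_zero_of_one {Φ : glueGroup Q' y (1 / (1 : ℕ)) →+ A}
    (h : IsGluing Q Q' d 1 x y Φ) : y = 0 := by
  simpa using h.torsion

/-- If `A'` is `2`-elementary and `d ∣ 2`, then so is `A`. -/
theorem IsGluing.two_smul_eq_zero (h : IsGluing Q Q' d e x y Φ)
    (h2 : ∀ w : A', (2 : ℤ) • w = 0) (hd : (d * e) ∣ 2) (u : A) : (2 : ℤ) • u = 0 := by
  obtain ⟨p, rfl⟩ := h.surjective u
  obtain ⟨k, hk⟩ := hd
  rw [← map_zsmul, h.ker]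
  -- With 2 = dek, this j gives -jd = 2a, and jy = 0 because ey = 0.
  refine ⟨-(p.1.1 * (e * k)), Prod.ext ?_ ?_⟩
  · change (2 : ℤ) • p.1.1 = _
    have : (2 : ℤ) = d * e * k := by exact_mod_cast hk
    rw [smul_eq_mul, this]
    ring
  · change (2 : ℤ) • p.1.2 = _
    rw [h2, neg_smul, show p.1.1 * ((e : ℤ) * k) = (p.1.1 * k) * e by ring, mul_smul, h.torsion,
      smul_zero, neg_zero]

/-- The norm-`1/2` elements of order two in `A'` embed into the `2`-torsion of `A`. -/
theorem IsGluing.card_half_le [Finite A] {Φ : glueGroup Q' y (1 / (2 : ℕ)) →+ A}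
    (h : IsGluing Q Q' 1 2 x y Φ) :
    Nat.card {z : A' // (2 : ℤ) • z = 0 ∧ Q' z = ((1 / 2 : ℚ) : AddCircle (2 : ℚ))} ≤
      Nat.card {u : A // (2 : ℤ) • u = 0} := by
  have hex : ∀ z : A', ∃ a : ℤ, (a = 0 ∧ polar Q' z y = 0 ∨
      a = 1 ∧ polar Q' z y = ((1 : ℚ) : AddCircle (2 : ℚ))) ∧
      (a, z) ∈ glueGroup Q' y (1 / (2 : ℕ)) := by
    intro z
    rcases polar_of_two_torsion (Q := Q') h.torsion z with hz | hz
    · refine ⟨0, Or.inl ⟨rfl, hz⟩, ?_⟩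
      rw [mem_glueGroup]
      simp [hz]
    · refine ⟨1, Or.inr ⟨rfl, hz⟩, ?_⟩
      rw [mem_glueGroup]
      simp only
      rw [hz, ← AddCircle.coe_add, coe_eq_zero_iff]
      exact ⟨1, by norm_num⟩
  choose a ha hmem using hex
  have hy : Q' y = ((1 / 2 : ℚ) : AddCircle (2 : ℚ)) := by
    rw [h.norm]; norm_num
  -- If z pairs with y to 1 (polar value), then z + y has norm 1/2 + 1/2 + 1 = 0 mod 2, not 1/2.
  have hbad : ∀ z z' : A', Q' z = ((1 / 2 : ℚ) : AddCircle (2 : ℚ)) →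
      Q' z' = ((1 / 2 : ℚ) : AddCircle (2 : ℚ)) → polar Q' z y = ((1 : ℚ) : AddCircle (2 : ℚ)) →
      z' = z + y → False := by
    rintro z _ hz hz' hp rfl
    rw [map_add', hz, hy, hp, ← AddCircle.coe_add, ← AddCircle.coe_add, coe_eq_iff] at hz'
    obtain ⟨m, hm⟩ := hz'
    have h1 : (1 : ℚ) / 2 = 2 + 2 * m := by linear_combination hm
    have : (1 : ℤ) = 4 + 4 * m := by
      have : (1 : ℚ) = 4 + 4 * m := by linear_combination 2 * h1
      exact_mod_cast this
    omega
  -- An element z is lifted with a ∈ {0,1}. The kernel of Φ is generated by (-1,y), so two lifts can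
  -- have the same image only if z and z' agree or differ by ±y. The latter is excluded by the
  -- norms.
  let f : {z : A' // (2 : ℤ) • z = 0 ∧ Q' z = ((1 / 2 : ℚ) : AddCircle (2 : ℚ))} →
      {u : A // (2 : ℤ) • u = 0} := fun z => ⟨Φ ⟨_, hmem z.1⟩, by
    rw [← map_zsmul, h.ker]
    refine ⟨-(2 * a z.1), Prod.ext ?_ ?_⟩
    · change (2 : ℤ) • a z.1 = _
      rw [smul_eq_mul]
      push_cast
      ring
    · change (2 : ℤ) • z.1 = _
      have := h.torsion
      push_cast at this
      rw [z.2.1]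
      change 0 = -(2 * a z.1) • y
      rw [neg_smul, mul_comm, mul_smul, this, smul_zero, neg_zero]⟩
  refine Nat.card_le_card_of_injective f fun z z' hzz => ?_
  have h1 : Φ ⟨_, hmem z.1⟩ = Φ ⟨_, hmem z'.1⟩ := congrArg Subtype.val hzz
  obtain ⟨j, hj⟩ := (h.ker _).mp ((map_sub Φ _ _).trans (sub_eq_zero.mpr h1))
  have h2 : a z.1 - a z'.1 = -j * ((1 : ℕ) : ℤ) := congrArg Prod.fst hj
  have h3 : z.1 - z'.1 = j • y := congrArg Prod.snd hj
  push_cast at h2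
  apply Subtype.ext
  rcases ha z.1 with ⟨ha1, hp1⟩ | ⟨ha1, hp1⟩ <;> rcases ha z'.1 with ⟨ha2, hp2⟩ | ⟨ha2, hp2⟩
  · rw [show j = 0 by omega, zero_smul, sub_eq_zero] at h3
    exact h3
  · rw [show j = 1 by omega, one_smul] at h3
    exact (hbad z'.1 z.1 z'.2.2 z.2.2 hp2 (by rw [← h3]; abel)).elim
  · rw [show j = -1 by omega, neg_smul, one_smul] at h3
    exact (hbad z.1 z'.1 z.2.2 z'.2.2 hp1 (by rw [← sub_eq_iff_eq_add', ← neg_sub, h3, neg_neg])).elim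
  · rw [show j = 0 by omega, zero_smul, sub_eq_zero] at h3
    exact h3

/-- If `y = 0` in a gluing with `e = 2`, then `x` is killed by `d / 2`. -/
theorem IsGluing.exists_smul_eq_zero {Φ : glueGroup Q' y (1 / (2 : ℕ)) →+ A}
    (h : IsGluing Q Q' d 2 x y Φ) (hy : y = 0) : ∃ k : ℕ, d = 2 * k ∧ (k : ℤ) • x = 0 := by
  -- Norm d/2 = 0 modulo 2 means 4 ∣ d. For primitive l this will contradict the fact that x has
  -- order exactly d, so that y ≠ 0.
  have h0 := h.norm
  rw [hy, QuadraticMap.map_zero, eq_comm, coe_eq_zero_iff] at h0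
  obtain ⟨m, hm⟩ := h0
  have hm' : (d : ℤ) = 4 * m := by
    have : (d : ℚ) = 4 * m := by push_cast at hm; linear_combination 2 * hm
    exact_mod_cast this
  -- This is d/2. Since x is the image of (2,0), the multiple (d/2)x is the image of (d,0), which is
  -- the kernel element with j = -1 because y = 0.
  refine ⟨2 * m.toNat, by omega, ?_⟩
  have h1 := mk_zero_mem_glueGroup (Q' := Q') (y := y) two_pos 1
  rw [mul_one] at h1
  rw [← h.base ⟨_, h1⟩ rfl, ← map_zsmul, h.ker]
  refine ⟨-1, Prod.ext ?_ ?_⟩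
  · change ((2 * m.toNat : ℕ) : ℤ) • ((2 : ℕ) : ℤ) = _
    rw [smul_eq_mul]
    push_cast
    omega
  · change ((2 * m.toNat : ℕ) : ℤ) • (0 : A') = _
    rw [hy, smul_zero, smul_zero]

end GluingConsequences
end OrthLattice
end

open scoped TensorProduct
noncomputable section
namespace OrthLattice
-- The class of l/div(l), and reflections acting as -id
section DivClass
open QuadraticMap Module
variable {L : Type*} [AddCommGroup L] {B : LinearMap.BilinForm ℤ L}

/-- The class `[l / div(l)]` of a primitive vector has order `div(l)` in the discriminant group. -/
theorem smul_divClass_eq_zero_iff [Module.Free ℤ L] {l : L} (hl : IsPrimitiveVec l)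
    (hd0 : 0 < divisor B l) (k : ℤ) :
    k • divClass B l = 0 ↔ (divisor B l : ℤ) ∣ k := by
  have hd0' : (divisor B l : ℚ) ≠ 0 := by exact_mod_cast hd0.ne'
  set d := divisor B l with hdd
  have hcoe : ((k • divVec B l : dual B) : ℚ ⊗[ℤ] L) = ((k : ℚ) / d) ⊗ₜ l := by
    change k • (((1 : ℚ) / d) ⊗ₜ[ℤ] l) = _
    rw [← Int.cast_smul_eq_zsmul ℚ, TensorProduct.smul_tmul', smul_eq_mul, mul_one_div]
  rw [divClass, ← discMk_smul, discMk_eq_zero, hcoe, mem_lat]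
  constructor
  · rintro ⟨z, hz⟩
    have h1 : (d : ℤ) • z = k • l := by
      apply one_tmul_injective (L := L)
      simp only
      rw [TensorProduct.tmul_smul, TensorProduct.tmul_smul, hz, ← Int.cast_smul_eq_zsmul ℚ,
        ← Int.cast_smul_eq_zsmul ℚ, TensorProduct.smul_tmul', TensorProduct.smul_tmul', smul_eq_mul,
        smul_eq_mul]
      congr 1
      push_cast
      field_simp
    -- From dz = kl, division by g = gcd(d,k) gives d'z = k'l with d' and k' coprime. By Bézout l is
    -- a multiple of d', so primitivity makes d' a unit, and d divides k.
    obtain ⟨a, b, hab⟩ : ∃ a b : ℤ, (Int.gcd d k : ℤ) = d * a + k * b := ⟨_, _, Int.gcd_eq_gcd_ab _ _⟩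
    obtain ⟨d', hd'⟩ := Int.gcd_dvd_left (d : ℤ) k
    obtain ⟨k', hk'⟩ := Int.gcd_dvd_right (d : ℤ) k
    have hg0 : (Int.gcd d k : ℤ) ≠ 0 := by
      intro h0
      rw [h0, zero_mul] at hd'
      exact hd0.ne' (by exact_mod_cast hd')
    generalize (Int.gcd (d : ℤ) k : ℤ) = g at *
    have h2 : 1 = d' * a + k' * b := by
      apply mul_left_cancel₀ hg0
      linear_combination hab + a * hd' + b * hk'
    have h3 : d' • z = k' • l := by
      have : g • (d' • z - k' • l) = 0 := by
        rw [smul_sub, smul_smul, smul_smul, ← hd', ← hk', h1, sub_self]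
      exact sub_eq_zero.mp ((smul_eq_zero.mp this).resolve_left hg0)
    have h4 : l = d' • (a • l + b • z) := by
      calc l = (d' * a + k' * b) • l := by rw [← h2, one_smul]
        _ = d' • (a • l) + b • (k' • l) := by rw [add_smul, mul_smul, mul_comm k', mul_smul]
        _ = d' • (a • l + b • z) := by rw [← h3, smul_add, smul_comm b]
    obtain ⟨u, hu⟩ := hl _ _ h4
    refine ⟨k' * ↑u⁻¹, ?_⟩
    rw [hk', hd', ← hu]
    linear_combination (-g * k') * u.mul_inv
  · rintro ⟨m, rfl⟩
    refine ⟨m • l, ?_⟩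
    rw [TensorProduct.tmul_smul, ← Int.cast_smul_eq_zsmul ℚ, TensorProduct.smul_tmul', smul_eq_mul]
    congr 1
    push_cast
    field_simp

theorem divClass_ne_neg [Module.Free ℤ L] {l : L} (hl : IsPrimitiveVec l)
    (hd : 2 < divisor B l) : divClass B l ≠ -divClass B l := by
  intro h
  have h2 : (2 : ℤ) • divClass B l = 0 := by
    rw [two_smul]
    nth_rewrite 2 [h]
    exact add_neg_cancel _
  have := Int.le_of_dvd (by norm_num) ((smul_divClass_eq_zero_iff hl (by omega) 2).mp h2)
  omega

/-- If `σ_l` acts as `-id` on `A_L`, then `A_K` is `2`-elementary. -/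
theorem two_smul_disc_complement_eq_zero [Module.Free ℤ L] [Module.Finite ℤ L]
    (hB : IsEvenLattice B) (hN : IsNondeg B) {l : L} {e : ℕ}
    (hd0 : 0 < divisor B l) (he0 : 0 < e) (hl : B l l = -((divisor B l * e : ℕ) : ℤ))
    (hr : ActsAsNegId B (reflection B l))
    (x : Disc (LinearMap.BilinForm.restrict B (complement B l))) : (2 : ℤ) • x = 0 := by
  obtain ⟨y, Φ, hΦ, hspec⟩ := exists_isGluing hB hN hd0 he0 hl
  obtain ⟨w, rfl⟩ := discMk_surjective x
  obtain ⟨a, ha⟩ := hΦ.exists_mem he0 (discMk w)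
  obtain ⟨h, -⟩ := hspec ⟨_, ha⟩ w rfl
  have hd0' : (divisor B l : ℚ) ≠ 0 := by exact_mod_cast hd0.ne'
  have he0' : (e : ℚ) ≠ 0 := by exact_mod_cast he0.ne'
  have hl0 : B l l ≠ 0 := by
    rw [hl]
    have : 0 < divisor B l * e := Nat.mul_pos hd0 he0
    omega
  -- For u = al/(de) + w in L^∨, the reflection negates the first summand and fixes the second.
  -- Hence σ_l(u) + u = 2w, which lies in L by hypothesis and thus in K.
  have h1 := hr _ h
  rw [reflection_apply, ratForm_glueVec_self hB hd0 he0 hl, hl] at h1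
  obtain ⟨z, hz⟩ := h1
  have hz' : (1 : ℚ) ⊗ₜ[ℤ] z = (2 : ℤ) • ratIncl B l w := by
    refine hz.trans ?_
    rw [glueVec]
    simp only
    rw [TensorProduct.smul_tmul', smul_eq_mul]
    have : (2 * -(a : ℚ) / ((-((divisor B l * e : ℕ) : ℤ) : ℤ) : ℚ) * 1) =
        (a : ℚ) / (divisor B l * e) + (a : ℚ) / (divisor B l * e) := by
      push_cast
      field_simp
      ring
    rw [this, TensorProduct.add_tmul, two_smul]
    abel
  have hzK : z ∈ complement B l := by
    rw [LinearMap.mem_ker]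
    have := ratForm_one B l z
    rw [hz', map_zsmul, ratForm_self_ratIncl, smul_zero] at this
    exact_mod_cast this.symm
  rw [← discMk_smul, discMk_eq_zero]
  refine ⟨⟨z, hzK⟩, ratIncl_injective hB hN hl0 ?_⟩
  change (1 : ℚ) ⊗ₜ[ℤ] z = ratIncl B l ((2 : ℤ) • (w : ℚ ⊗[ℤ] complement B l))
  rw [map_zsmul, hz']

end DivClass
end OrthLattice
end

open scoped TensorProduct
noncomputable section
namespace OrthLattice
-- Eichler transvections and Eichler's criterion
section Eichler
open QuadraticMap Module

/-- The Eichler transvection `v ↦ v - (a, v) e + (e, v) a - q (e, v) e`, where `(a, a) = 2 q`. -/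
def eichler {R M : Type*} [CommRing R] [AddCommGroup M] [Module R M] (b : LinearMap.BilinForm R M)
    (e a : M) (q : R) : M →ₗ[R] M :=
  LinearMap.id - (b a).smulRight e + (b e).smulRight a - (q • b e).smulRight e

section
variable {R M : Type*} [CommRing R] [AddCommGroup M] [Module R M] {b : LinearMap.BilinForm R M}
  {e a : M} {q : R}

theorem eichler_apply (v : M) :
    eichler b e a q v = v - b a v • e + b e v • a - (q * b e v) • e := by
  simp [eichler]

theorem eichler_isometry (hs : ∀ x y, b x y = b y x) (hee : b e e = 0) (hea : b e a = 0)
    (haa : b a a = 2 * q) (v w : M) :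
    b (eichler b e a q v) (eichler b e a q w) = b v w := by
  have hae : b a e = 0 := by rw [hs, hea]
  simp only [eichler_apply, map_add, map_sub, map_smul, LinearMap.add_apply, LinearMap.sub_apply,
    LinearMap.smul_apply, hee, hea, haa, hae, smul_eq_mul, hs v e, hs v a]
  ring

theorem eichler_neg (hs : ∀ x y, b x y = b y x) (hee : b e e = 0) (hea : b e a = 0)
    (haa : b a a = 2 * q) (v : M) : eichler b e (-a) q (eichler b e a q v) = v := by
  have hae : b a e = 0 := by rw [hs, hea]
  simp only [eichler_apply, map_add, map_sub, map_neg, map_smul, LinearMap.neg_apply, hee, hea, haa,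
    hae]
  module

end

variable {L : Type*} [AddCommGroup L] {B : LinearMap.BilinForm ℤ L}

theorem eichler_baseChange (S : Type*) [CommRing S] (e a : L) (q : ℤ) (v : S ⊗[ℤ] L) :
    (eichler B e a q).baseChange S v =
      eichler (LinearMap.BilinForm.baseChange S B) (1 ⊗ₜ e) (1 ⊗ₜ a) (q : S) v := by
  induction v using TensorProduct.induction_on with
  | zero => simp
  | add x y hx hy => rw [map_add, map_add, hx, hy]
  | tmul s x =>
    simp only [LinearMap.baseChange_tmul, eichler_apply, LinearMap.BilinForm.baseChange_tmul,
      TensorProduct.tmul_add, TensorProduct.tmul_sub, TensorProduct.smul_tmul', smul_eq_mul, mul_one,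
      one_mul]
    congr 1
    · congr 1
      · congr 1
        rw [TensorProduct.tmul_smul, TensorProduct.smul_tmul']
      · rw [TensorProduct.tmul_smul, TensorProduct.smul_tmul']
    · rw [TensorProduct.tmul_smul, TensorProduct.smul_tmul']
      simp [mul_assoc]

theorem baseChange_symm (hB : IsEvenLattice B) (S : Type*) [CommRing S] (v w : S ⊗[ℤ] L) :
    LinearMap.BilinForm.baseChange S B v w = LinearMap.BilinForm.baseChange S B w v := by
  induction v using TensorProduct.induction_on with
  | zero => simp
  | add x y hx hy => simp [hx, hy]
  | tmul q x =>
    induction w using TensorProduct.induction_on with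
    | zero => simp
    | add x y hx hy => simp [hx, hy]
    | tmul r y => simp [hB.symm x y, mul_comm]

theorem conjC_tmul (c : ℂ) (x : L) : conjC L (c ⊗ₜ x) = (starRingEnd ℂ) c ⊗ₜ x := rfl

theorem conjC_smul (c : ℂ) (v : ℂ ⊗[ℤ] L) :
    conjC L (c • v) = (starRingEnd ℂ) c • conjC L v := by
  induction v using TensorProduct.induction_on with
  | zero => simp
  | add x y hx hy => rw [smul_add, map_add, map_add, hx, hy, smul_add]
  | tmul q x => simp [conjC_tmul, TensorProduct.smul_tmul']

theorem baseChange_conjC (x : L) (v : ℂ ⊗[ℤ] L) :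
    LinearMap.BilinForm.baseChange ℂ B (1 ⊗ₜ x) (conjC L v) =
      (starRingEnd ℂ) (LinearMap.BilinForm.baseChange ℂ B (1 ⊗ₜ x) v) := by
  induction v using TensorProduct.induction_on with
  | zero => simp
  | add y z hy hz => simp only [map_add, hy, hz]
  | tmul q y => simp [conjC_tmul]

/-- The Eichler transvection attached to the real multiple `s a`. -/
def eichlerPath (B : LinearMap.BilinForm ℤ L) (e a : L) (q : ℤ) (s : ℝ) :
    (ℂ ⊗[ℤ] L) →ₗ[ℂ] (ℂ ⊗[ℤ] L) :=
  eichler (LinearMap.BilinForm.baseChange ℂ B) (1 ⊗ₜ e) ((s : ℂ) • (1 ⊗ₜ a)) ((s : ℂ) ^ 2 * q)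

theorem eichlerPath_conjC (e a : L) (q : ℤ) (s : ℝ) (v : ℂ ⊗[ℤ] L) :
    conjC L (eichlerPath B e a q s v) = eichlerPath B e a q s (conjC L v) := by
  simp only [eichlerPath, eichler_apply, map_add, map_sub, conjC_smul, conjC_tmul, map_one, map_smul,
    LinearMap.smul_apply, baseChange_conjC, smul_eq_mul, map_mul, Complex.conj_ofReal, map_pow,
    map_intCast]

theorem eichlerPath_isometry (hB : IsEvenLattice B) {e a : L} {q : ℤ} (hee : B e e = 0)
    (hea : B e a = 0) (haa : B a a = 2 * q) (s : ℝ) (v w : ℂ ⊗[ℤ] L) :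
    LinearMap.BilinForm.baseChange ℂ B (eichlerPath B e a q s v) (eichlerPath B e a q s w) =
      LinearMap.BilinForm.baseChange ℂ B v w := by
  refine eichler_isometry (baseChange_symm hB ℂ) ?_ ?_ ?_ v w
  · simp [hee]
  · simp [hea]
  · simp [haa]
    ring

theorem eichlerPath_continuous (e a : L) (q : ℤ) (v : ℂ ⊗[ℤ] L) :
    @Continuous ℝ (ℂ ⊗[ℤ] L) _ (complexTopology L) fun s => eichlerPath B e a q s v := by
  let := complexTopology L
  have : IsModuleTopology ℂ (ℂ ⊗[ℤ] L) := ⟨rfl⟩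
  have := IsModuleTopology.toContinuousSMul ℂ (ℂ ⊗[ℤ] L)
  have := IsModuleTopology.toContinuousAdd ℂ (ℂ ⊗[ℤ] L)
  have := IsModuleTopology.topologicalAddGroup ℂ (ℂ ⊗[ℤ] L)
  simp only [eichlerPath, eichler_apply, map_smul, LinearMap.smul_apply]
  fun_prop

theorem eichlerPath_one (e a : L) (q : ℤ) (v : ℂ ⊗[ℤ] L) :
    eichlerPath B e a q 1 v = (eichler B e a q).baseChange ℂ v := by
  rw [eichler_baseChange, eichlerPath]
  simp

theorem eichlerPath_zero (e a : L) (q : ℤ) (v : ℂ ⊗[ℤ] L) : eichlerPath B e a q 0 v = v := by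
  simp [eichlerPath, eichler_apply]

/-- The Eichler transvection as an automorphism of the lattice. -/
def eichlerEquiv (hB : IsEvenLattice B) {e a : L} {q : ℤ} (hee : B e e = 0)
    (hea : B e a = 0) (haa : B a a = 2 * q) : L ≃ₗ[ℤ] L :=
  LinearEquiv.ofLinearMap (eichler B e a q) (eichler B e (-a) q)
    (LinearMap.ext fun v => by
      have := eichler_neg hB.symm hee (a := -a) (q := q) (by rw [map_neg, hea, neg_zero])
        (by simp [haa]) v
      rwa [neg_neg] at this)
    (LinearMap.ext fun v => eichler_neg hB.symm hee hea haa v)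

theorem eichlerEquiv_apply (hB : IsEvenLattice B) {e a : L} {q : ℤ} (hee : B e e = 0)
    (hea : B e a = 0) (haa : B a a = 2 * q) (v : L) :
    eichlerEquiv hB hee hea haa v = v - B a v • e + B e v • a - (q * B e v) • e :=
  eichler_apply v

theorem eichlerEquiv_mem_orthGroup (hB : IsEvenLattice B) {e a : L} {q : ℤ} (hee : B e e = 0)
    (hea : B e a = 0) (haa : B a a = 2 * q) : eichlerEquiv hB hee hea haa ∈ orthGroup B :=
  fun v w => eichler_isometry hB.symm hee hea haa v w

theorem eichlerEquiv_actsAsId (hB : IsEvenLattice B) {e a : L} {q : ℤ} (hee : B e e = 0)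
    (hea : B e a = 0) (haa : B a a = 2 * q) :
    ActsAsId B (ratExt (eichlerEquiv hB hee hea haa)) := by
  intro v hv
  obtain ⟨k, hk⟩ := mem_dual.mp hv a
  obtain ⟨m, hm⟩ := mem_dual.mp hv e
  change (eichler B e a q).baseChange ℚ v - v ∈ lat L
  rw [eichler_baseChange, eichler_apply]
  change v - ratForm B (1 ⊗ₜ a) v • _ + ratForm B (1 ⊗ₜ e) v • _ -
    ((q : ℚ) * ratForm B (1 ⊗ₜ e) v) • _ - v ∈ lat L
  rw [ratForm_symm hB _ v, ratForm_symm hB _ v, hk, hm]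
  refine ⟨-(k • e) + m • a - (q * m) • e, ?_⟩
  change (1 : ℚ) ⊗ₜ[ℤ] _ = _
  have h : ∀ (j : ℤ) (x : L), (j : ℚ) • ((1 : ℚ) ⊗ₜ[ℤ] x) = (1 : ℚ) ⊗ₜ[ℤ] (j • x) := fun j x => by
    rw [TensorProduct.tmul_smul, Int.cast_smul_eq_zsmul]
  rw [← Int.cast_mul, h, h, h, TensorProduct.tmul_sub, TensorProduct.tmul_add,
    TensorProduct.tmul_neg]
  abel

/-- Replacing a by sa with s real gives a continuous family of real isometries joining the identity
(s = 0) to the transvection (s = 1). It moves each period point along a path inside the period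
space, so components are preserved. -/
theorem eichlerEquiv_mem (hB : IsEvenLattice B) {e a : L} {q : ℤ} (hee : B e e = 0)
    (hea : B e a = 0) (haa : B a a = 2 * q) : eichlerEquiv hB hee hea haa ∈ stableGroupPlus B := by
  have ho := eichlerEquiv_mem_orthGroup hB hee hea haa
  refine ⟨⟨ho, eichlerEquiv_actsAsId hB hee hea haa⟩, ho, ?_⟩
  rintro _ ⟨ω, hω, rfl, h1, h2⟩
  let := complexTopology L
  let := projTopology L
  have hne : ∀ s : ℝ, eichlerPath B e a q s ω ≠ 0 := fun s h0 => by
    have := eichlerPath_isometry hB hee hea haa s ω (conjC L ω)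
    rw [h0, map_zero, LinearMap.zero_apply] at this
    rw [← this] at h2
    simp at h2
  let γ : ℝ → Projectivization ℂ (ℂ ⊗[ℤ] L) := fun s => Projectivization.mk ℂ _ (hne s)
  have hγ : Continuous γ := by
    have c1 : Continuous fun s => (⟨_, hne s⟩ : {v : ℂ ⊗[ℤ] L // v ≠ 0}) :=
      (eichlerPath_continuous e a q ω).subtype_mk hne
    exact continuous_coinduced_rng.comp c1
  have hsub : γ '' Set.univ ⊆ periodSpace B := by
    rintro _ ⟨s, -, rfl⟩
    refine ⟨_, hne s, rfl, ?_, ?_⟩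
    · rw [eichlerPath_isometry hB hee hea haa, h1]
    · rw [eichlerPath_conjC, eichlerPath_isometry hB hee hea haa]
      exact h2
  have h0 : γ 0 = Projectivization.mk ℂ ω hω := by
    simp only [γ, eichlerPath_zero]
  have h1' : γ 1 = projAct (eichlerEquiv hB hee hea haa) (Projectivization.mk ℂ ω hω) := by
    simp only [γ, eichlerPath_one]
    rfl
  unfold component
  rw [← h1', ← h0]
  exact (isPreconnected_univ.image γ hγ.continuousOn).subset_connectedComponentIn
    (Set.mem_image_of_mem _ trivial) hsub (Set.mem_image_of_mem _ trivial)

/-- Equivalence under the group `Õ⁺(L)`. -/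
def StabEquiv (B : LinearMap.BilinForm ℤ L) (l l' : L) : Prop := ∃ g ∈ stableGroupPlus B, g l = l'

theorem StabEquiv.refl (l : L) : StabEquiv B l l := ⟨1, one_mem _, rfl⟩

theorem StabEquiv.symm {l l' : L} (h : StabEquiv B l l') : StabEquiv B l' l := by
  obtain ⟨g, hg, rfl⟩ := h
  exact ⟨g⁻¹, inv_mem hg, g.symm_apply_apply l⟩

theorem StabEquiv.trans {l l' l'' : L} (h : StabEquiv B l l') (h' : StabEquiv B l' l'') :
    StabEquiv B l l'' := by
  obtain ⟨g, hg, rfl⟩ := h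
  obtain ⟨g', hg', rfl⟩ := h'
  exact ⟨g' * g, mul_mem hg' hg, rfl⟩

theorem stabEquiv_eichler (hB : IsEvenLattice B) {e a : L} (q : ℤ) (hee : B e e = 0)
    (hea : B e a = 0) (haa : B a a = 2 * q) (l : L) :
    StabEquiv B l (l - B a l • e + B e l • a - (q * B e l) • e) :=
  ⟨_, eichlerEquiv_mem hB hee hea haa, eichlerEquiv_apply hB hee hea haa l⟩

theorem stabEquiv_isotropic (hB : IsEvenLattice B) {e a : L} (hee : B e e = 0)
    (hea : B e a = 0) (haa : B a a = 0) (k : ℤ) (l : L) :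
    StabEquiv B l (l - (k * B a l) • e + (k * B e l) • a) := by
  have := stabEquiv_eichler hB 0 hee (a := k • a) (by rw [map_smul, hea, smul_zero])
    (by simp [haa]) l
  rwa [zero_mul, zero_smul, sub_zero, smul_smul, map_smul, LinearMap.smul_apply, smul_eq_mul,
    mul_comm (B e l)] at this

/-- One step of the Euclidean algorithm. With r the remainder of b modulo a, the number a is
replaced by a ∓ r, the sign being that of a, so the result stays nonzero and decreases in absolute
value. Both operations are available as transvections. -/
theorem exists_reduce {a b : ℤ} (ha : a ≠ 0) (hab : ¬ a ∣ b) :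
    ∃ j k : ℤ, a - k * (b + j * a) ≠ 0 ∧ (a - k * (b + j * a)).natAbs < a.natAbs := by
  have h1 := Int.emod_nonneg b ha
  have h2 : b % a ≠ 0 := fun h => hab (Int.dvd_of_emod_eq_zero h)
  have h3 := Int.emod_lt_abs b ha
  have h4 : b + -(b / a) * a = b % a := by
    have := Int.emod_add_mul_ediv b a
    linear_combination -this
  rcases lt_or_gt_of_ne ha with h | h
  · refine ⟨-(b / a), -1, ?_⟩
    rw [h4]
    rw [abs_of_neg h] at h3
    omega
  · refine ⟨-(b / a), 1, ?_⟩
    rw [h4]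
    rw [abs_of_pos h] at h3
    omega

/-- Every vector is equivalent to one orthogonal to the second hyperbolic plane. -/
theorem exists_stabEquiv_orthogonal (hB : IsEvenLattice B) {e f : Fin 2 → L}
    (hee : ∀ i j, B (e i) (e j) = 0) (hff : ∀ i j, B (f i) (f j) = 0)
    (hef : ∀ i j, B (e i) (f j) = if i = j then 1 else 0) (l : L) :
    ∃ l', StabEquiv B l l' ∧ B (e 1) l' = 0 ∧ B (f 1) l' = 0 := by
  have hfe : ∀ i j, B (f i) (e j) = if i = j then 1 else 0 := fun i j => by
    rw [hB.symm, hef]; simp only [eq_comm]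
  -- Descent on |(f₀,l)|. If it divides (f₁,l) and (e₁,l), two transvections along f₀ clear both
  -- coordinates. If it fails to divide one of them, a Euclidean step makes |(f₀,l)| smaller.
  have key : ∀ n : ℕ, ∀ l₀ l, StabEquiv B l₀ l → B (f 0) l ≠ 0 → (B (f 0) l).natAbs = n →
      ∃ l', StabEquiv B l₀ l' ∧ B (e 1) l' = 0 ∧ B (f 1) l' = 0 := by
    intro n
    induction n using Nat.strong_induction_on with
    | _ n ih =>
      intro l₀ l s₀ h0 hn
      by_cases h1 : B (f 0) l ∣ B (f 1) l
      · by_cases h2 : B (f 0) l ∣ B (e 1) l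
        · obtain ⟨k, hk⟩ := h1
          obtain ⟨m, hm⟩ := h2
          have s1 := s₀.trans <|
            stabEquiv_isotropic hB (hff 0 0) (a := e 1) (by simp [hfe]) (hee 1 1) (-k) l
          refine ⟨_, s1.trans (stabEquiv_isotropic hB (hff 0 0) (a := f 1) (hff 0 1)
            (hff 1 1) (-m) _), ?_, ?_⟩
          · simp [hee, hff, hef, hfe, hk, hm]
            ring
          · simp [hff, hfe, hk, hm]
            ring
        · obtain ⟨j, k, hne, hlt⟩ := exists_reduce h0 h2
          have s1 := s₀.trans <| stabEquiv_isotropic hB (hff 0 0) (a := f 1) (hff 0 1) (hff 1 1) j l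
          have s2 := s1.trans (stabEquiv_isotropic hB (hee 0 0) (a := e 1) (hee 0 1) (hee 1 1) k _)
          refine ih _ ?_ _ _ s2 ?_ rfl
          · simpa [hee, hff, hef, hfe, ← hn] using hlt
          · simpa [hee, hff, hef, hfe] using hne
      · obtain ⟨j, k, hne, hlt⟩ := exists_reduce h0 h1
        have s1 := s₀.trans <|
            stabEquiv_isotropic hB (hff 0 0) (a := e 1) (by simp [hfe]) (hee 1 1) j l
        have s2 := s1.trans (stabEquiv_isotropic hB (hee 0 0) (a := f 1) (by simp [hef])
          (hff 1 1) k _)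
        refine ih _ ?_ _ _ s2 ?_ rfl
        · simpa [hee, hff, hef, hfe, ← hn] using hlt
        · simpa [hee, hff, hef, hfe] using hne
  -- The descent needs (f₀,l) ≠ 0. If it vanishes, a transvection along e₀ moves a nonzero
  -- coordinate of the second plane into this place.
  by_cases h0 : B (f 0) l = 0
  · by_cases h1 : B (f 1) l = 0
    · by_cases h2 : B (e 1) l = 0
      · exact ⟨l, .refl l, h2, h1⟩
      · have s := stabEquiv_isotropic hB (hee 0 0) (a := e 1) (hee 0 1) (hee 1 1) 1 l
        exact key _ _ _ s (by simpa [hee, hff, hef, hfe, h0] using h2) rfl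
    · have s := stabEquiv_isotropic hB (hee 0 0) (a := f 1) (by simp [hef]) (hff 1 1) 1 l
      exact key _ _ _ s (by simpa [hee, hff, hef, hfe, h0] using h1) rfl
  · exact key _ _ l (.refl l) h0 rfl

/-- A transvection along e moves l to l - de, and another moves l + dw to l + dw - de, since both
vectors are orthogonal to the plane and take the value d. The transvection along f with parameter -w
joins the two images: it adds dw because (f, l - de) = -d, and its f-component vanishes because the
norms are equal. -/
theorem stabEquiv_add_smul_of_orthogonal (hB : IsEvenLattice B) {e f l w v : L} {d : ℤ}
    (hee : B e e = 0) (hff : B f f = 0) (hef : B e f = 1) (hel : B e l = 0) (hfl : B f l = 0)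
    (hew : B e w = 0) (hfw : B f w = 0) (hd : d ≠ 0) (hv : B l v = d)
    (hn : B (l + d • w) (l + d • w) = B l l) (hv' : ∃ v', B (l + d • w) v' = d) :
    StabEquiv B l (l + d • w) := by
  have hfe : B f e = 1 := by rw [hB.symm, hef]
  have key : ∀ u v : L, B e u = 0 → B f u = 0 → B u v = d → StabEquiv B u (u - d • e) := by
    intro u v heu hfu huv
    obtain ⟨q, hq⟩ := hB.even (v - B f v • e - B e v • f)
    have h := stabEquiv_eichler hB q hee (a := v - B f v • e - B e v • f)
      (by simp [hee, hef]) (by rw [hq]; ring) u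
    have h1 : B (v - B f v • e - B e v • f) u = d := by
      simp [heu, hfu, hB.symm v u, huv]
    rw [h1, heu] at h
    simpa using h
  obtain ⟨v', hv'⟩ := hv'
  have h1 := key l v hel hfl hv
  have h2 := key (l + d • w) v' (by simp [hel, hew]) (by simp [hfl, hfw]) hv'
  refine h1.trans (StabEquiv.trans ?_ h2.symm)
  obtain ⟨q, hq⟩ := hB.even w
  have h3 := stabEquiv_eichler hB q hff (a := -w) (by simp [hfw]) (by simp [hq]; ring) (l - d • e)
  have h4 : B w l = - (d * q) := by
    simp only [map_add, map_smul, LinearMap.add_apply, LinearMap.smul_apply, smul_eq_mul,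
      hB.symm l w, hq] at hn
    have : d * (2 * (B w l + d * q)) = 0 := by linear_combination hn
    have := (mul_eq_zero.mp this).resolve_left hd
    linarith
  have h5 : B (-w) (l - d • e) = d * q := by
    simp [hB.symm w e, hew, h4]
  have h6 : B f (l - d • e) = -d := by simp [hfl, hfe]
  rw [h5, h6] at h3
  convert h3 using 1
  module

theorem StabEquiv.map_eq {l l' : L} (h : StabEquiv B l l') :
    ∃ g : L ≃ₗ[ℤ] L, g l = l' ∧ ∀ x y, B (g x) (g y) = B x y := by
  obtain ⟨g, hg, h⟩ := h
  exact ⟨g, h, hg.1.1⟩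

/-- `Õ⁺(L)` acts trivially on `L^∨ / L`. -/
theorem StabEquiv.exists_eq_add [Module.Free ℤ L] {l l' : L} (h : StabEquiv B l l') {d : ℤ}
    (hd : d ≠ 0) (hl : ∀ x, d ∣ B l x) : ∃ w, l' = l + d • w := by
  obtain ⟨g, hg, rfl⟩ := h
  have hd' : (d : ℚ) ≠ 0 := by exact_mod_cast hd
  have hm : ((1 : ℚ) / d) ⊗ₜ[ℤ] l ∈ dual B := mem_dual.mpr fun y => by
    obtain ⟨k, hk⟩ := hl y
    refine ⟨k, ?_⟩
    rw [ratForm_tmul, hk]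
    push_cast
    field_simp
  obtain ⟨z, hz⟩ := hg.1.2 _ hm
  have hz' : (1 : ℚ) ⊗ₜ[ℤ] z = ((1 : ℚ) / d) ⊗ₜ[ℤ] (g l) - ((1 : ℚ) / d) ⊗ₜ[ℤ] l := hz
  refine ⟨z, eq_add_of_sub_eq' (one_tmul_injective (L := L) ?_)⟩
  simp only
  rw [TensorProduct.tmul_smul, hz', ← TensorProduct.tmul_sub, ← Int.cast_smul_eq_zsmul ℚ,
    TensorProduct.smul_tmul', smul_eq_mul, mul_one_div_cancel hd']

/-- Eichler's criterion. -/
theorem stabEquiv_add_smul [Module.Free ℤ L] (hB : IsEvenLattice B) (hU : ContainsTwoU B)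
    {l l' w v v' : L} {d : ℤ} (hd : d ≠ 0) (hl : ∀ x, d ∣ B l x) (hl' : ∀ x, d ∣ B l' x)
    (hv : B l v = d) (hv' : B l' v' = d) (hn : B l' l' = B l l) (hw : l' = l + d • w) :
    StabEquiv B l l' := by
  obtain ⟨e, f, hee, hff, hef⟩ := hU
  -- Both vectors are moved into the complement of the second plane. Stable isometries change them
  -- only by elements of dL, so the congruence modulo dL survives. The new difference is then
  -- orthogonal to that plane as well.
  obtain ⟨l₁, s, he, hf⟩ := exists_stabEquiv_orthogonal hB hee hff hef l
  obtain ⟨l₂, s', he', hf'⟩ := exists_stabEquiv_orthogonal hB hee hff hef l'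
  obtain ⟨w₁, h1⟩ := s.exists_eq_add hd hl
  obtain ⟨w₂, h2⟩ := s'.exists_eq_add hd hl'
  obtain ⟨g, hg, hgB⟩ := s.map_eq
  obtain ⟨g', hg', hgB'⟩ := s'.map_eq
  have h3 : l₂ = l₁ + d • (w + w₂ - w₁) := by
    rw [h1, h2, hw]
    module
  refine s.trans (StabEquiv.trans ?_ s'.symm)
  rw [h3] at he' hf' ⊢
  refine stabEquiv_add_smul_of_orthogonal hB (hee 1 1) (hff 1 1) (by simp [hef]) he hf ?_ ?_ hd
    (v := g v) (by rw [← hg, hgB, hv]) (by rw [← h3, ← hg, ← hg', hgB, hgB', hn])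
    ⟨g' v', by rw [← h3, ← hg', hgB', hv']⟩
  · rw [map_add, he, zero_add, map_smul, smul_eq_mul] at he'
    exact (mul_eq_zero.mp he').resolve_left hd
  · rw [map_add, hf, zero_add, map_smul, smul_eq_mul] at hf'
    exact (mul_eq_zero.mp hf').resolve_left hd

/-- Equality of the classes [l/d] and [l'/d] in A_L is the congruence l' ≡ l mod dL required by
Eichler's criterion. -/
theorem stabEquiv_of_divClass_eq [Module.Free ℤ L] (hB : IsEvenLattice B) (hU : ContainsTwoU B)
    {l l' : L} (hd0 : 0 < divisor B l) (hd : divisor B l' = divisor B l) (hn : B l' l' = B l l)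
    (hc : divClass B l' = divClass B l) : StabEquiv B l l' := by
  have hd' : (divisor B l : ℤ) ≠ 0 := by exact_mod_cast hd0.ne'
  have hdq : (divisor B l : ℚ) ≠ 0 := by exact_mod_cast hd0.ne'
  rw [divClass, divClass, discMk_eq] at hc
  obtain ⟨w, hw⟩ := hc
  have hw' : (1 : ℚ) ⊗ₜ[ℤ] w = ((1 : ℚ) / divisor B l') ⊗ₜ l' - ((1 : ℚ) / divisor B l) ⊗ₜ l := hw
  rw [hd, ← TensorProduct.tmul_sub] at hw'
  obtain ⟨v, hv⟩ := exists_eq_divisor (B := B) l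
  obtain ⟨v', hv'⟩ := exists_eq_divisor (B := B) l'
  refine stabEquiv_add_smul hB hU hd' (divisor_dvd l) (fun x => hd ▸ divisor_dvd l' x) hv
    (hd ▸ hv') hn (w := w) ?_
  refine eq_add_of_sub_eq' (one_tmul_injective (L := L) ?_)
  simp only
  rw [TensorProduct.tmul_smul, hw', ← Int.cast_smul_eq_zsmul ℚ, TensorProduct.smul_tmul',
    smul_eq_mul, Int.cast_natCast, mul_one_div_cancel hdq]

theorem divisor_neg (l : L) : divisor B (-l) = divisor B l := by
  have : LinearMap.range (B (-l)) = LinearMap.range (B l) := by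
    rw [map_neg, LinearMap.range_neg]
  unfold divisor
  congr

theorem divClass_neg (l : L) : divClass B (-l) = -divClass B l := by
  rw [divClass, divClass, ← neg_one_zsmul (discMk _), ← discMk_smul]
  congr 1
  apply Subtype.ext
  change ((1 : ℚ) / divisor B (-l)) ⊗ₜ[ℤ] (-l) = (-1 : ℤ) • (((1 : ℚ) / divisor B l) ⊗ₜ[ℤ] l)
  rw [divisor_neg, TensorProduct.tmul_neg, neg_one_zsmul]

theorem orbitRel_of_divClass [Module.Free ℤ L] (hB : IsEvenLattice B) (hU : ContainsTwoU B)
    {l l' : L} (hd0 : 0 < divisor B l) (hd : divisor B l' = divisor B l) (hn : B l' l' = B l l)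
    (hc : divClass B l' = divClass B l ∨ divClass B l' = -divClass B l) :
    MulAction.orbitRel (stableGroupPlusNeg B) L l l' := by
  refine Setoid.symm' _ ?_
  rw [MulAction.orbitRel_apply, MulAction.mem_orbit_iff]
  rcases hc with hc | hc
  · obtain ⟨g, hg, h⟩ := stabEquiv_of_divClass_eq hB hU hd0 hd hn hc
    exact ⟨⟨g, Subgroup.mem_sup_left hg⟩, h⟩
  · obtain ⟨g, hg, h⟩ := stabEquiv_of_divClass_eq hB hU (l := l) (l' := -l') hd0
      (by rw [divisor_neg, hd]) (by simp [hn]) (by rw [divClass_neg, hc, neg_neg])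
    refine ⟨⟨LinearEquiv.neg ℤ * g, mul_mem (Subgroup.mem_sup_right (Subgroup.mem_zpowers _))
      (Subgroup.mem_sup_left hg)⟩, ?_⟩
    change -(g l) = l'
    rw [h, neg_neg]

end Eichler
end OrthLattice
end

open scoped TensorProduct
noncomputable section
namespace OrthLattice
-- Orbit counting
section Counting
open QuadraticMap Module
variable {A : Type*} [AddCommGroup A] {Q : QuadMod A}

instance isoGroup_finite [Finite A] : Finite (isoGroup Q) :=
  have : Finite (A ≃ₗ[ℤ] A) := DFunLike.finite _
  inferInstance

theorem isoGroup_neg_mem : LinearEquiv.neg ℤ ∈ isoGroup Q := fun x => QuadraticMap.map_neg Q x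

/-- If the points `x c` fall into at most `|T|` orbits, then the inverses of their orbit lengths
add up to at most `|T|`. -/
theorem sum_card_stab_le [Finite A] {C T : Type*} [Fintype C] [Fintype T] (x : C → A)
    (hx : Function.Injective x) (τ : C → T) (hτ : ∀ c c', τ c = τ c' → IsoEquiv Q (x c) (x c')) :
    ∑ c, Nat.card {g : isoGroup Q // g.1 (x c) = x c} ≤ Fintype.card T * Nat.card (isoGroup Q) := by
  -- In each fibre of τ one base index is fixed, with an isometry h_c carrying the base point to
  -- x_c. The map (c,g) ↦ (τ(c), g h_c) is injective: since g fixes x_c, the product sends the base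
  -- point to x_c and so recovers c.
  have hex : ∀ c, ∃ h : isoGroup Q, ∀ c', c' = @Function.invFun _ _ ⟨c⟩ τ (τ c) →
      h.1 (x c') = x c := by
    intro c
    obtain ⟨g, hg, h⟩ := hτ (@Function.invFun _ _ ⟨c⟩ τ (τ c)) c
      (@Function.invFun_eq _ _ ⟨c⟩ τ _ ⟨c, rfl⟩)
    exact ⟨⟨g, hg⟩, by rintro _ rfl; exact h⟩
  choose h hh using hex
  rw [← Nat.card_sigma, ← Nat.card_eq_fintype_card, ← Nat.card_prod]
  refine Nat.card_le_card_of_injective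
    (fun p : (c : C) × {g : isoGroup Q // g.1 (x c) = x c} => (τ p.1, p.2.1 * h p.1)) ?_
  rintro ⟨c, g, hg⟩ ⟨c', g', hg'⟩ hcc
  have h1 : τ c = τ c' := congrArg Prod.fst hcc
  have h2 : g * h c = g' * h c' := congrArg Prod.snd hcc
  have h3 := hh c _ rfl
  have h4 := hh c' _ rfl
  rw [← h1] at h4
  have h5 : x c = x c' := by
    have e1 : (g * h c).1 (x (@Function.invFun _ _ ⟨c⟩ τ (τ c))) = x c := by
      change g.1 ((h c).1 _) = _
      rw [h3, hg]
    have e2 : (g' * h c').1 (x (@Function.invFun _ _ ⟨c'⟩ τ (τ c))) = x c' := by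
      change g'.1 ((h c').1 _) = _
      rw [h4, hg']
    rw [← e1, ← e2, h2]
  obtain rfl := hx h5
  obtain rfl := mul_right_cancel h2
  rfl

/-- The variant of `sum_card_stab_le` for points that are distinct up to sign. -/
theorem two_mul_sum_card_stab_le [Finite A] {C T : Type*} [Fintype C] [Fintype T] (x : C → A)
    (hx : Function.Injective x) (hx' : ∀ c c', x c ≠ -x c') (τ : C → T)
    (hτ : ∀ c c', τ c = τ c' → IsoEquiv Q (x c) (x c')) :
    2 * ∑ c, Nat.card {g : isoGroup Q // g.1 (x c) = x c} ≤
      Fintype.card T * Nat.card (isoGroup Q) := by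
  have hneg : ∀ z, IsoEquiv Q z (-z) := fun z => ⟨_, isoGroup_neg_mem, rfl⟩
  -- The count is applied to all the points x_c and -x_c, which are distinct by assumption,
  -- equivalent in pairs under -1, and have equal stabilizers.
  have key := sum_card_stab_le (Q := Q) (C := C × Bool) (T := T)
    (fun p => if p.2 then x p.1 else -x p.1) (by
      rintro ⟨c, b⟩ ⟨c', b'⟩ h
      cases b <;> cases b' <;> simp only [if_true, if_false, Bool.false_eq_true] at h
      · rw [hx (neg_injective h)]
      · exact (hx' _ _ h.symm).elim
      · exact (hx' _ _ h).elim
      · rw [hx h]) (fun p => τ p.1) (by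
      rintro ⟨c, b⟩ ⟨c', b'⟩ h
      have h1 := hτ c c' h
      cases b <;> cases b' <;> simp only [if_true, if_false, Bool.false_eq_true]
      · exact ((hneg _).symm.trans h1).trans (hneg _)
      · exact (hneg _).symm.trans h1
      · exact h1.trans (hneg _)
      · exact h1)
  rw [Fintype.sum_prod_type] at key
  refine le_trans (le_of_eq ?_) key
  rw [Finset.mul_sum]
  refine Finset.sum_congr rfl fun c _ => ?_
  rw [Fintype.sum_bool]
  simp only [if_true, if_false, Bool.false_eq_true, map_neg, neg_inj]
  rw [two_mul]

/-- The orbit-stabilizer inequality. -/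
theorem card_isoGroup_le [Finite A] (y : A) (S : A → Prop) (hS : ∀ g ∈ isoGroup Q, S (g y)) :
    Nat.card (isoGroup Q) ≤ Nat.card {z // S z} * Nat.card {g : isoGroup Q // g.1 y = y} := by
  let s : A → isoGroup Q := fun z => Classical.epsilon fun h : isoGroup Q => h.1 y = z
  have hs : ∀ g : isoGroup Q, (s (g.1 y)).1 y = g.1 y := fun g =>
    Classical.epsilon_spec (p := fun h : isoGroup Q => h.1 y = g.1 y) ⟨g, rfl⟩
  rw [← Nat.card_prod]
  refine Nat.card_le_card_of_injective (fun g : isoGroup Q =>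
    ((⟨g.1 y, hS _ g.2⟩, ⟨(s (g.1 y))⁻¹ * g, ?_⟩) :
      {z // S z} × {g : isoGroup Q // g.1 y = y})) ?_
  · change (s (g.1 y)).1⁻¹ (g.1 y) = y
    rw [← hs g]
    simp only [hs]
    nth_rewrite 2 [← hs g]
    exact (s (g.1 y)).1.symm_apply_apply y
  · intro g g' h
    have h1 : g.1 y = g'.1 y := congrArg (fun p => p.1.1) h
    have h2 : (s (g.1 y))⁻¹ * g = (s (g'.1 y))⁻¹ * g' := congrArg (fun p => p.2.1) h
    rw [h1] at h2
    exact mul_left_cancel h2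

end Counting
section Ratio
variable {L : Type*} [AddCommGroup L] {B : LinearMap.BilinForm ℤ L}

theorem discNeg_sq (hB : IsEvenLattice B) : discNeg hB ^ 2 = 1 := by
  refine Subtype.ext (LinearEquiv.ext fun x => ?_)
  change -(-x) = x
  rw [neg_neg]

/-- The order of -1 is 1 exactly for 2-elementary groups and 2 otherwise. Comparing these orders for
A_L and A_K is the only place where the quotients by ±1 can cost a factor. -/
theorem cardDiscO_mul (hB : IsEvenLattice B) :
    cardDiscO hB * orderOf (discNeg hB) = Nat.card (isoGroup (discQuad hB)) := by
  have := Subgroup.card_eq_card_quotient_mul_card_subgroup (Subgroup.zpowers (discNeg hB))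
  rw [Nat.card_zpowers] at this
  exact this.symm

theorem discNeg_eq_one_iff (hB : IsEvenLattice B) :
    discNeg hB = 1 ↔ ∀ x : Disc B, (2 : ℤ) • x = 0 := by
  constructor
  · intro h x
    have : -x = x := congrArg (fun g : discO hB => g.1 x) h
    rw [two_smul]
    nth_rewrite 1 [← this]
    exact neg_add_cancel x
  · intro h
    refine Subtype.ext (LinearEquiv.ext fun x => ?_)
    change -x = x
    have := h x
    rw [two_smul] at this
    exact neg_eq_of_add_eq_zero_left this

variable [Module.Free ℤ L] [Module.Finite ℤ L]

theorem cardDiscO_pos (hB : IsEvenLattice B) (hN : IsNondeg B) : 0 < cardDiscO hB := by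
  have := disc_finite hB hN
  have h1 : 0 < Nat.card (isoGroup (discQuad hB)) := Nat.card_pos
  rw [← cardDiscO_mul] at h1
  exact pos_of_mul_pos_left h1 (Nat.zero_le _)

end Ratio
end OrthLattice
end

open scoped TensorProduct
noncomputable section
namespace OrthLattice
-- The bound for each type
section Bounds
open QuadraticMap Module
theorem card_isoGroup_le_of_fixed {A : Type*} [AddCommGroup A] [Finite A] {Q : QuadMod A} {y : A}
    (hy : ∀ g ∈ isoGroup Q, g y = y) :
    Nat.card (isoGroup Q) ≤ Nat.card {g : isoGroup Q // g.1 y = y} := by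
  simpa using card_isoGroup_le (Q := Q) y (· = y) hy

variable {L : Type*} [AddCommGroup L] {B : LinearMap.BilinForm ℤ L}

theorem exists_isGluing_of_divisor_eq (hB : IsEvenLattice B) (hN : IsNondeg B) {l : L} {d e : ℕ}
    (hd : divisor B l = d) (hd0 : 0 < d) (he0 : 0 < e) (hl : B l l = -((d * e : ℕ) : ℤ)) :
    ∃ y Φ, IsGluing (discQuad hB) (discQuad (hB.complement l)) d e (divClass B l) y Φ := by
  subst hd
  obtain ⟨y, Φ, h, -⟩ := exists_isGluing hB hN hd0 he0 hl
  exact ⟨y, Φ, h⟩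

theorem neg_ne_of_divisor [Module.Free ℤ L] {C : Type*} (l : C → L)
    (hinj : ∀ c c', divClass B (l c') = -divClass B (l c) → c = c')
    (hp : ∀ c, IsPrimitiveVec (l c)) {d : ℕ} (hd2 : 2 < d) (hd : ∀ c, divisor B (l c) = d)
    (c c' : C) : divClass B (l c) ≠ -divClass B (l c') := fun h => by
  obtain rfl := hinj _ _ h
  exact divClass_ne_neg (hp c') (by rw [hd]; exact hd2) h

variable [Module.Free ℤ L] [Module.Finite ℤ L]

/-- The assumption says that -1 is trivial on A_L whenever it is trivial on A_K. Passing to the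
quotients by ±1 therefore cannot increase the ratio. -/
theorem discRatio_mul_le_of_two_torsion (hB : IsEvenLattice B) (hN : IsNondeg B) {l : L}
    (h2 : (∀ x : Disc (LinearMap.BilinForm.restrict B (complement B l)), (2 : ℤ) • x = 0) →
      ∀ x : Disc B, (2 : ℤ) • x = 0) :
    discRatio hB l * Nat.card (isoGroup (discQuad hB)) ≤
      Nat.card (isoGroup (discQuad (hB.complement l))) := by
  have hpos := cardDiscO_pos hB hN
  have h0 : (cardDiscO hB : ℚ) ≠ 0 := by exact_mod_cast hpos.ne'
  have hord : orderOf (discNeg hB) ≤ orderOf (discNeg (hB.complement l)) := by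
    by_cases h : discNeg (hB.complement l) = 1
    · rw [(discNeg_eq_one_iff hB).mpr (h2 ((discNeg_eq_one_iff _).mp h)), h]
      simp
    · rw [orderOf_eq_prime (discNeg_sq _) h]
      exact orderOf_le_of_pow_eq_one two_pos (discNeg_sq hB)
  rw [discRatio, ← cardDiscO_mul, ← cardDiscO_mul]
  push_cast
  rw [div_mul_eq_mul_div, mul_left_comm, mul_div_cancel_left₀ _ h0]
  gcongr

theorem discRatio_mul_le_two (hB : IsEvenLattice B) (hN : IsNondeg B) (l : L) :
    discRatio hB l * Nat.card (isoGroup (discQuad hB)) ≤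
      (2 * Nat.card (isoGroup (discQuad (hB.complement l))) : ℕ) := by
  have hpos := cardDiscO_pos hB hN
  have h0 : (cardDiscO hB : ℚ) ≠ 0 := by exact_mod_cast hpos.ne'
  have h1 : orderOf (discNeg hB) ≤ 2 := orderOf_le_of_pow_eq_one two_pos (discNeg_sq hB)
  have h2 : 1 ≤ orderOf (discNeg (hB.complement l)) :=
    orderOf_pos_iff.mpr (isOfFinOrder_iff_pow_eq_one.mpr ⟨2, two_pos, discNeg_sq _⟩)
  have h3 : discRatio hB l * Nat.card (isoGroup (discQuad hB)) =
      ((cardDiscO (hB.complement l) * orderOf (discNeg hB) : ℕ) : ℚ) := by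
    rw [discRatio, ← cardDiscO_mul]
    push_cast
    field_simp
  rw [h3, ← cardDiscO_mul]
  norm_cast
  calc _ ≤ cardDiscO (hB.complement l) * 2 := by gcongr
    _ ≤ cardDiscO (hB.complement l) * 2 * orderOf (discNeg (hB.complement l)) :=
      Nat.le_mul_of_pos_right _ h2
    _ = _ := by ring

/-- Summation of the ratios over representatives lying in at most `|T|` orbits of `O(A_L)`. -/
theorem sum_discRatio_le (hB : IsEvenLattice B) (hN : IsNondeg B) {C T : Type*} [Fintype C]
    [Fintype T] (l : C → L) (κ : ℕ)
    (hinj : Function.Injective fun c => divClass B (l c))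
    (hκ : ∀ c, discRatio hB (l c) * Nat.card (isoGroup (discQuad hB)) ≤
      (κ * Nat.card {g : isoGroup (discQuad hB) // g.1 (divClass B (l c)) = divClass B (l c)} : ℕ))
    (τ : C → T)
    (hτ : ∀ c c', τ c = τ c' → IsoEquiv (discQuad hB) (divClass B (l c)) (divClass B (l c'))) :
    ∑ c, discRatio hB (l c) ≤ κ * Fintype.card T := by
  have := disc_finite hB hN
  have hO : (0 : ℚ) < Nat.card (isoGroup (discQuad hB)) := by exact_mod_cast Nat.card_pos
  refine le_of_mul_le_mul_right ?_ hO
  rw [Finset.sum_mul]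
  refine (Finset.sum_le_sum fun c _ => hκ c).trans ?_
  rw [← Nat.cast_sum, ← Finset.mul_sum, mul_assoc]
  exact_mod_cast Nat.mul_le_mul_left κ (sum_card_stab_le _ hinj τ hτ)

theorem two_mul_sum_discRatio_le (hB : IsEvenLattice B) (hN : IsNondeg B) {C T : Type*} [Fintype C]
    [Fintype T] (l : C → L) (κ : ℕ)
    (hinj : Function.Injective fun c => divClass B (l c))
    (hneg : ∀ c c', divClass B (l c) ≠ -divClass B (l c'))
    (hκ : ∀ c, discRatio hB (l c) * Nat.card (isoGroup (discQuad hB)) ≤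
      (κ * Nat.card {g : isoGroup (discQuad hB) // g.1 (divClass B (l c)) = divClass B (l c)} : ℕ))
    (τ : C → T)
    (hτ : ∀ c c', τ c = τ c' → IsoEquiv (discQuad hB) (divClass B (l c)) (divClass B (l c'))) :
    2 * ∑ c, discRatio hB (l c) ≤ κ * Fintype.card T := by
  have := disc_finite hB hN
  have hO : (0 : ℚ) < Nat.card (isoGroup (discQuad hB)) := by exact_mod_cast Nat.card_pos
  refine le_of_mul_le_mul_right ?_ hO
  rw [mul_assoc, Finset.sum_mul]
  refine (mul_le_mul_of_nonneg_left (Finset.sum_le_sum fun c _ => hκ c) two_pos.le).trans ?_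
  rw [← Nat.cast_sum, ← Finset.mul_sum, mul_assoc]
  have := Nat.mul_le_mul_left κ (two_mul_sum_card_stab_le _ hinj hneg τ hτ)
  rw [mul_left_comm] at this
  exact_mod_cast this

/-- With d = 2 and e = 1, the gluing has y = 0, so all of O(A_K) embeds into Stab(x). The element x
is 2-torsion of norm -1/2, and such elements form at most four orbits. -/
theorem sum_discRatio_le_AI (hB : IsEvenLattice B) (hN : IsNondeg B) {C : Type*} [Fintype C]
    (l : C → L) (hinj : Function.Injective fun c => divClass B (l c))
    (hd : ∀ c, divisor B (l c) = 2) (hl : ∀ c, B (l c) (l c) = -2) :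
    ∑ c, discRatio hB (l c) ≤ 4 := by
  have := disc_finite hB hN
  have hQ := discQuad_nondeg hB hN
  have hl0 : ∀ c, B (l c) (l c) ≠ 0 := fun c => by rw [hl]; norm_num
  have hglue := fun c => exists_isGluing_of_divisor_eq hB hN (e := 1) (hd c) two_pos one_pos
    (by rw [hl]; norm_num)
  choose y Φ hΦ using hglue
  obtain ⟨τ, hτ⟩ := exists_classify_minusHalf hQ
  have hx : ∀ c, IsMinusHalf (discQuad hB) (divClass B (l c)) := by
    intro c
    have h1 := mk_zero_mem_glueGroup (Q' := discQuad (hB.complement (l c))) (y := y c) one_pos 1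
    rw [mul_one] at h1
    have hb := (hΦ c).base ⟨_, h1⟩ rfl
    constructor
    · rw [← hb, ← map_zsmul, (hΦ c).ker]
      refine ⟨-1, Prod.ext ?_ ?_⟩
      · change (2 : ℤ) • ((1 : ℕ) : ℤ) = _
        norm_num
      · change (2 : ℤ) • (0 : Disc _) = _
        rw [(hΦ c).eq_zero_of_one, smul_zero, smul_zero]
    · rw [← hb, (hΦ c).map]
      change _ + discQuad (hB.complement (l c)) 0 = _
      rw [QuadraticMap.map_zero, add_zero]
      norm_num
  have key := sum_discRatio_le hB hN l 1 hinj (fun c => ?_) (fun c => τ (divClass B (l c)))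
    (fun c c' h => hτ _ _ (hx c) (hx c') h)
  · simpa using key
  · have := disc_finite (hB.complement (l c)) (complement_isNondeg hB hN (hl0 c))
    refine (discRatio_mul_le_of_two_torsion hB hN fun h2 =>
      (hΦ c).two_smul_eq_zero h2 (by norm_num)).trans ?_
    rw [one_mul]
    exact_mod_cast (card_isoGroup_le_of_fixed (y := y c) fun g _ => by
      rw [(hΦ c).eq_zero_of_one, map_zero]).trans ((hΦ c).card_stab_le hQ two_pos one_pos)

/-- With d = 1 and e = 2, the class x is zero, so there is a single orbit. The element y is
2-torsion of norm 1/2, and the elements of this kind in A_K are no more numerous than the 2-torsion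
of A_L. -/
theorem sum_discRatio_le_AII (hB : IsEvenLattice B) (hN : IsNondeg B) {C : Type*} [Fintype C]
    (l : C → L) (hinj : Function.Injective fun c => divClass B (l c))
    (hp : ∀ c, IsPrimitiveVec (l c))
    (hd : ∀ c, divisor B (l c) = 1) (hl : ∀ c, B (l c) (l c) = -2) :
    ∑ c, discRatio hB (l c) ≤ Nat.card {x : Disc B // (2 : ℤ) • x = 0} := by
  have := disc_finite hB hN
  have hQ := discQuad_nondeg hB hN
  have hl0 : ∀ c, B (l c) (l c) ≠ 0 := fun c => by rw [hl]; norm_num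
  have hglue := fun c => exists_isGluing_of_divisor_eq hB hN (e := 2) (hd c) one_pos two_pos
    (by rw [hl]; norm_num)
  choose y Φ hΦ using hglue
  have hx : ∀ c, divClass B (l c) = 0 := fun c => by
    have := (smul_divClass_eq_zero_iff (hp c) (by rw [hd]; exact one_pos) 1).mpr (by rw [hd]; simp)
    rwa [one_smul] at this
  have key := sum_discRatio_le hB hN l (Nat.card {x : Disc B // (2 : ℤ) • x = 0}) hinj (fun c => ?_)
    (fun _ => ()) (fun c c' _ => by rw [hx, hx]; exact .refl _)
  · simpa using key
  · have := disc_finite (hB.complement (l c)) (complement_isNondeg hB hN (hl0 c))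
    refine (discRatio_mul_le_of_two_torsion hB hN fun h2 =>
      (hΦ c).two_smul_eq_zero h2 (by norm_num)).trans ?_
    have h3 := card_isoGroup_le (Q := discQuad (hB.complement (l c))) (y c)
      (fun z => (2 : ℤ) • z = 0 ∧ discQuad (hB.complement (l c)) z = ((1 / 2 : ℚ) : AddCircle (2 : ℚ)))
      (fun g hg => by
        refine ⟨?_, ?_⟩
        · have := (hΦ c).torsion
          push_cast at this
          rw [← map_zsmul, this, map_zero]
        · rw [hg, (hΦ c).norm]
          norm_num)
    exact_mod_cast h3.trans (Nat.mul_le_mul (hΦ c).card_half_le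
      ((hΦ c).card_stab_le hQ one_pos two_pos))

/-- With e = 1, y = 0 and the orbit of x depends only on the isometry class of A_K, which is
2-elementary of fixed order. The at most eight classes give the bound, the factor 2 from ±1 being
cancelled because x has order d > 2. -/
theorem sum_discRatio_le_BI (hB : IsEvenLattice B) (hN : IsNondeg B) {C : Type*} [Fintype C]
    (l : C → L) (hinj : Function.Injective fun c => divClass B (l c))
    (hinj' : ∀ c c', divClass B (l c') = -divClass B (l c) → c = c')
    (hp : ∀ c, IsPrimitiveVec (l c)) (hr : ∀ c, ActsAsNegId B (reflection B (l c)))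
    {d : ℕ} (hd2 : 2 < d) (hd : ∀ c, divisor B (l c) = d)
    (hl : ∀ c, B (l c) (l c) = -((d * 1 : ℕ) : ℤ)) :
    ∑ c, discRatio hB (l c) ≤ 8 := by
  have := disc_finite hB hN
  have hQ := discQuad_nondeg hB hN
  have hd0 : 0 < d := by omega
  have hl0 : ∀ c, B (l c) (l c) ≠ 0 := fun c => by rw [hl]; omega
  have hglue := fun c => exists_isGluing_of_divisor_eq hB hN (e := 1) (hd c) hd0 one_pos (hl c)
  choose y Φ hΦ using hglue
  have hfin : ∀ c, Finite (Disc (LinearMap.BilinForm.restrict B (complement B (l c)))) := fun c =>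
    disc_finite (hB.complement (l c)) (complement_isNondeg hB hN (hl0 c))
  obtain ⟨τ, hτ⟩ := exists_classify_two_elementary
    (fun c => Disc (LinearMap.BilinForm.restrict B (complement B (l c))))
    (fun c => discQuad (hB.complement (l c)))
    (fun c => discQuad_nondeg _ (complement_isNondeg hB hN (hl0 c)))
    (fun c => two_smul_disc_complement_eq_zero hB hN (by rw [hd]; exact hd0) one_pos
      (by rw [hd]; exact hl c) (hr c))
    (fun c c' => mul_left_cancel₀ hd0.ne' (((hΦ c).card_mul hd0 one_pos).trans
      ((hΦ c').card_mul hd0 one_pos).symm))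
  have key := two_mul_sum_discRatio_le hB hN l 2 hinj (neg_ne_of_divisor l hinj' hp hd2 hd)
    (fun c => ?_) τ (fun c c' h => ?_)
  · simp at key
    linarith
  · refine (discRatio_mul_le_two hB hN (l c)).trans ?_
    exact_mod_cast Nat.mul_le_mul_left 2 ((card_isoGroup_le_of_fixed (y := y c) fun g _ => by
      rw [(hΦ c).eq_zero_of_one, map_zero]).trans ((hΦ c).card_stab_le hQ hd0 one_pos))
  · obtain ⟨ψ, hψ⟩ := hτ c c' h
    obtain ⟨g, hg, hgx, -⟩ := (hΦ c).exists_isometry (hΦ c') hQ one_pos ψ hψ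
      (by rw [(hΦ c).eq_zero_of_one, (hΦ c').eq_zero_of_one, map_zero])
    exact ⟨g, hg, hgx⟩

/-- The orbit of x is determined by the pair (A_K, y) with y ≠ 0, of which there are at most 32
classes. The orbit of y is bounded by |A_K| = 2|A_L|/d ≤ κ. The factor 2 from ±1 is kept, since d =
2 is allowed here. -/
theorem sum_discRatio_le_BII (hB : IsEvenLattice B) (hN : IsNondeg B) {C : Type*} [Fintype C]
    (l : C → L) (hinj : Function.Injective fun c => divClass B (l c))
    (hp : ∀ c, IsPrimitiveVec (l c)) (hr : ∀ c, ActsAsNegId B (reflection B (l c)))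
    {d κ : ℕ} (hd0 : 0 < d) (hd : ∀ c, divisor B (l c) = d)
    (hl : ∀ c, B (l c) (l c) = -((d * 2 : ℕ) : ℤ)) (hκ : 2 * Nat.card (Disc B) ≤ d * κ) :
    ∑ c, discRatio hB (l c) ≤ 64 * κ := by
  have := disc_finite hB hN
  have hQ := discQuad_nondeg hB hN
  have hl0 : ∀ c, B (l c) (l c) ≠ 0 := fun c => by rw [hl]; omega
  have hglue := fun c => exists_isGluing_of_divisor_eq hB hN (e := 2) (hd c) hd0 two_pos (hl c)
  choose y Φ hΦ using hglue
  have hfin : ∀ c, Finite (Disc (LinearMap.BilinForm.restrict B (complement B (l c)))) := fun c =>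
    disc_finite (hB.complement (l c)) (complement_isNondeg hB hN (hl0 c))
  obtain ⟨τ, hτ⟩ := exists_classify_pointed
    (fun c => Disc (LinearMap.BilinForm.restrict B (complement B (l c))))
    (fun c => discQuad (hB.complement (l c)))
    (fun c => discQuad_nondeg _ (complement_isNondeg hB hN (hl0 c)))
    (fun c => two_smul_disc_complement_eq_zero hB hN (by rw [hd]; exact hd0) two_pos
      (by rw [hd]; exact hl c) (hr c))
    (fun c c' => mul_left_cancel₀ hd0.ne' (((hΦ c).card_mul hd0 two_pos).trans
      ((hΦ c').card_mul hd0 two_pos).symm)) y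
    (fun c hy => by
      obtain ⟨k, hk, hkx⟩ := (hΦ c).exists_smul_eq_zero hy
      rw [smul_divClass_eq_zero_iff (hp c) (by rw [hd]; exact hd0), hd] at hkx
      have := Nat.le_of_dvd (by omega) (Int.natCast_dvd_natCast.mp hkx)
      omega) _ (fun c => (hΦ c).norm)
  have key := sum_discRatio_le hB hN l (2 * κ) hinj (fun c => ?_) τ (fun c c' h => ?_)
  · simp at key
    linarith
  · refine (discRatio_mul_le_two hB hN (l c)).trans ?_
    have h1 := card_isoGroup_le (Q := discQuad (hB.complement (l c))) (y c) (fun _ => True)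
      (fun _ _ => trivial)
    have h2 : Nat.card {z : Disc (LinearMap.BilinForm.restrict B (complement B (l c))) // True} ≤
        κ := by
      rw [Nat.card_congr (Equiv.subtypeUnivEquiv fun _ => trivial)]
      refine Nat.le_of_mul_le_mul_left ?_ hd0
      have := (hΦ c).card_mul hd0 two_pos
      omega
    rw [mul_assoc]
    exact_mod_cast Nat.mul_le_mul_left 2 (h1.trans (Nat.mul_le_mul h2
      ((hΦ c).card_stab_le hQ hd0 two_pos)))
  · obtain ⟨ψ, hψ, hy⟩ := hτ c c' h
    obtain ⟨g, hg, hgx, -⟩ := (hΦ c).exists_isometry (hΦ c') hQ two_pos ψ hψ hy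
    exact ⟨g, hg, hgx⟩

/-- Here |A_K| = 2|A_L|/d = 2. As d is odd, y is nonzero, so it generates A_K and its norm d/2
determines the form. All x thus lie in one orbit, and y is fixed by O(A_K). -/
theorem sum_discRatio_le_BIII (hB : IsEvenLattice B) (hN : IsNondeg B) {C : Type*} [Fintype C]
    (l : C → L) (hinj : Function.Injective fun c => divClass B (l c))
    (hinj' : ∀ c c', divClass B (l c') = -divClass B (l c) → c = c')
    (hp : ∀ c, IsPrimitiveVec (l c))
    {d : ℕ} (hd2 : 2 < d) (hodd : Odd d) (hcard : Nat.card (Disc B) = d)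
    (hd : ∀ c, divisor B (l c) = d) (hl : ∀ c, B (l c) (l c) = -((d * 2 : ℕ) : ℤ)) :
    ∑ c, discRatio hB (l c) ≤ 1 := by
  have := disc_finite hB hN
  have hQ := discQuad_nondeg hB hN
  have hd0 : 0 < d := by omega
  have hl0 : ∀ c, B (l c) (l c) ≠ 0 := fun c => by rw [hl]; omega
  have hglue := fun c => exists_isGluing_of_divisor_eq hB hN (e := 2) (hd c) hd0 two_pos (hl c)
  choose y Φ hΦ using hglue
  have hfin : ∀ c, Finite (Disc (LinearMap.BilinForm.restrict B (complement B (l c)))) := fun c =>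
    disc_finite (hB.complement (l c)) (complement_isNondeg hB hN (hl0 c))
  have hy0 : ∀ c, y c ≠ 0 := fun c hy => by
    obtain ⟨k, hk, -⟩ := (hΦ c).exists_smul_eq_zero hy
    rw [hk] at hodd
    exact Nat.not_odd_iff_even.mpr (even_two_mul k) hodd
  have hc2 : ∀ c, Nat.card (Disc (LinearMap.BilinForm.restrict B (complement B (l c)))) = 2 :=
    fun c => mul_left_cancel₀ hd0.ne' (by rw [(hΦ c).card_mul hd0 two_pos, hcard, mul_comm])
  have hy : ∀ c z, z = 0 ∨ z = y c := fun c z => by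
    by_contra! h
    have hfi : Function.Injective ![0, y c, z] := by
      intro i j hij
      fin_cases i <;> fin_cases j <;> simp_all [hy0 c, h.1.symm, h.2.symm, (hy0 c).symm]
    have := Nat.card_le_card_of_injective _ hfi
    rw [hc2] at this
    simp at this
  have key := two_mul_sum_discRatio_le hB hN l 2 hinj (neg_ne_of_divisor l hinj' hp hd2 hd)
    (fun c => ?_) (fun _ => ()) (fun c c' h => ?_)
  · simp at key
    linarith
  · refine (discRatio_mul_le_two hB hN (l c)).trans ?_
    exact_mod_cast Nat.mul_le_mul_left 2 ((card_isoGroup_le_of_fixed (y := y c) fun g _ =>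
      (hy c (g (y c))).resolve_left fun h => hy0 c (by simpa using h)).trans
        ((hΦ c).card_stab_le hQ hd0 two_pos))
  · have hsurj : ∀ c, Function.Surjective (zmultiplesHom _ (y c)) := fun c z => by
      rcases hy c z with rfl | rfl
      · exact ⟨0, by simp⟩
      · exact ⟨1, by simp⟩
    obtain ⟨ψ, hψ, hψy⟩ := exists_isometry_of_surjective
      (discQuad_nondeg (hB.complement (l c)) (complement_isNondeg hB hN (hl0 c)))
      (discQuad_nondeg (hB.complement (l c')) (complement_isNondeg hB hN (hl0 c')))
      _ _ (hsurj c) (hsurj c') (fun p => by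
        rw [zmultiplesHom_apply, zmultiplesHom_apply, QuadraticMap.map_smul, QuadraticMap.map_smul,
          (hΦ c).norm, (hΦ c').norm])
    obtain ⟨g, hg, hgx, -⟩ := (hΦ c).exists_isometry (hΦ c') hQ two_pos ψ hψ
      (by simpa using hψy 1)
    exact ⟨g, hg, hgx⟩

end Bounds
end OrthLattice
end

open scoped TensorProduct
noncomputable section
namespace OrthLattice
-- Types, divisors and orders
section Types
open QuadraticMap Module
variable {L : Type*} [AddCommGroup L] {B : LinearMap.BilinForm ℤ L}

/-- The ratio `-(l, l) / div(l)` for vectors of a given type. -/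
def ReflType.index : ReflType → ℕ
  | .AI => 1
  | .AII => 2
  | .BI => 1
  | .BII => 2
  | .BIII => 2

theorem divisor_pos_and_norm_eq {l : L} {t : ReflType} (h : TypeCondition B l t) :
    0 < divisor B l ∧ B l l = -((divisor B l * t.index : ℕ) : ℤ) := by
  cases t with
  | AI => obtain ⟨-, h1, h2⟩ := h; rw [h1, h2]; simp [ReflType.index]
  | AII => obtain ⟨-, h1, h2⟩ := h; rw [h1, h2]; simp [ReflType.index]
  | BI =>
    obtain ⟨-, D, m, hD, -, h1, h2⟩ := h
    rw [h1, h2]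
    simp only [ReflType.index]
    omega
  | BII =>
    obtain ⟨-, D, m, hD, -, h1, h2⟩ := h
    rw [h1]
    simp only [ReflType.index]
    omega
  | BIII =>
    obtain ⟨-, D, hD, -, -, h1, h2⟩ := h
    rw [h1, h2]
    simp only [ReflType.index]
    omega

/-- An even D' kills the second presentation, including its ℤ/2 factors, while the first contains an
element of order D. -/
theorem dvd_of_even_of_equiv {A : Type*} [AddCommGroup A] {D D' m m' : ℕ} (hD' : Even D')
    (φ : A ≃+ ZMod D × (Fin m → ZMod 2)) (φ' : A ≃+ ZMod D' × (Fin m' → ZMod 2)) : D ∣ D' := by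
  obtain ⟨k, rfl⟩ := hD'
  have h0 : ∀ w : ZMod 2, (k + k) • w = 0 := fun w => by
    rw [← two_mul, mul_comm, mul_smul, nsmul_eq_mul 2, show ((2 : ℕ) : ZMod 2) = 0 from rfl,
      zero_mul, smul_zero]
  have h1 : ∀ z : ZMod (k + k) × (Fin m' → ZMod 2), (k + k) • z = 0 := fun z => by
    refine Prod.ext ?_ (funext fun i => ?_)
    · change (k + k) • z.1 = 0
      rw [nsmul_eq_mul, ZMod.natCast_self, zero_mul]
    · exact h0 (z.2 i)
  have h2 : (k + k) • ((1, 0) : ZMod D × (Fin m → ZMod 2)) = 0 := by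
    apply φ.symm.injective
    apply φ'.injective
    rw [map_nsmul, map_nsmul, h1, map_zero, map_zero]
  have h3 : (k + k) • (1 : ZMod D) = 0 := congrArg Prod.fst h2
  rw [nsmul_eq_mul, mul_one] at h3
  exact (ZMod.natCast_eq_zero_iff _ _).mp h3

/-- The integer D is quantified separately for each vector, but A_L determines it. For BI and BII it
is even, because L is even, and hence it is the exponent of A_L. For BIII it is the order of A_L. -/
theorem divisor_eq_of_typeCondition (hB : IsEvenLattice B) {l l' : L} {t : ReflType}
    (h : TypeCondition B l t) (h' : TypeCondition B l' t) : divisor B l' = divisor B l := by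
  have heven : ∀ (x : L) (D : ℕ), B x x = -(D : ℤ) → Even D := fun x D hx => by
    have := hB.even x
    rw [hx, even_neg] at this
    exact_mod_cast this
  cases t with
  | AI => rw [h.2.2, h'.2.2]
  | AII => rw [h.2.2, h'.2.2]
  | BI =>
    obtain ⟨-, D, m, hD, ⟨φ⟩, h1, h2⟩ := h
    obtain ⟨-, D', m', hD', ⟨φ'⟩, h1', h2'⟩ := h'
    rw [h2, h2']
    exact Nat.dvd_antisymm (dvd_of_even_of_equiv (heven _ _ h1) φ' φ)
      (dvd_of_even_of_equiv (heven _ _ h1') φ φ')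
  | BII =>
    obtain ⟨-, D, m, hD, ⟨φ⟩, h1, h2⟩ := h
    obtain ⟨-, D', m', hD', ⟨φ'⟩, h1', h2'⟩ := h'
    have := Nat.dvd_antisymm (dvd_of_even_of_equiv (heven _ _ h1) φ' φ)
      (dvd_of_even_of_equiv (heven _ _ h1') φ φ')
    omega
  | BIII =>
    obtain ⟨-, D, hD, ⟨φ⟩, -, -, h2⟩ := h
    obtain ⟨-, D', hD', ⟨φ'⟩, -, -, h2'⟩ := h'
    rw [h2, h2']
    have := Nat.card_congr (φ.symm.trans φ').toEquiv
    rw [Nat.card_zmod, Nat.card_zmod] at this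
    exact this.symm

/-- Classes of stably reflective vectors are determined by `± [l / div(l)] ∈ A_L`. -/
theorem reflClass_eq [Module.Free ℤ L] (hB : IsEvenLattice B) (hU : ContainsTwoU B)
    {t : ReflType} (l l' : ReflVec B t)
    (h : divClass B l'.1 = divClass B l.1 ∨ divClass B l'.1 = -divClass B l.1) :
    (Quotient.mk (reflSetoid B t) l) = Quotient.mk (reflSetoid B t) l' := by
  have hd := divisor_eq_of_typeCondition hB l.2.2 l'.2.2
  have h1 := divisor_pos_and_norm_eq l.2.2
  have h2 := divisor_pos_and_norm_eq l'.2.2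
  exact Quotient.sound (orbitRel_of_divClass hB hU h1.1 hd (by rw [h1.2, h2.2, hd]) h)

/-- Here |A_L| = 2d·2^m, while both the element d of ℤ/2d and the m factors ℤ/2 contribute to the
2-torsion, which has at least 2^(m+1) elements. Through |A_K| = 2|A_L|/d this bounds |A_K| by twice
the 2-torsion of A_L. -/
theorem card_disc_le {D m d : ℕ} [Finite (Disc B)] (hD : 2 * d = D) (hd0 : 0 < d)
    (φ : Disc B ≃+ ZMod D × (Fin m → ZMod 2)) :
    2 * Nat.card (Disc B) ≤ d * (2 * Nat.card {x : Disc B // (2 : ℤ) • x = 0}) := by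
  subst hD
  have h1 : Nat.card (Disc B) = 2 * d * 2 ^ m := by
    rw [Nat.card_congr φ.toEquiv, Nat.card_prod, Nat.card_zmod]
    simp
  have hne : (d : ZMod (2 * d)) ≠ 0 := fun h => by
    have := Nat.le_of_dvd hd0 ((ZMod.natCast_eq_zero_iff _ _).mp h)
    omega
  have h2 : 2 * 2 ^ m ≤ Nat.card {x : Disc B // (2 : ℤ) • x = 0} := by
    let f : Bool × (Fin m → ZMod 2) → {x : Disc B // (2 : ℤ) • x = 0} := fun p =>
      ⟨φ.symm (if p.1 then (d : ZMod (2 * d)) else 0, p.2), by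
        rw [← map_zsmul]
        refine (map_eq_zero_iff _ φ.symm.injective).mpr (Prod.ext ?_ (funext fun i => ?_))
        · change (2 : ℤ) • (if p.1 then (d : ZMod (2 * d)) else 0) = 0
          split_ifs
          · rw [zsmul_eq_mul]
            have := ZMod.natCast_self (2 * d)
            push_cast at this ⊢
            exact this
          · rw [smul_zero]
        · change (2 : ℤ) • p.2 i = 0
          rw [zsmul_eq_mul, show ((2 : ℤ) : ZMod 2) = 0 from rfl, zero_mul]⟩
    have hf : Function.Injective f := by
      rintro ⟨b, v⟩ ⟨b', v'⟩ h
      have h' := φ.symm.injective (congrArg Subtype.val h)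
      have e1 := congrArg Prod.fst h'
      have e2 : v = v' := congrArg Prod.snd h'
      subst e2
      cases b <;> cases b' <;> simp_all [hne.symm]
    have := Nat.card_le_card_of_injective f hf
    simpa using this
  rw [h1]
  calc 2 * (2 * d * 2 ^ m) = d * (2 * (2 * 2 ^ m)) := by ring
    _ ≤ _ := by gcongr

end Types
end OrthLattice
end

theorem proposition3p4 {L : Type*} [AddCommGroup L] [Module.Free ℤ L] [Module.Finite ℤ L]
    (B : LinearMap.BilinForm ℤ L) (hB : OrthLattice.IsEvenLattice B)
    (n : ℕ) (hsig : OrthLattice.HasSignature B 2 n) (hU : OrthLattice.ContainsTwoU B)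
    (t : OrthLattice.ReflType) :
    Finite (OrthLattice.ReflClass B t) ∧
    ∀ rep : OrthLattice.ReflClass B t → OrthLattice.ReflVec B t,
      (∀ c, Quotient.mk (OrthLattice.reflSetoid B t) (rep c) = c) →
        ∑ᶠ c : OrthLattice.ReflClass B t, OrthLattice.discRatio hB (rep c).val ≤
          OrthLattice.bound n t := by
  open OrthLattice in
  have hN := isNondeg_of_hasSignature hB hsig
  have hfinD := disc_finite hB hN
  have hinj : ∀ rep : ReflClass B t → ReflVec B t,
      (∀ c, Quotient.mk (reflSetoid B t) (rep c) = c) →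
      Function.Injective fun c => divClass B (rep c).1 := fun rep hrep c c' h => by
    rw [← hrep c, ← hrep c']
    exact reflClass_eq hB hU _ _ (Or.inl h.symm)
  -- Classes inject into the finite group A_L by way of [l/div(l)].
  have hfin : Finite (ReflClass B t) :=
    Finite.of_injective _ (hinj Quotient.out Quotient.out_eq)
  refine ⟨hfin, fun rep hrep => ?_⟩
  have hinj' : ∀ c c', divClass B (rep c').1 = -divClass B (rep c).1 → c = c' := fun c c' h => by
    rw [← hrep c, ← hrep c']
    exact reflClass_eq hB hU _ _ (Or.inr h)
  have := Fintype.ofFinite (ReflClass B t)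
  rw [finsum_eq_sum_of_fintype]
  obtain ⟨r, hr, hr2⟩ := card_two_torsion_le hB hU
  -- The complement of 2U has rank r = n - 2, so in particular n ≥ 2.
  have hrn : (n : ℤ) - 2 = r := by
    have := hsig.rank
    omega
  have hr2' : (Nat.card {x : Disc B // (2 : ℤ) • x = 0} : ℚ) ≤ 2 ^ r := by exact_mod_cast hr2
  rcases isEmpty_or_nonempty (ReflClass B t) with hemp | ⟨⟨c₀⟩⟩
  · rw [Finset.sum_of_isEmpty]
    cases t <;> simp only [bound] <;> positivity
  have hp : ∀ c, IsPrimitiveVec (rep c).1 := fun c => (rep c).2.1.primitive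
  have hd : ∀ c, divisor B (rep c).1 = divisor B (rep c₀).1 := fun c =>
    divisor_eq_of_typeCondition hB (rep c₀).2.2 (rep c).2.2
  have hl : ∀ c, B (rep c).1 (rep c).1 = -((divisor B (rep c₀).1 * t.index : ℕ) : ℤ) := fun c => by
    rw [(divisor_pos_and_norm_eq (rep c).2.2).2, hd]
  have hd0 := (divisor_pos_and_norm_eq (rep c₀).2.2).1
  have h0 := (rep c₀).2.2
  cases t with
  | AI =>
    have := sum_discRatio_le_AI hB hN (fun c => (rep c).1) (hinj rep hrep)
      (fun c => (rep c).2.2.2.2) (fun c => (rep c).2.2.2.1)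
    exact this.trans (by norm_num [bound])
  | AII =>
    have := sum_discRatio_le_AII hB hN (fun c => (rep c).1) (hinj rep hrep) hp
      (fun c => (rep c).2.2.2.2) (fun c => (rep c).2.2.2.1)
    refine this.trans ?_
    rw [bound, hrn, zpow_natCast]
    exact hr2'
  | BI =>
    obtain ⟨-, D, m, hD, -, -, h2⟩ := h0
    have := sum_discRatio_le_BI hB hN (fun c => (rep c).1) (hinj rep hrep) hinj' hp
      (fun c => (rep c).2.2.1.1) (h2 ▸ hD) hd hl
    exact this.trans (by norm_num [bound])
  | BII =>
    obtain ⟨-, D, m, hD, ⟨φ⟩, -, h2⟩ := h0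
    have := sum_discRatio_le_BII hB hN (fun c => (rep c).1) (hinj rep hrep) hp
      (fun c => (rep c).2.2.1.1) hd0 hd hl (card_disc_le h2 hd0 φ)
    refine this.trans ?_
    -- The sum is at most 64 · 2|A_L[2]| ≤ 2^(r+7), which lies below 2^(n+6) = 2^(r+8).
    rw [bound, show (n : ℤ) + 6 = ((r + 8 : ℕ) : ℤ) by push_cast; omega, zpow_natCast, pow_add]
    push_cast
    have : (0 : ℚ) < 2 ^ r := by positivity
    linarith
  | BIII =>
    obtain ⟨-, D, hD, ⟨φ⟩, hodd, -, h2⟩ := h0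
    have := sum_discRatio_le_BIII hB hN (fun c => (rep c).1) (hinj rep hrep) hinj' hp
      (h2 ▸ hD) (h2 ▸ hodd) (by rw [Nat.card_congr φ.toEquiv, Nat.card_zmod, h2]) hd hl
    exact this.trans (by norm_num [bound])
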